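/- Let $(\lambda_t)_{t\in\mathbb Z}$ and $(\epsilon_{it})_{i\in\{0,1,2,\dots\},\,t\in\mathbb Z}$ be random variables, all independent of each other, with $\lambda_t\sim N(0,\sigma_\lambda^2)$ and $\epsilon_{it}\sim N(0,\sigma^2)$, where $\sigma_\lambda,\sigma>0$. Untreated outcomes are $y^N_{it}=\lambda_t+\epsilon_{it}$ and treated outcomes are $y^I_{it}=\alpha_{it}+y^N_{it}$ with non-random $\alpha_{it}$. Unit $0$ is treated in the periods $t\ge 1$ and no other unit is ever treated, so that the observed outcomes are $y_{0t}=y^I_{0t}$ for $t\ge1$ and $y_{it}=y^N_{it}$ otherwise. The pre-treatment periods are $t\in\mathcal T_0=\{-T_0+1,\dots,0\}$, and there are $J=J(T_0)$ control units $1,\dots,J$; write $\mathbf y_t=(y_{1t},\dots,y_{Jt})'$. Assume that, as $T_0\to\infty$, $J\to\infty$ and $J/T_0\to c\in[0,1)$. Let $$\widehat{\mathbf b}\in\operatorname*{argmin}_{\mathbf b\in\mathbb R^J}\frac1{T_0}\sum_{t\in\mathcal T_0}(y_{0t}-\mathbf b'\mathbf y_t)^2,\qquad \widehat{\mathbf w}\in\operatorname*{argmin}_{\mathbf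 w\ge 0,\ \sum_j w_j=1}\frac1{T_0}\sum_{t\in\mathcal T_0}(y_{0t}-\mathbf w'\mathbf y_t)^2$$ be (measurable) unrestricted-OLS and synthetic control (SC) weights, and, for $t\ge1$, let $\widehat\alpha^{\mathrm{OLS}}_{0t}=y_{0t}-\mathbf y_t'\widehat{\mathbf b}$ and $\widehat\alpha^{\mathrm{SC}}_{0t}=y_{0t}-\mathbf y_t'\widehat{\mathbf w}$. Then, as $T_0\to\infty$: 1. $\widehat{\mathbf b}'\widehat{\mathbf b}$ converges in probability to $c/(1-c)$. 2. For every $t\ge1$, $\widehat\alpha^{\mathrm{OLS}}_{0t}$ converges in distribution to $N\!\left(\alpha_{0t},\,\sigma^2/(1-c)\right)$. 3. For every $t\ge1$, $\widehat\alpha^{\mathrm{SC}}_{0t}$ converges in distribution to $N(\alpha_{0t},\sigma^2)$. 4. Consequently the asymptotic variance of $\widehat\alpha^{\mathrm{OLS}}_{0t}$ equals that of $\widehat\alpha^{\mathrm{SC}}_{0t}$ if $c=0$ and is strictly larger if $c>0$, and it diverges to $+\infty$ as $c\uparrow1$. -/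

import Mathlib

open MeasureTheory ProbabilityTheory Filter Topology

namespace SyntheticControl

noncomputable section

variable {Ω : Type*}

/-- Untreated potential outcome `y_{it}^N = λ_t + ε_{it}` of unit `i` at time `t`: one common factor
with loading equal to `1` for every unit. -/
def untreatedOutcome (lam : ℤ → Ω → ℝ) (eps : ℕ → ℤ → Ω → ℝ) (i : ℕ) (t : ℤ) (ω : Ω) : ℝ :=
  lam t ω + eps i t ω

/-- Treated potential outcome `y_{it}^I = α_{it} + y_{it}^N`. -/
def treatedOutcome (α : ℕ → ℤ → ℝ) (lam : ℤ → Ω → ℝ) (eps : ℕ → ℤ → Ω → ℝ)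
    (i : ℕ) (t : ℤ) (ω : Ω) : ℝ :=
  α i t + untreatedOutcome lam eps i t ω

/-- Treatment indicator `d_{it}`: unit `0` is treated after time `0`, nobody else ever is. -/
def treatment (i : ℕ) (t : ℤ) : ℝ :=
  if i = 0 ∧ 0 < t then 1 else 0

/-- Observed outcome `y_{it} = d_{it} y_{it}^I + (1 - d_{it}) y_{it}^N`. -/
def outcome (α : ℕ → ℤ → ℝ) (lam : ℤ → Ω → ℝ) (eps : ℕ → ℤ → Ω → ℝ)
    (i : ℕ) (t : ℤ) (ω : Ω) : ℝ :=
  treatment i t * treatedOutcome α lam eps i t ω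
    + (1 - treatment i t) * untreatedOutcome lam eps i t ω

/-- The `T₀` pre-treatment periods `-T₀ + 1, …, -1, 0`. -/
def prePeriods (T₀ : ℕ) : Finset ℤ :=
  Finset.Ioc (-(T₀ : ℤ)) 0

/-- The combination `b' y_t = ∑_{j = 1}^{J} b_j y_{jt}` of the outcomes `y : unit → time → ℝ` of the
`J` control units `1, …, J` at time `t`; the entry `j : Fin J` of `b` belongs to unit `j + 1`. -/
def controlOutcome (y : ℕ → ℤ → ℝ) {J : ℕ} (b : Fin J → ℝ) (t : ℤ) : ℝ :=
  ∑ j : Fin J, b j * y ((j : ℕ) + 1) t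

/-- The pre-treatment mean squared residual `(1 / T₀) ∑_t (y_{0t} - b' y_t)²`. -/
def preTreatmentLoss (y : ℕ → ℤ → ℝ) (T₀ J : ℕ) (b : Fin J → ℝ) : ℝ :=
  (1 / (T₀ : ℝ)) * ∑ t ∈ prePeriods T₀, (y 0 t - controlOutcome y b t) ^ 2

/-- `b` is a vector of unrestricted OLS weights: it minimizes the loss over `ℝ^J`. -/
def IsOLSWeights (y : ℕ → ℤ → ℝ) (T₀ J : ℕ) (b : Fin J → ℝ) : Prop :=
  IsMinOn (preTreatmentLoss y T₀ J) Set.univ b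

/-- `w` is a vector of synthetic control weights: it minimizes the loss over the weights that are
non-negative and sum to one. -/
def IsSCWeights (y : ℕ → ℤ → ℝ) (T₀ J : ℕ) (w : Fin J → ℝ) : Prop :=
  w ∈ stdSimplex ℝ (Fin J) ∧ IsMinOn (preTreatmentLoss y T₀ J) (stdSimplex ℝ (Fin J)) w

/-- The estimator `y_{0t} - b' y_t` of the treatment effect `α_{0t}` from weights `b`. -/
def effectEstimator (y : ℕ → ℤ → ℝ) {J : ℕ} (b : Fin J → ℝ) (t : ℤ) : ℝ :=
  y 0 t - controlOutcome y b t

end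

end SyntheticControl

/-!
The weights depend on pre-treatment shocks only, whereas `y_{0t} - b'y_t - α_{0t}` is, for `t ≥ 1`, the
linear form `(1 - ∑ b_j) λ_t + ε_{0t} - ∑ b_j ε_{jt}` in the independent shocks of period `t`. Given the
weights, the estimator is therefore Gaussian with mean `α_{0t}` and variance
`V(b) = σ² (1 + b'b) + σ_λ² (1 - ∑ b_j)²` (`predictionVar`). If `V(b)` converges in probability to a
constant `a`, the characteristic functions converge to that of `N(α_{0t}, a)`
(`IsGaussianModel.tendstoInDistribution_effectEstimator`). What remains is the limit of `V`, which is
`σ² / (1 - c)` for OLS and `σ²` for synthetic control.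

*OLS.* The coefficients are not analysed directly. Let `M` be the residual maker of the control
outcomes over the pre-treatment periods and one further period `t`. The leave-one-out identity
(`residualMaker_mulVec_none`) expresses the prediction error of period `t` as `(M y)_t / M_tt`. The mean
of the controls is `λ` plus averaged noise and is annihilated by `M`, so that `M λ` is minus `M` applied
to averaged noise, and is negligible (`tendstoInMeasure_residual_noiseMean`). Up to that term the error
is, given the controls, centred Gaussian with variance `σ² / M_tt`. The law of `M` is invariant under
rotations of the observations; this determines the first two moments of its diagonal entries
(`integral_residualMaker_diag_sq`) and gives `M_tt → 1 - c` in probability. Computing the characteristic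
function of the same prediction error in these two ways identifies the limit of the Laplace transform
of `V(b)`, whence `V(b) → σ² / (1 - c)` (`tendstoInMeasure_predictionVar_ols`).

To extract `b'b` it has to be shown that `∑ b_j → 1`. The error `1 - ∑ b_j` is `⟨k, ε̄ - ε_0⟩` with
`k = X (XᵀX)⁻¹ 1`, where `ε̄` is the cross-sectional mean of the noise, and `|k|²` is at most the inverse
of the squared length of the part of `λ` that is orthogonal to the noise of the controls
(`sumVec_sq_mul_le`). By rotation invariance that squared length is of order `n (1 - c) σ_λ²`, so
`|k|² = O(1 / n)` and the inner product vanishes in the limit.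

*Synthetic control.* On the simplex the factor cancels from the residuals, and the loss is a quadratic
form in the sample covariance matrix of the idiosyncratic shocks. By Chernoff bounds all its entries
are uniformly close to those of `σ² I`, because there are only polynomially many of them
(`IsGaussianModel.tendsto_measure_gram`). Since a point of the simplex has `ℓ¹` norm one, the loss is
uniformly close to `σ² (1 + w'w)`, and comparison with equal weights forces `w'w → 0`. That the weights
are a function of pre-treatment data follows from uniqueness of the minimizer, which holds almost surely
since Gaussian regressors are almost surely linearly independent (`ae_isUnit_det_gram`).
-/

namespace SyntheticControl

open Matrix
open scoped NNReal ENNReal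

/-! ### Residual makers and least squares -/

section LinearAlgebra

variable {ι κ τ : Type*} [Fintype ι] [Fintype κ] [Fintype τ]
  [DecidableEq ι] [DecidableEq κ] [DecidableEq τ]

/-- The residual maker `1 - X (XᵀX)⁻¹ Xᵀ` of a regressor matrix: the orthogonal projection onto the
complement of the column space of `X` whenever the Gram matrix `XᵀX` is invertible. For a singular Gram
matrix the inverse is `0` by convention and the definition returns the identity. -/
noncomputable def residualMaker (X : Matrix ι κ ℝ) : Matrix ι ι ℝ :=
  1 - X * (Xᵀ * X)⁻¹ * Xᵀ

omit [DecidableEq ι] in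
lemma dotProduct_self_nonneg (v : ι → ℝ) : 0 ≤ v ⬝ᵥ v :=
  Finset.sum_nonneg fun _ _ => mul_self_nonneg _

omit [DecidableEq ι] in
lemma mulVec_eq_zero_of_gram {X : Matrix ι κ ℝ} (hX : IsUnit (Xᵀ * X).det) {v : κ → ℝ}
    (hv : X *ᵥ v = 0) : v = 0 := by
  have h : (Xᵀ * X) *ᵥ v = 0 := by rw [← mulVec_mulVec, hv, mulVec_zero]
  have h2 : ((Xᵀ * X)⁻¹ * (Xᵀ * X)) *ᵥ v = 0 := by rw [← mulVec_mulVec, h, mulVec_zero]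
  rwa [nonsing_inv_mul _ hX, one_mulVec] at h2

omit [DecidableEq ι] in
lemma isUnit_det_gram {X : Matrix ι κ ℝ} (hX : ∀ v, X *ᵥ v = 0 → v = 0) :
    IsUnit (Xᵀ * X).det := by
  rw [isUnit_iff_ne_zero]
  intro h
  obtain ⟨v, hv, hv0⟩ := exists_mulVec_eq_zero_iff.2 h
  refine hv (hX v ?_)
  have h1 : (X *ᵥ v) ⬝ᵥ (X *ᵥ v) = 0 := by
    rw [dotProduct_mulVec, vecMul_mulVec, ← dotProduct_mulVec, hv0, dotProduct_zero]
  exact dotProduct_self_eq_zero.1 h1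

lemma residualMaker_transpose (X : Matrix ι κ ℝ) : (residualMaker X)ᵀ = residualMaker X := by
  simp [residualMaker, transpose_sub, transpose_mul, transpose_nonsing_inv, Matrix.mul_assoc]

lemma residualMaker_mul {X : Matrix ι κ ℝ} (hX : IsUnit (Xᵀ * X).det) :
    residualMaker X * X = 0 := by
  rw [residualMaker, Matrix.sub_mul, Matrix.one_mul, Matrix.mul_assoc, Matrix.mul_assoc,
    nonsing_inv_mul _ hX, Matrix.mul_one, sub_self]

lemma residualMaker_mul_self {X : Matrix ι κ ℝ} (hX : IsUnit (Xᵀ * X).det) :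
    residualMaker X * residualMaker X = residualMaker X := by
  conv_lhs => rw [show residualMaker X * residualMaker X
    = residualMaker X * (1 - X * (Xᵀ * X)⁻¹ * Xᵀ) from rfl]
  rw [Matrix.mul_sub, Matrix.mul_one, ← Matrix.mul_assoc, ← Matrix.mul_assoc,
    residualMaker_mul hX, Matrix.zero_mul, Matrix.zero_mul, sub_zero]

lemma trace_residualMaker {X : Matrix ι κ ℝ} (hX : IsUnit (Xᵀ * X).det) :
    (residualMaker X).trace = Fintype.card ι - Fintype.card κ := by
  rw [residualMaker, trace_sub, trace_one, trace_mul_comm, ← Matrix.mul_assoc,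
    mul_nonsing_inv _ hX, trace_one]

lemma residualMaker_mulVec_of_orthogonal {X : Matrix ι κ ℝ} {v : ι → ℝ} (hv : Xᵀ *ᵥ v = 0) :
    residualMaker X *ᵥ v = v := by
  rw [residualMaker, sub_mulVec, one_mulVec, ← mulVec_mulVec, hv, mulVec_zero, sub_zero]

lemma residualMaker_orthogonal_mul {O : Matrix ι ι ℝ} (hO : Oᵀ * O = 1) (X : Matrix ι κ ℝ) :
    residualMaker (O * X) = O * residualMaker X * Oᵀ := by
  have hO' : O * Oᵀ = 1 := mul_eq_one_comm.1 hO
  have h : (O * X)ᵀ * (O * X) = Xᵀ * X := by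
    rw [transpose_mul, Matrix.mul_assoc, ← Matrix.mul_assoc Oᵀ, hO, Matrix.one_mul]
  rw [residualMaker, residualMaker, h, transpose_mul, Matrix.mul_sub, Matrix.sub_mul,
    Matrix.mul_one, hO']
  simp only [Matrix.mul_assoc]

lemma dotProduct_residualMaker {X : Matrix ι κ ℝ} (hX : IsUnit (Xᵀ * X).det) (x : ι → ℝ) :
    x ⬝ᵥ (residualMaker X *ᵥ x) = (residualMaker X *ᵥ x) ⬝ᵥ (residualMaker X *ᵥ x) := by
  conv_lhs => rw [← residualMaker_mul_self hX, ← mulVec_mulVec, dotProduct_mulVec,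
    ← mulVec_transpose, residualMaker_transpose]

lemma dotProduct_residualMaker_nonneg {X : Matrix ι κ ℝ} (hX : IsUnit (Xᵀ * X).det)
    (x : ι → ℝ) : 0 ≤ x ⬝ᵥ (residualMaker X *ᵥ x) := by
  rw [dotProduct_residualMaker hX]
  exact dotProduct_self_nonneg _

lemma dotProduct_residualMaker_le {X : Matrix ι κ ℝ} (hX : IsUnit (Xᵀ * X).det)
    (x : ι → ℝ) : x ⬝ᵥ (residualMaker X *ᵥ x) ≤ x ⬝ᵥ x := by
  have h1 := dotProduct_self_nonneg (x - residualMaker X *ᵥ x)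
  have h2 := dotProduct_residualMaker hX x
  have h3 : (residualMaker X *ᵥ x) ⬝ᵥ x = x ⬝ᵥ (residualMaker X *ᵥ x) := dotProduct_comm _ _
  simp only [sub_dotProduct, dotProduct_sub] at h1
  linarith

lemma residualMaker_mulVec_sq_le {X : Matrix ι κ ℝ} (hX : IsUnit (Xᵀ * X).det)
    (x : ι → ℝ) : (residualMaker X *ᵥ x) ⬝ᵥ (residualMaker X *ᵥ x) ≤ x ⬝ᵥ x :=
  (dotProduct_residualMaker hX x).symm.trans_le (dotProduct_residualMaker_le hX x)

lemma residualMaker_diag {X : Matrix ι κ ℝ} (hX : IsUnit (Xᵀ * X).det) (i : ι) :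
    residualMaker X i i = ∑ j, residualMaker X i j ^ 2 := by
  conv_lhs => rw [← residualMaker_mul_self hX, Matrix.mul_apply]
  refine Finset.sum_congr rfl fun j _ => ?_
  conv_lhs => rw [← residualMaker_transpose X, transpose_apply]
  rw [← transpose_apply (residualMaker X) j i, residualMaker_transpose, sq]

lemma residualMaker_diag_le_one {X : Matrix ι κ ℝ} (hX : IsUnit (Xᵀ * X).det) (i : ι) :
    residualMaker X i i ≤ 1 := by
  have := dotProduct_residualMaker_le hX (Pi.single i 1)
  simpa using this

/-- The leave-one-out identity: the residual of the held-out observation `none` in the regression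
on all rows is its prediction error from the remaining rows, shrunk by the diagonal entry of the
residual maker. -/
lemma residualMaker_mulVec_none {X : Matrix (Option τ) κ ℝ} (hX : IsUnit (Xᵀ * X).det)
    (y : Option τ → ℝ) (b : κ → ℝ)
    (hb : (X.submatrix some id)ᵀ *ᵥ ((fun s => y (some s)) - X.submatrix some id *ᵥ b) = 0) :
    (residualMaker X *ᵥ y) none = residualMaker X none none * (y none - X none ⬝ᵥ b) := by
  -- split the error vector into its pre-part, orthogonal to the regressors, and the entry `none`
  set e : Option τ → ℝ := y - X *ᵥ b with he
  set p : Option τ → ℝ := fun r => r.elim 0 (fun s => e (some s)) with hp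
  have hsplit : e = p + Pi.single none (e none) := by
    funext r; cases r <;> simp [hp]
  have hp0 : Xᵀ *ᵥ p = 0 := by
    funext k
    have := congrFun hb k
    simp only [mulVec, dotProduct, transpose_apply, submatrix_apply, id, Pi.sub_apply,
      Pi.zero_apply] at this ⊢
    rw [Fintype.sum_option]
    simpa [hp, he, mulVec, dotProduct] using this
  have hy : residualMaker X *ᵥ y = residualMaker X *ᵥ e := by
    rw [he, mulVec_sub, mulVec_mulVec, residualMaker_mul hX, zero_mulVec, sub_zero]
  rw [hy, hsplit, mulVec_add, residualMaker_mulVec_of_orthogonal hp0]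
  simp [hp, he, mulVec, dotProduct]

omit [DecidableEq τ] in
lemma isUnit_det_gram_of_submatrix {X : Matrix (Option τ) κ ℝ}
    (hY : IsUnit ((X.submatrix some id)ᵀ * X.submatrix some id).det) : IsUnit (Xᵀ * X).det := by
  refine isUnit_det_gram fun v hv => mulVec_eq_zero_of_gram hY ?_
  funext s
  exact congrFun hv (some s)

/-- An observation is not fitted perfectly if the remaining rows already have full column rank. -/
lemma residualMaker_none_pos {X : Matrix (Option τ) κ ℝ}
    (hY : IsUnit ((X.submatrix some id)ᵀ * X.submatrix some id).det) :
    0 < residualMaker X none none := by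
  have hX := isUnit_det_gram_of_submatrix hY
  have h0 : 0 ≤ residualMaker X none none := by
    have := dotProduct_residualMaker_nonneg hX (Pi.single none 1)
    simpa using this
  refine lt_of_le_of_ne h0 fun h => ?_
  have h1 : residualMaker X *ᵥ Pi.single none 1 = 0 := by
    apply dotProduct_self_eq_zero.1
    rw [← dotProduct_residualMaker hX]
    simpa using h.symm
  rw [residualMaker, sub_mulVec, one_mulVec, ← mulVec_mulVec, ← mulVec_mulVec, sub_eq_zero] at h1
  set v := (Xᵀ * X)⁻¹ *ᵥ (Xᵀ *ᵥ Pi.single none 1)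
  have hv : v = 0 := by
    refine mulVec_eq_zero_of_gram hY ?_
    funext s
    have := congrFun h1 (some s)
    simpa [mulVec, dotProduct] using this.symm
  rw [hv, mulVec_zero] at h1
  simpa using congrFun h1 none

omit [DecidableEq κ] [DecidableEq τ] in
/-- A minimizer of the sum of squared residuals satisfies the normal equations. -/
lemma normal_equations {Y : Matrix τ κ ℝ} {y : τ → ℝ} {b : κ → ℝ}
    (h : ∀ b', (y - Y *ᵥ b) ⬝ᵥ (y - Y *ᵥ b) ≤ (y - Y *ᵥ b') ⬝ᵥ (y - Y *ᵥ b')) :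
    Yᵀ *ᵥ (y - Y *ᵥ b) = 0 := by
  set r := y - Y *ᵥ b with hr
  set g := Yᵀ *ᵥ r with hg
  have key : ∀ s : ℝ, 0 ≤ s ^ 2 * ((Y *ᵥ g) ⬝ᵥ (Y *ᵥ g)) - 2 * s * (g ⬝ᵥ g) := by
    intro s
    have h1 := h (b + s • g)
    have h2 : y - Y *ᵥ (b + s • g) = r - s • (Y *ᵥ g) := by
      rw [mulVec_add, mulVec_smul, hr]; abel
    have h3 : r ⬝ᵥ (Y *ᵥ g) = g ⬝ᵥ g := by
      rw [dotProduct_mulVec, ← mulVec_transpose]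
    have h4 : (Y *ᵥ g) ⬝ᵥ r = g ⬝ᵥ g := by rw [dotProduct_comm, h3]
    rw [h2] at h1
    simp only [sub_dotProduct, dotProduct_sub, smul_dotProduct, dotProduct_smul, smul_eq_mul,
      h3, h4] at h1
    nlinarith
  apply dotProduct_self_eq_zero.1
  by_contra hne
  -- a short step along the gradient `g` would decrease the sum of squares
  have hgp : 0 < g ⬝ᵥ g := lt_of_le_of_ne (dotProduct_self_nonneg _) (Ne.symm hne)
  have hQ : 0 ≤ (Y *ᵥ g) ⬝ᵥ (Y *ᵥ g) := dotProduct_self_nonneg _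
  set Q := (Y *ᵥ g) ⬝ᵥ (Y *ᵥ g)
  have h1 := key ((g ⬝ᵥ g) / (Q + 1))
  have hQ1 : 0 < Q + 1 := by linarith
  have h2 : ((g ⬝ᵥ g) / (Q + 1)) ^ 2 * Q - 2 * ((g ⬝ᵥ g) / (Q + 1)) * (g ⬝ᵥ g)
      = -((g ⬝ᵥ g) ^ 2 * (Q + 2) / (Q + 1) ^ 2) := by field_simp; ring
  rw [h2] at h1
  have : 0 < (g ⬝ᵥ g) ^ 2 * (Q + 2) / (Q + 1) ^ 2 := by positivity
  linarith

omit [DecidableEq τ] in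
lemma eq_of_normal_equations {Y : Matrix τ κ ℝ} (hY : IsUnit (Yᵀ * Y).det) {y : τ → ℝ}
    {b : κ → ℝ} (h : Yᵀ *ᵥ (y - Y *ᵥ b) = 0) : b = (Yᵀ * Y)⁻¹ *ᵥ (Yᵀ *ᵥ y) := by
  rw [mulVec_sub, sub_eq_zero, mulVec_mulVec] at h
  rw [h, mulVec_mulVec, nonsing_inv_mul _ hY, one_mulVec]

/-- Orthogonal matrices act transitively on the unit sphere (by Householder reflections). -/
lemma exists_orthogonal_mulVec_eq {x y : ι → ℝ} (hxy : x ⬝ᵥ x = y ⬝ᵥ y) :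
    ∃ O : Matrix ι ι ℝ, Oᵀ * O = 1 ∧ O *ᵥ x = y := by
  by_cases h : x = y
  · exact ⟨1, by simp, by simp [h]⟩
  set v := x - y with hv
  have hv0 : v ⬝ᵥ v ≠ 0 := fun h0 => h (sub_eq_zero.1 (dotProduct_self_eq_zero.1 h0))
  have hO : ∀ z, (1 - (2 / (v ⬝ᵥ v)) • vecMulVec v v : Matrix ι ι ℝ) *ᵥ z
      = z - (2 / (v ⬝ᵥ v) * (v ⬝ᵥ z)) • v := by
    intro z
    rw [sub_mulVec, one_mulVec, smul_mulVec, vecMulVec_mulVec]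
    funext i
    simp; ring
  refine ⟨1 - (2 / (v ⬝ᵥ v)) • vecMulVec v v, ?_, ?_⟩
  · have ht : (1 - (2 / (v ⬝ᵥ v)) • vecMulVec v v : Matrix ι ι ℝ)ᵀ
        = 1 - (2 / (v ⬝ᵥ v)) • vecMulVec v v := by
      rw [transpose_sub, transpose_one, transpose_smul, transpose_vecMulVec]
    rw [ht]
    clear_value v
    apply Matrix.ext_of_mulVec_single
    intro i
    rw [← mulVec_mulVec, hO, hO, one_mulVec, dotProduct_sub, dotProduct_smul, smul_eq_mul,
      sub_sub, ← add_smul]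
    have : 2 / v ⬝ᵥ v * v ⬝ᵥ Pi.single i 1
        + 2 / v ⬝ᵥ v * (v ⬝ᵥ Pi.single i 1 - 2 / v ⬝ᵥ v * v ⬝ᵥ Pi.single i 1 * v ⬝ᵥ v) = 0 := by
      field_simp; ring
    rw [this, zero_smul, sub_zero]
  · rw [hO]
    have h1 : v ⬝ᵥ v = 2 * (v ⬝ᵥ x) := by
      have : x ⬝ᵥ y = y ⬝ᵥ x := dotProduct_comm _ _
      simp only [hv, sub_dotProduct, dotProduct_sub]
      linarith
    have h2 : 2 / (v ⬝ᵥ v) * (v ⬝ᵥ x) = 1 := by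
      have : v ⬝ᵥ x ≠ 0 := fun h0 => hv0 (by rw [h1, h0, mul_zero])
      rw [h1]; field_simp
    rw [h2, one_smul, hv]; abel

end LinearAlgebra

/-! ### Gaussian vectors and Gaussian data arrays -/

section Gaussian

/-- The law of a vector of independent centred Gaussian variables with variances `v i`. -/
noncomputable abbrev gaussianVec {ι : Type*} [Fintype ι] (v : ι → ℝ≥0) : Measure (ι → ℝ) :=
  Measure.pi fun i => gaussianReal 0 (v i)

lemma integral_cexp_dotProduct_gaussianVec {ι : Type*} [Fintype ι] (v : ι → ℝ≥0) (a : ι → ℝ) :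
    ∫ z, Complex.exp (((a ⬝ᵥ z : ℝ) : ℂ) * Complex.I) ∂gaussianVec v
      = Complex.exp ((-(∑ i, (v i : ℝ) * a i ^ 2) / 2 : ℝ) : ℂ) := by
  have h : ∀ z : ι → ℝ, Complex.exp (((a ⬝ᵥ z : ℝ) : ℂ) * Complex.I)
      = ∏ i, Complex.exp ((a i : ℂ) * (z i : ℂ) * Complex.I) := by
    intro z
    rw [← Complex.exp_sum, dotProduct, Complex.ofReal_sum, Finset.sum_mul]
    simp
  simp_rw [h]
  rw [integral_fintype_prod_eq_prod
    (f := fun i (x : ℝ) => Complex.exp ((a i : ℂ) * (x : ℂ) * Complex.I))]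
  have h2 : ∀ i, ∫ x, Complex.exp ((a i : ℂ) * (x : ℂ) * Complex.I) ∂gaussianReal 0 (v i)
      = Complex.exp (-((v i : ℝ) * a i ^ 2 / 2 : ℝ)) := by
    intro i
    have := charFun_gaussianReal (μ := 0) (v := v i) (a i)
    rw [charFun_apply_real] at this
    rw [this]
    congr 1
    push_cast
    ring
  simp_rw [h2]
  rw [← Complex.exp_sum]
  congr 1
  push_cast
  rw [neg_div, Finset.sum_div, Finset.sum_neg_distrib]

variable {Ω : Type*} [MeasurableSpace Ω] {P : Measure Ω} [IsProbabilityMeasure P]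

/-- Integrating out a centred Gaussian vector `Z` independent of `W`: conditionally on `W`, the
linear form `⟨f(W), Z⟩` is centred Gaussian with variance `∑ i, v i * f(W) i ^ 2`. -/
lemma integral_cexp_gaussian_mixture {ι 𝓦 : Type*} [Fintype ι] [MeasurableSpace 𝓦] {W : Ω → 𝓦}
    {Z : Ω → ι → ℝ} {v : ι → ℝ≥0} (hW : AEMeasurable W P) (hZ : HasLaw Z (gaussianVec v) P)
    (hWZ : IndepFun W Z P) {f : 𝓦 → ι → ℝ} (hf : Measurable f) :
    ∫ ω, Complex.exp (((f (W ω) ⬝ᵥ Z ω : ℝ) : ℂ) * Complex.I) ∂P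
      = ((∫ ω, Real.exp (-(∑ i, (v i : ℝ) * f (W ω) i ^ 2) / 2) ∂P : ℝ) : ℂ) := by
  have hf' : ∀ i, Measurable fun w => f w i := fun i => (measurable_pi_apply i).comp hf
  have hZm : AEMeasurable Z P := hZ.aemeasurable
  have hmeas : Measurable fun p : 𝓦 × (ι → ℝ) =>
      Complex.exp (((f p.1 ⬝ᵥ p.2 : ℝ) : ℂ) * Complex.I) := by
    have : Measurable fun p : 𝓦 × (ι → ℝ) => f p.1 ⬝ᵥ p.2 :=
      Finset.measurable_sum _ fun i _ => ((hf' i).comp measurable_fst).mul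
        ((measurable_pi_apply i).comp measurable_snd)
    fun_prop
  have h1 : ∫ ω, Complex.exp (((f (W ω) ⬝ᵥ Z ω : ℝ) : ℂ) * Complex.I) ∂P
      = ∫ p, Complex.exp (((f p.1 ⬝ᵥ p.2 : ℝ) : ℂ) * Complex.I)
        ∂(P.map W).prod (gaussianVec v) := by
    rw [← hZ.map_eq, ← hWZ.map_prod_eq_prod_map_map hW hZm,
      integral_map (hW.prodMk hZm) hmeas.aestronglyMeasurable]
  have : IsProbabilityMeasure (P.map W) := Measure.isProbabilityMeasure_map hW
  rw [h1, integral_prod]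
  · simp_rw [integral_cexp_dotProduct_gaussianVec, ← Complex.ofReal_exp]
    rw [integral_complex_ofReal, integral_map hW]
    refine (Measurable.aestronglyMeasurable ?_)
    fun_prop
  · refine Integrable.of_bound hmeas.aestronglyMeasurable 1 (ae_of_all _ fun p => ?_)
    rw [Complex.norm_exp_ofReal_mul_I]

/-- A conditional probability bound valid for every value of `W` in `A` integrates to an
unconditional one. -/
lemma measure_le_of_forall_section_le {𝓦 𝓧 : Type*} [MeasurableSpace 𝓦]
    [MeasurableSpace 𝓧] {W : Ω → 𝓦} {X : Ω → 𝓧} (hW : AEMeasurable W P) (hX : AEMeasurable X P)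
    (hWX : IndepFun W X P) {S : Set (𝓦 × 𝓧)} (hS : MeasurableSet S) {A : Set 𝓦}
    (hA : MeasurableSet A) {C : ℝ≥0∞}
    (h : ∀ w ∈ A, P {ω | (w, X ω) ∈ S} ≤ C) :
    P {ω | (W ω, X ω) ∈ S} ≤ P {ω | W ω ∉ A} + C := by
  have h1 : P {ω | (W ω, X ω) ∈ S} = ((P.map W).prod (P.map X)) S := by
    rw [← hWX.map_prod_eq_prod_map_map hW hX, Measure.map_apply_of_aemeasurable (hW.prodMk hX) hS]
    rfl
  rw [h1, Measure.prod_apply hS]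
  have hsec : ∀ w, (P.map X) (Prod.mk w ⁻¹' S) = P {ω | (w, X ω) ∈ S} := fun w => by
    rw [Measure.map_apply_of_aemeasurable hX (measurable_prodMk_left hS)]
    rfl
  calc ∫⁻ w, (P.map X) (Prod.mk w ⁻¹' S) ∂P.map W
      ≤ ∫⁻ w, (Aᶜ.indicator 1 w + C) ∂P.map W := by
        refine lintegral_mono fun w => ?_
        rw [hsec]
        by_cases hw : w ∈ A
        · exact (h w hw).trans (by simp)
        · refine prob_le_one.trans ?_
          simp [Set.indicator, hw]
    _ ≤ P {ω | W ω ∉ A} + C := by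
        rw [lintegral_add_right _ measurable_const, lintegral_indicator_one hA.compl,
          lintegral_const, Measure.map_apply_of_aemeasurable hW hA.compl,
          Measure.map_apply_of_aemeasurable hW MeasurableSet.univ]
        simp only [Set.preimage_univ, measure_univ, mul_one]
        exact le_rfl

variable {ι κ' κ : Type*} [Fintype ι] [Fintype κ'] [Fintype κ]

/-- The action of a matrix on the observation index `i` of a data array `z (k, i)`. -/
def rotateData (O : Matrix ι ι ℝ) (z : κ' × ι → ℝ) : κ' × ι → ℝ :=
  fun p => ∑ j, O p.2 j * z (p.1, j)

omit [Fintype κ'] in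
lemma measurable_rotateData (O : Matrix ι ι ℝ) :
    Measurable (rotateData O : (κ' × ι → ℝ) → κ' × ι → ℝ) := by
  unfold rotateData; fun_prop

/-- Rotating the observations preserves the law, since within each data column the entries are
independent with the same variance. -/
lemma map_rotateData_gaussianVec [DecidableEq ι] {O : Matrix ι ι ℝ} (hO : Oᵀ * O = 1)
    (v : κ' → ℝ≥0) :
    (gaussianVec fun p : κ' × ι => v p.1).map (rotateData O) = gaussianVec fun p => v p.1 := by
  classical
  have : IsProbabilityMeasure ((gaussianVec fun p : κ' × ι => v p.1).map (rotateData O)) :=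
    Measure.isProbabilityMeasure_map (measurable_rotateData O).aemeasurable
  refine Measure.ext_of_charFunDual ?_
  funext L
  set a : κ' × ι → ℝ := fun p => L (Pi.single p 1) with ha
  have hL : ∀ z, L z = a ⬝ᵥ z := by
    intro z
    conv_lhs => rw [pi_eq_sum_univ' z]
    rw [map_sum]
    refine Finset.sum_congr rfl fun p _ => ?_
    rw [map_smul, smul_eq_mul, mul_comm, ha]
  have hL2 : ∀ z, L (rotateData O z) = (fun p : κ' × ι => ∑ i, a (p.1, i) * O i p.2) ⬝ᵥ z := by
    intro z
    rw [hL]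
    simp only [dotProduct, rotateData, Fintype.sum_prod_type, Finset.mul_sum, Finset.sum_mul]
    refine Finset.sum_congr rfl fun k _ => ?_
    rw [Finset.sum_comm]
    exact Finset.sum_congr rfl fun i _ => Finset.sum_congr rfl fun j _ => by ring
  rw [charFunDual_apply, charFunDual_apply, integral_map (measurable_rotateData O).aemeasurable
    (by fun_prop)]
  simp_rw [hL2, hL]
  rw [integral_cexp_dotProduct_gaussianVec, integral_cexp_dotProduct_gaussianVec]
  have key : ∀ k, ∑ j, (∑ i, a (k, i) * O i j) ^ 2 = ∑ i, a (k, i) ^ 2 := by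
    intro k
    have hO' : O * Oᵀ = 1 := mul_eq_one_comm.1 hO
    have h1 : ((fun i => a (k, i)) ᵥ* O) ⬝ᵥ ((fun i => a (k, i)) ᵥ* O)
        = (fun i => a (k, i)) ⬝ᵥ (fun i => a (k, i)) := by
      conv_lhs => rw [← mulVec_transpose O, dotProduct_mulVec, vecMul_mulVec,
        transpose_transpose, hO', vecMul_one]
    simpa [dotProduct, vecMul, sq] using h1
  have hsum : ∑ p : κ' × ι, (v p.1 : ℝ) * (∑ i, a (p.1, i) * O i p.2) ^ 2
      = ∑ p : κ' × ι, (v p.1 : ℝ) * a p ^ 2 := by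
    simp_rw [Fintype.sum_prod_type, ← Finset.mul_sum, key]
  rw [hsum]

/-- The matrix whose columns are the linear combinations of the data columns `z (k, ·)` given by
the columns of `B`. -/
def designMatrix (B : Matrix κ' κ ℝ) (z : κ' × ι → ℝ) : Matrix ι κ ℝ :=
  (Matrix.of fun i k => z (k, i)) * B

omit [Fintype κ] in
lemma designMatrix_rotateData (B : Matrix κ' κ ℝ) (O : Matrix ι ι ℝ) (z : κ' × ι → ℝ) :
    designMatrix B (rotateData O z) = O * designMatrix B z := by
  rw [designMatrix, designMatrix, ← Matrix.mul_assoc]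
  rfl

omit [Fintype κ] [Fintype ι] in
@[fun_prop]
lemma continuous_designMatrix (B : Matrix κ' κ ℝ) :
    Continuous (designMatrix B : (κ' × ι → ℝ) → Matrix ι κ ℝ) := by
  unfold designMatrix
  refine Continuous.matrix_mul ?_ continuous_const
  exact continuous_matrix fun i k => continuous_apply _

/-- A finite product of absolutely continuous measures is absolutely continuous. -/
lemma pi_absolutelyContinuous {ι : Type*} [Fintype ι] {μ ν : ι → Measure ℝ}
    [∀ i, SigmaFinite (μ i)] [∀ i, SigmaFinite (ν i)] (h : ∀ i, μ i ≪ ν i) :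
    Measure.pi μ ≪ Measure.pi ν := by
  have hfin : ∀ (n : ℕ) (μ ν : Fin n → Measure ℝ) [∀ i, SigmaFinite (μ i)]
      [∀ i, SigmaFinite (ν i)], (∀ i, μ i ≪ ν i) → Measure.pi μ ≪ Measure.pi ν := by
    intro n
    induction n with
    | zero =>
      intro μ ν _ _ _
      rw [Measure.pi_of_empty μ, Measure.pi_of_empty ν]
    | succ n ih =>
      intro μ ν _ _ h
      have h1 := (measurePreserving_piFinSuccAbove μ 0).symm.map_eq
      have h2 := (measurePreserving_piFinSuccAbove ν 0).symm.map_eq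
      rw [← h1, ← h2]
      refine Measure.AbsolutelyContinuous.map ?_ (MeasurableEquiv.measurable _)
      exact (h 0).prod (ih _ _ fun j => h _)
  let e := (Fintype.equivFin ι).symm
  have h1 := (measurePreserving_piCongrLeft μ e).map_eq
  have h2 := (measurePreserving_piCongrLeft ν e).map_eq
  rw [← h1, ← h2]
  exact (hfin _ _ _ fun i => h _).map (MeasurableEquiv.measurable _)

lemma measurableSet_isUnit_det_gram [DecidableEq κ] (B : Matrix κ' κ ℝ) :
    MeasurableSet {z : κ' × ι → ℝ | IsUnit ((designMatrix B z)ᵀ * designMatrix B z).det} := by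
  have hc : Continuous fun z : κ' × ι → ℝ => ((designMatrix B z)ᵀ * designMatrix B z).det :=
    (((continuous_designMatrix B).matrix_transpose).matrix_mul
      (continuous_designMatrix B)).matrix_det
  simp_rw [isUnit_iff_ne_zero]
  exact (isOpen_compl_singleton.preimage hc).measurableSet

/-- With at least as many observations as regressors, Gaussian regressors are almost surely
linearly independent: along a suitable line in data space, the determinant of a selected square
block is a characteristic polynomial, so that it vanishes at finitely many points only. -/
lemma ae_isUnit_det_gram [DecidableEq κ] [DecidableEq ι] {v : κ' → ℝ≥0} (hv : ∀ k, v k ≠ 0)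
    {B : Matrix κ' κ ℝ} {C : Matrix κ κ' ℝ} (hC : C * B = 1)
    (hcard : Fintype.card κ ≤ Fintype.card ι) :
    ∀ᵐ z ∂gaussianVec (fun p : κ' × ι => v p.1),
      IsUnit ((designMatrix B z)ᵀ * designMatrix B z).det := by
  have hac : gaussianVec (fun p : κ' × ι => v p.1) ≪ (volume : Measure (κ' × ι → ℝ)) :=
    pi_absolutelyContinuous fun p => gaussianReal_absolutelyContinuous _ (hv _)
  refine hac.ae_le ?_
  obtain ⟨f⟩ : Nonempty (κ ↪ ι) := Function.Embedding.nonempty_of_card_le hcard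
  -- the direction `d` of the line, and the selection `R` of the rows `f j`
  let d : κ' × ι → ℝ := fun p => ∑ j, if f j = p.2 then C j p.1 else 0
  let R : Matrix κ ι ℝ := Matrix.of fun j i => if i = f j then 1 else 0
  have hRd : R * designMatrix B d = 1 := by
    have : R * (Matrix.of fun i k => d (k, i)) = C := by
      ext j k
      simp [R, d, Matrix.mul_apply]
    rw [designMatrix, ← Matrix.mul_assoc, this, hC]
  have hline : ∀ (z : κ' × ι → ℝ) (x : ℝ),
      designMatrix B (z + x • d) = designMatrix B z + x • designMatrix B d := by
    intro z x
    rw [designMatrix, designMatrix, designMatrix, ← Matrix.smul_mul, ← Matrix.add_mul]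
    rfl
  refine ae_mem_of_ae_add_linearMap_mem (LinearMap.toSpanSingleton ℝ (κ' × ι → ℝ) d)
    (volume : Measure ℝ) volume (measurableSet_isUnit_det_gram B) fun z => ?_
  set A := R * designMatrix B z with hA
  have hroots : {x : ℝ | (-A).charpoly.IsRoot x}.Finite :=
    (-A).charpoly.finite_setOfPred_isRoot (Matrix.charpoly_monic _).ne_zero
  filter_upwards [hroots.countable.ae_notMem (volume : Measure ℝ)] with x hx
  change IsUnit ((designMatrix B (z + x • d))ᵀ * designMatrix B (z + x • d)).det
  rw [hline]
  refine isUnit_det_gram fun u hu => ?_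
  have h1 : (R * (designMatrix B z + x • designMatrix B d)) *ᵥ u = 0 := by
    rw [← mulVec_mulVec, hu, mulVec_zero]
  rw [Matrix.mul_add, Matrix.mul_smul, hRd, ← hA] at h1
  by_contra hu0
  refine hx ?_
  rw [Polynomial.IsRoot.def, Matrix.eval_charpoly]
  refine Matrix.exists_mulVec_eq_zero_iff.1 ⟨u, hu0, ?_⟩
  rw [← h1, sub_neg_eq_add, add_comm, Matrix.scalar_apply, Matrix.smul_one_eq_diagonal]

lemma map_dotProduct_gaussianVec {ι : Type*} [Fintype ι] (v : ι → ℝ≥0) (a : ι → ℝ) :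
    (gaussianVec v).map (fun z => a ⬝ᵥ z)
      = gaussianReal 0 (∑ i, (v i : ℝ) * a i ^ 2).toNNReal := by
  have hm : Measurable fun z : ι → ℝ => a ⬝ᵥ z :=
    Finset.measurable_sum _ fun i _ => (measurable_pi_apply i).const_mul _
  have : IsProbabilityMeasure ((gaussianVec v).map (fun z => a ⬝ᵥ z)) :=
    Measure.isProbabilityMeasure_map hm.aemeasurable
  have h0 : 0 ≤ ∑ i, (v i : ℝ) * a i ^ 2 := by positivity
  refine Measure.ext_of_charFun ?_
  funext t
  rw [charFun_apply_real, integral_map hm.aemeasurable (by fun_prop), charFun_gaussianReal,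
    Real.coe_toNNReal _ h0]
  have h := integral_cexp_dotProduct_gaussianVec v (t • a)
  simp only [smul_dotProduct, smul_eq_mul, Complex.ofReal_mul, Pi.smul_apply] at h
  rw [h]
  congr 1
  push_cast
  simp_rw [mul_pow, Finset.sum_mul]
  simp only [mul_zero, zero_mul, zero_sub, neg_div]
  congr 2
  exact Finset.sum_congr rfl fun i _ => by ring

lemma integrable_dotProduct_sq_gaussianVec {ι : Type*} [Fintype ι] (v : ι → ℝ≥0) (a : ι → ℝ) :
    Integrable (fun z => (a ⬝ᵥ z) ^ 2) (gaussianVec v) := by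
  have hm : Measurable fun z : ι → ℝ => a ⬝ᵥ z :=
    Finset.measurable_sum _ fun i _ => (measurable_pi_apply i).const_mul _
  have h : Integrable (fun x : ℝ => x ^ 2) ((gaussianVec v).map (fun z => a ⬝ᵥ z)) := by
    rw [map_dotProduct_gaussianVec]
    exact (memLp_id_gaussianReal 2).integrable_sq
  exact h.comp_measurable hm

lemma integral_dotProduct_sq_gaussianVec {ι : Type*} [Fintype ι] (v : ι → ℝ≥0) (a : ι → ℝ) :
    ∫ z, (a ⬝ᵥ z) ^ 2 ∂gaussianVec v = ∑ i, (v i : ℝ) * a i ^ 2 := by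
  have hm : Measurable fun z : ι → ℝ => a ⬝ᵥ z :=
    Finset.measurable_sum _ fun i _ => (measurable_pi_apply i).const_mul _
  have h0 : 0 ≤ ∑ i, (v i : ℝ) * a i ^ 2 := by positivity
  have h := variance_id_gaussianReal (μ := 0) (v := (∑ i, (v i : ℝ) * a i ^ 2).toNNReal)
  rw [variance_of_integral_eq_zero aemeasurable_id (by simp), Real.coe_toNNReal _ h0,
    ← map_dotProduct_gaussianVec, integral_map hm.aemeasurable (by fun_prop)] at h
  exact h

end Gaussian

/-! ### Measurability of matrix expressions -/

section Measurability

variable {𝓧 : Type*} [MeasurableSpace 𝓧] {m n p : Type*} [Fintype n]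

lemma measurable_matrix_mul_apply {A : 𝓧 → Matrix m n ℝ} {B : 𝓧 → Matrix n p ℝ}
    (hA : ∀ i j, Measurable fun x => A x i j) (hB : ∀ i j, Measurable fun x => B x i j)
    (i : m) (j : p) : Measurable fun x => (A x * B x) i j := by
  simp only [Matrix.mul_apply]
  exact Finset.measurable_sum _ fun k _ => (hA i k).mul (hB k j)

lemma measurable_mulVec_apply {A : 𝓧 → Matrix m n ℝ} {v : 𝓧 → n → ℝ}
    (hA : ∀ i j, Measurable fun x => A x i j) (hv : ∀ j, Measurable fun x => v x j)
    (i : m) : Measurable fun x => (A x *ᵥ v x) i :=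
  Finset.measurable_sum _ fun k _ => (hA i k).mul (hv k)

variable [DecidableEq n]

lemma measurable_matrix_det {A : 𝓧 → Matrix n n ℝ} (hA : ∀ i j, Measurable fun x => A x i j) :
    Measurable fun x => (A x).det := by
  simp only [Matrix.det_apply']
  exact Finset.measurable_sum _ fun σ _ =>
    (Finset.measurable_prod _ fun i _ => hA _ _).const_mul _

lemma measurable_matrix_inv_apply {A : 𝓧 → Matrix n n ℝ}
    (hA : ∀ i j, Measurable fun x => A x i j) (i j : n) :
    Measurable fun x => (A x)⁻¹ i j := by
  simp only [Matrix.inv_def, Ring.inverse_eq_inv', Matrix.smul_apply, smul_eq_mul,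
    Matrix.adjugate_apply]
  refine (measurable_matrix_det hA).inv.mul (measurable_matrix_det fun k l => ?_)
  by_cases hk : k = j
  · subst hk; simp only [updateRow_self]; exact measurable_const
  · simp only [updateRow_ne hk]; exact hA k l

lemma measurable_residualMaker_apply [Fintype m] [DecidableEq m] {X : 𝓧 → Matrix m n ℝ}
    (hX : ∀ i j, Measurable fun x => X x i j) (i j : m) :
    Measurable fun x => residualMaker (X x) i j := by
  unfold residualMaker
  simp only [Matrix.sub_apply]
  refine measurable_const.sub (measurable_matrix_mul_apply (fun k l =>
    measurable_matrix_mul_apply hX (fun k l => measurable_matrix_inv_apply (fun k l =>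
      measurable_matrix_mul_apply (fun k l => hX l k) hX k l) k l) k l) (fun k l => hX l k) i j)

end Measurability

/-! ### Moments of the residual maker of Gaussian regressors -/

section Invariance

variable {ι κ' κ : Type*} [Fintype ι] [Fintype κ'] [Fintype κ] [DecidableEq ι] [DecidableEq κ]

omit [Fintype κ] [DecidableEq ι] [DecidableEq κ] [Fintype ι] in
lemma measurable_designMatrix_apply (B : Matrix κ' κ ℝ) (i : ι) (j : κ) :
    Measurable fun z : κ' × ι → ℝ => designMatrix B z i j :=
  measurable_matrix_mul_apply (A := fun z : κ' × ι → ℝ => Matrix.of fun i k => z (k, i))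
    (B := fun _ => B) (fun i k => measurable_pi_apply (k, i)) (fun _ _ => measurable_const) i j

lemma measurable_quadForm (B : Matrix κ' κ ℝ) (x y : ι → ℝ) :
    Measurable fun z : κ' × ι → ℝ => x ⬝ᵥ (residualMaker (designMatrix B z) *ᵥ y) :=
  Finset.measurable_sum _ fun _ _ => measurable_const.mul
    (measurable_mulVec_apply (v := fun _ => y)
      (measurable_residualMaker_apply (measurable_designMatrix_apply B))
      (fun _ => measurable_const) _)

lemma integral_comp_rotateData {v : κ' → ℝ≥0} {O : Matrix ι ι ℝ} (hO : Oᵀ * O = 1)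
    {F : (κ' × ι → ℝ) → ℝ} (hF : Measurable F) :
    ∫ z, F (rotateData O z) ∂gaussianVec (fun p : κ' × ι => v p.1)
      = ∫ z, F z ∂gaussianVec (fun p : κ' × ι => v p.1) := by
  conv_rhs => rw [← map_rotateData_gaussianVec hO v]
  rw [integral_map (measurable_rotateData O).aemeasurable hF.aestronglyMeasurable]

/-- The law of a diagonal quadratic form of the residual maker of rotation-invariant regressors does
not depend on the direction. -/
lemma integral_quadForm_congr (v : κ' → ℝ≥0) (B : Matrix κ' κ ℝ) {φ : ℝ → ℝ} (hφ : Measurable φ)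
    {x y : ι → ℝ} (hxy : x ⬝ᵥ x = y ⬝ᵥ y) :
    ∫ z, φ (x ⬝ᵥ (residualMaker (designMatrix B z) *ᵥ x)) ∂gaussianVec (fun p : κ' × ι => v p.1)
      = ∫ z, φ (y ⬝ᵥ (residualMaker (designMatrix B z) *ᵥ y))
        ∂gaussianVec (fun p : κ' × ι => v p.1) := by
  obtain ⟨O, hO, hOx⟩ := exists_orthogonal_mulVec_eq hxy.symm
  rw [← integral_comp_rotateData hO (F := fun z => φ (x ⬝ᵥ (residualMaker (designMatrix B z) *ᵥ x)))
    (hφ.comp (measurable_quadForm B x x))]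
  refine integral_congr_ae (ae_of_all _ fun z => ?_)
  have hOx' : Oᵀ *ᵥ x = y := by rw [← hOx, mulVec_mulVec, hO, one_mulVec]
  simp only []
  rw [designMatrix_rotateData, residualMaker_orthogonal_mul hO, ← mulVec_mulVec, ← mulVec_mulVec,
    hOx', dotProduct_mulVec, ← mulVec_transpose, hOx']

variable {v : κ' → ℝ≥0} {B : Matrix κ' κ ℝ}

lemma abs_residualMaker_le_one {X : Matrix ι κ ℝ} (hX : IsUnit (Xᵀ * X).det) (i j : ι) :
    |residualMaker X i j| ≤ 1 := by
  have h1 : residualMaker X i j ^ 2 ≤ residualMaker X i i := by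
    rw [residualMaker_diag hX]
    exact Finset.single_le_sum (f := fun j => residualMaker X i j ^ 2)
      (fun _ _ => sq_nonneg _) (Finset.mem_univ j)
  exact (sq_le_one_iff_abs_le_one _).1 (h1.trans (residualMaker_diag_le_one hX i))

lemma integrable_residualMaker_mul
    (hG : ∀ᵐ z ∂gaussianVec (fun p : κ' × ι => v p.1),
      IsUnit ((designMatrix B z)ᵀ * designMatrix B z).det) (i j k l : ι) :
    Integrable (fun z => residualMaker (designMatrix B z) i j
      * residualMaker (designMatrix B z) k l) (gaussianVec (fun p : κ' × ι => v p.1)) := by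
  have hm := measurable_residualMaker_apply (measurable_designMatrix_apply (ι := ι) B)
  refine Integrable.of_bound ((hm i j).mul (hm k l)).aestronglyMeasurable 1 ?_
  filter_upwards [hG] with z hz
  rw [norm_mul]
  exact mul_le_one₀ (abs_residualMaker_le_one hz i j) (norm_nonneg _)
    (abs_residualMaker_le_one hz k l)

lemma integrable_residualMaker
    (hG : ∀ᵐ z ∂gaussianVec (fun p : κ' × ι => v p.1),
      IsUnit ((designMatrix B z)ᵀ * designMatrix B z).det) (i j : ι) :
    Integrable (fun z => residualMaker (designMatrix B z) i j)
      (gaussianVec (fun p : κ' × ι => v p.1)) := by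
  have hm := measurable_residualMaker_apply (measurable_designMatrix_apply (ι := ι) B)
  refine Integrable.of_bound (hm i j).aestronglyMeasurable 1 ?_
  filter_upwards [hG] with z hz
  exact abs_residualMaker_le_one hz i j

lemma integral_residualMaker_diag [Nonempty ι]
    (hG : ∀ᵐ z ∂gaussianVec (fun p : κ' × ι => v p.1),
      IsUnit ((designMatrix B z)ᵀ * designMatrix B z).det) (i : ι) :
    ∫ z, residualMaker (designMatrix B z) i i ∂gaussianVec (fun p : κ' × ι => v p.1)
      = (Fintype.card ι - Fintype.card κ) / Fintype.card ι := by
  have hm0 : (Fintype.card ι : ℝ) ≠ 0 := by simp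
  have hconst : ∀ j, ∫ z, residualMaker (designMatrix B z) j j
      ∂gaussianVec (fun p : κ' × ι => v p.1)
      = ∫ z, residualMaker (designMatrix B z) i i ∂gaussianVec (fun p : κ' × ι => v p.1) := by
    intro j
    have := integral_quadForm_congr v B (φ := id) measurable_id
      (x := Pi.single j 1) (y := Pi.single i 1) (by simp)
    simpa using this
  have htr : ∫ z, ∑ j, residualMaker (designMatrix B z) j j
      ∂gaussianVec (fun p : κ' × ι => v p.1) = Fintype.card ι - Fintype.card κ := by
    rw [integral_congr_ae (g := fun _ => (Fintype.card ι - Fintype.card κ : ℝ))]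
    · simp
    · filter_upwards [hG] with z hz
      exact trace_residualMaker hz
  rw [integral_finsetSum _ fun j _ => integrable_residualMaker hG j j] at htr
  simp only [hconst, Finset.sum_const, Finset.card_univ, nsmul_eq_mul] at htr
  rw [eq_div_iff hm0, mul_comm]
  exact htr

/-- The second moment of a diagonal entry of the residual maker. Writing `M` for the residual maker
and `r` for its trace, invariance along `(eᵢ ± eⱼ) / √2` gives
`E[Mᵢᵢ²] = E[Mᵢᵢ Mⱼⱼ] + 2 E[Mᵢⱼ²]` for `i ≠ j`, and summing over all pairs yields `r² + 2r`. -/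
lemma integral_residualMaker_diag_sq [Nonempty ι]
    (hG : ∀ᵐ z ∂gaussianVec (fun p : κ' × ι => v p.1),
      IsUnit ((designMatrix B z)ᵀ * designMatrix B z).det) (i : ι) :
    ∫ z, residualMaker (designMatrix B z) i i ^ 2 ∂gaussianVec (fun p : κ' × ι => v p.1)
      = ((Fintype.card ι - Fintype.card κ) * (Fintype.card ι - Fintype.card κ + 2))
        / (Fintype.card ι * (Fintype.card ι + 2)) := by
  set μ := gaussianVec (fun p : κ' × ι => v p.1) with hμ
  set m : ℝ := (Fintype.card ι : ℝ) with hm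
  have hm0 : 0 < m := by rw [hm]; exact_mod_cast Fintype.card_pos
  set r : ℝ := m - (Fintype.card κ : ℝ) with hr
  set M : (κ' × ι → ℝ) → Matrix ι ι ℝ := fun z => residualMaker (designMatrix B z) with hM
  have hint : ∀ i j k l, Integrable (fun z => M z i j * M z k l) μ :=
    fun i j k l => integrable_residualMaker_mul hG i j k l
  have hint2 : ∀ i j, Integrable (fun z => M z i j ^ 2) μ := fun i j => by
    simpa only [sq] using hint i j i j
  set a := ∫ z, M z i i ^ 2 ∂μ with ha
  have hunit : ∀ x : ι → ℝ, x ⬝ᵥ x = 1 → ∫ z, (x ⬝ᵥ (M z *ᵥ x)) ^ 2 ∂μ = a := by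
    intro x hx
    have := integral_quadForm_congr v B (φ := fun t => t ^ 2) (by fun_prop)
      (x := x) (y := Pi.single i 1) (by simpa using hx)
    simpa using this
  have hdiag : ∀ j, ∫ z, M z j j ^ 2 ∂μ = a := by
    intro j
    have := hunit (Pi.single j 1) (by simp)
    simpa using this
  have hsym : ∀ z i j, M z j i = M z i j := fun z i j => by
    conv_lhs => rw [hM]; simp only []; rw [← residualMaker_transpose]
    rfl
  -- average of the identity `hunit` over the two unit vectors `(e_j ± e_k) / √2`
  have hoff : ∀ j k, j ≠ k → ∫ z, (M z j j * M z k k + 2 * M z j k ^ 2) ∂μ = a := by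
    intro j k hjk
    have h2 : (1 / √2) * (1 / √2) = (1 / 2 : ℝ) := by
      rw [div_mul_div_comm, Real.mul_self_sqrt (by norm_num)]; norm_num
    have hq : ∀ (s : ℝ), s * s = 1 → ∫ z, ((M z j j + M z k k) / 2 + s * M z j k) ^ 2 ∂μ = a := by
      intro s hs
      rw [← hunit ((1 / √2) • (Pi.single j 1 + s • Pi.single k 1))]
      · refine integral_congr_ae (ae_of_all _ fun z => ?_)
        simp only [mulVec_smul, mulVec_add, smul_dotProduct, dotProduct_smul, add_dotProduct,
          dotProduct_add, mulVec_single_one, single_one_dotProduct, smul_eq_mul, col_apply]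
        rw [hsym z j k]
        congr 1
        linear_combination (-(M z j j + s * M z j k + s * (M z j k + s * M z k k))) * h2
          - (1 / 2) * M z k k * hs
      · simp only [smul_dotProduct, dotProduct_smul, add_dotProduct,
          dotProduct_add, single_one_dotProduct, smul_eq_mul, Pi.single_apply, hjk, hjk.symm,
          if_true, if_false]
        linear_combination (1 + s * s) * h2 + (1 / 2) * hs
    have hp := hq 1 (by norm_num)
    have hn := hq (-1) (by norm_num)
    have hI : ∀ s : ℝ, Integrable (fun z => ((M z j j + M z k k) / 2 + s * M z j k) ^ 2) μ := by
      intro s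
      have : (fun z => ((M z j j + M z k k) / 2 + s * M z j k) ^ 2) = fun z =>
          (1 / 4) * (M z j j * M z j j) + (1 / 2) * (M z j j * M z k k)
          + (1 / 4) * (M z k k * M z k k) + s * (M z j j * M z j k) + s * (M z k k * M z j k)
          + s ^ 2 * (M z j k * M z j k) := by funext z; ring
      rw [this]
      exact ((((((hint _ _ _ _).const_mul _).add ((hint _ _ _ _).const_mul _)).add
        ((hint _ _ _ _).const_mul _)).add ((hint _ _ _ _).const_mul _)).add
        ((hint _ _ _ _).const_mul _)).add ((hint _ _ _ _).const_mul _)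
    have hsum : ∫ z, (M z j j * M z k k + 2 * M z j k ^ 2) ∂μ
        = ∫ z, ((M z j j + M z k k) / 2 + 1 * M z j k) ^ 2 ∂μ
          + ∫ z, ((M z j j + M z k k) / 2 + (-1) * M z j k) ^ 2 ∂μ
          - (1 / 2) * ∫ z, M z j j ^ 2 ∂μ - (1 / 2) * ∫ z, M z k k ^ 2 ∂μ := by
      have hJ := hint j j k k
      have hpt : ∀ z, ((M z j j + M z k k) / 2 + 1 * M z j k) ^ 2
          = (M z j j * M z k k + 2 * M z j k ^ 2)
            - ((M z j j + M z k k) / 2 + (-1) * M z j k) ^ 2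
            + (1 / 2) * M z j j ^ 2 + (1 / 2) * M z k k ^ 2 := fun z => by ring
      have hJ1 : Integrable (fun z => M z j j * M z k k + 2 * M z j k ^ 2) μ :=
        hJ.add ((hint2 j k).const_mul 2)
      have hJ2 : Integrable (fun z => (M z j j * M z k k + 2 * M z j k ^ 2)
          - ((M z j j + M z k k) / 2 + (-1) * M z j k) ^ 2) μ := hJ1.sub (hI (-1))
      have hJ3 : Integrable (fun z => (M z j j * M z k k + 2 * M z j k ^ 2)
          - ((M z j j + M z k k) / 2 + (-1) * M z j k) ^ 2 + (1 / 2) * M z j j ^ 2) μ :=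
        hJ2.add ((hint2 j j).const_mul _)
      simp_rw [hpt]
      rw [integral_add hJ3 ((hint2 k k).const_mul _), integral_add hJ2 ((hint2 j j).const_mul _),
        integral_sub hJ1 (hI (-1)), integral_const_mul, integral_const_mul]
      ring
    rw [hsum, hp, hn, hdiag, hdiag]; ring
  have hon : ∀ j, ∫ z, (M z j j * M z j j + 2 * M z j j ^ 2) ∂μ = 3 * a := by
    intro j
    rw [← hdiag j, ← integral_const_mul]
    refine integral_congr_ae (ae_of_all _ fun z => ?_)
    simp only []
    ring
  -- almost surely `∑_j M_jj = r` and `∑_k M_jk² = M_jj`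
  have htot : ∫ z, ∑ j, ∑ k, (M z j j * M z k k + 2 * M z j k ^ 2) ∂μ = r ^ 2 + 2 * r := by
    rw [integral_congr_ae (g := fun _ => (r ^ 2 + 2 * r : ℝ))]
    · simp
    · filter_upwards [hG] with z hz
      have ht : ∑ j, M z j j = r := trace_residualMaker hz
      have h2 : ∀ j, ∑ k, M z j k ^ 2 = M z j j := fun j => (residualMaker_diag hz j).symm
      simp_rw [Finset.sum_add_distrib, ← Finset.mul_sum, h2, ht, ← Finset.sum_mul, ht]
      ring
  have hJ : ∀ j k, Integrable (fun z => M z j j * M z k k + 2 * M z j k ^ 2) μ :=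
    fun j k => (hint _ _ _ _).add ((hint2 _ _).const_mul _)
  rw [integral_finsetSum _ fun j _ => integrable_finsetSum _ fun k _ => hJ j k] at htot
  -- each row contributes `3 a` on the diagonal and `a` for each of the `m - 1` other entries
  have hrow : ∀ j, ∫ z, ∑ k, (M z j j * M z k k + 2 * M z j k ^ 2) ∂μ = (m + 2) * a := by
    intro j
    rw [integral_finsetSum _ fun k _ => hJ j k,
      ← Finset.add_sum_erase _ _ (Finset.mem_univ j), hon,
      Finset.sum_congr rfl fun k hk => hoff j k (Finset.ne_of_mem_erase hk).symm,
      Finset.sum_const, Finset.card_erase_of_mem (Finset.mem_univ j), Finset.card_univ,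
      nsmul_eq_mul, Nat.cast_sub Fintype.card_pos]
    push_cast
    ring
  simp only [hrow, Finset.sum_const, Finset.card_univ, nsmul_eq_mul] at htot
  rw [eq_div_iff (by positivity)]
  linear_combination htot

/-- A diagonal quadratic form of the residual maker concentrates around the fraction of residual
degrees of freedom. -/
lemma integral_quadForm_sub_sq_le [Nonempty ι] (hcard : Fintype.card κ ≤ Fintype.card ι)
    (hG : ∀ᵐ z ∂gaussianVec (fun p : κ' × ι => v p.1),
      IsUnit ((designMatrix B z)ᵀ * designMatrix B z).det) {x : ι → ℝ} (hx : x ⬝ᵥ x = 1) :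
    ∫ z, (x ⬝ᵥ (residualMaker (designMatrix B z) *ᵥ x)
        - (Fintype.card ι - Fintype.card κ) / Fintype.card ι) ^ 2
        ∂gaussianVec (fun p : κ' × ι => v p.1) ≤ 2 / Fintype.card ι := by
  obtain ⟨i⟩ := (inferInstance : Nonempty ι)
  set c : ℝ := (Fintype.card ι - Fintype.card κ) / Fintype.card ι with hc
  have h1 := integral_quadForm_congr v B (φ := fun t => (t - c) ^ 2) (by fun_prop)
      (x := x) (y := Pi.single i 1) (by simpa using hx)
  rw [h1]
  simp only [mulVec_single_one, single_one_dotProduct, col_apply]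
  have hI := integrable_residualMaker hG i i
  have hI2 : Integrable (fun z => residualMaker (designMatrix B z) i i ^ 2)
      (gaussianVec (fun p : κ' × ι => v p.1)) := by
    simpa only [sq] using integrable_residualMaker_mul hG i i i i
  have h2 : ∫ z, (residualMaker (designMatrix B z) i i - c) ^ 2
      ∂gaussianVec (fun p : κ' × ι => v p.1)
      = ∫ z, residualMaker (designMatrix B z) i i ^ 2 ∂gaussianVec (fun p : κ' × ι => v p.1)
        - 2 * c * ∫ z, residualMaker (designMatrix B z) i i ∂gaussianVec (fun p : κ' × ι => v p.1)
        + c ^ 2 := by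
    have : ∀ z : κ' × ι → ℝ, (residualMaker (designMatrix B z) i i - c) ^ 2
        = residualMaker (designMatrix B z) i i ^ 2
          - 2 * c * residualMaker (designMatrix B z) i i + c ^ 2 := fun z => by ring
    simp_rw [this]
    have hI3 : Integrable (fun z => residualMaker (designMatrix B z) i i ^ 2
        - 2 * c * residualMaker (designMatrix B z) i i) (gaussianVec (fun p : κ' × ι => v p.1)) :=
      hI2.sub (hI.const_mul _)
    rw [integral_add hI3 (integrable_const _),
      integral_sub hI2 (hI.const_mul _), integral_const_mul]
    simp
  rw [h2, integral_residualMaker_diag hG, integral_residualMaker_diag_sq hG, ← hc, hc]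
  have hm0 : (0 : ℝ) < Fintype.card ι := by exact_mod_cast Fintype.card_pos
  have hk : (Fintype.card κ : ℝ) ≤ Fintype.card ι := by exact_mod_cast hcard
  have hk0 : (0 : ℝ) ≤ Fintype.card κ := by positivity
  set m : ℝ := (Fintype.card ι : ℝ)
  set k : ℝ := (Fintype.card κ : ℝ)
  have : (m - k) * (m - k + 2) / (m * (m + 2)) - 2 * ((m - k) / m) * ((m - k) / m)
      + ((m - k) / m) ^ 2 = 2 * ((m - k) * k) / (m ^ 2 * (m + 2)) := by field_simp; ring
  rw [this, div_le_div_iff₀ (by positivity) hm0]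
  have h3 : (m - k) * k ≤ m * m := by nlinarith
  nlinarith [mul_le_mul_of_nonneg_left h3 hm0.le]

/-- Chebyshev's inequality for the quadratic form, in a form homogeneous in the direction `x`. -/
lemma measure_quadForm_sub_gt_le [Nonempty ι] (hcard : Fintype.card κ ≤ Fintype.card ι)
    (hG : ∀ᵐ z ∂gaussianVec (fun p : κ' × ι => v p.1),
      IsUnit ((designMatrix B z)ᵀ * designMatrix B z).det) (x : ι → ℝ) {δ : ℝ} (hδ : 0 < δ) :
    gaussianVec (fun p : κ' × ι => v p.1)
      {z | δ * (x ⬝ᵥ x) < |x ⬝ᵥ (residualMaker (designMatrix B z) *ᵥ x)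
        - (Fintype.card ι - Fintype.card κ) / Fintype.card ι * (x ⬝ᵥ x)|}
      ≤ ENNReal.ofReal (2 / (Fintype.card ι * δ ^ 2)) := by
  rcases (dotProduct_self_nonneg x).eq_or_lt with h0 | hpos
  · have hx : x = 0 := dotProduct_self_eq_zero.1 h0.symm
    subst hx
    simp
  set N := x ⬝ᵥ x with hN
  set c : ℝ := (Fintype.card ι - Fintype.card κ) / Fintype.card ι with hc
  set u : ι → ℝ := (1 / √N) • x with hu
  have hsq : (1 / √N) * (1 / √N) = 1 / N := by
    rw [div_mul_div_comm, Real.mul_self_sqrt hpos.le]; norm_num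
  have huu : u ⬝ᵥ u = 1 := by
    rw [hu, smul_dotProduct, dotProduct_smul, smul_smul, hsq, smul_eq_mul, ← hN]
    field_simp
  have hq : ∀ z : κ' × ι → ℝ, x ⬝ᵥ (residualMaker (designMatrix B z) *ᵥ x)
      = N * (u ⬝ᵥ (residualMaker (designMatrix B z) *ᵥ u)) := by
    intro z
    rw [hu, mulVec_smul, smul_dotProduct, dotProduct_smul, smul_smul, hsq, smul_eq_mul]
    field_simp
  have hI : Integrable (fun z => (u ⬝ᵥ (residualMaker (designMatrix B z) *ᵥ u) - c) ^ 2)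
      (gaussianVec (fun p : κ' × ι => v p.1)) := by
    refine Integrable.of_bound (((measurable_quadForm B u u).sub_const c).pow_const
      2).aestronglyMeasurable ((1 + |c|) ^ 2) ?_
    filter_upwards [hG] with z hz
    have h1 := dotProduct_residualMaker_nonneg hz u
    have h2 := (dotProduct_residualMaker_le hz u).trans_eq huu
    rw [norm_pow]
    gcongr
    refine (abs_sub _ _).trans ?_
    gcongr
    rwa [abs_of_nonneg h1]
  have hmark := mul_meas_ge_le_integral_of_nonneg (ae_of_all _ fun z => sq_nonneg _) hI (δ ^ 2)
  have hle := hmark.trans (integral_quadForm_sub_sq_le hcard hG huu)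
  have hm0 : (0 : ℝ) < Fintype.card ι := by exact_mod_cast Fintype.card_pos
  have hreal : (gaussianVec (fun p : κ' × ι => v p.1)).real
      {z | δ ^ 2 ≤ (u ⬝ᵥ (residualMaker (designMatrix B z) *ᵥ u) - c) ^ 2}
      ≤ 2 / (Fintype.card ι * δ ^ 2) := by
    rw [← div_div, le_div_iff₀ (by positivity), mul_comm]
    exact hle
  refine (measure_mono fun z hz => ?_).trans
    ((ENNReal.le_ofReal_iff_toReal_le (measure_ne_top _ _) (by positivity)).2 hreal)
  have hz' : δ * N < |x ⬝ᵥ (residualMaker (designMatrix B z) *ᵥ x) - c * N| := hz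
  change δ ^ 2 ≤ (u ⬝ᵥ (residualMaker (designMatrix B z) *ᵥ u) - c) ^ 2
  rw [hq, mul_comm c, ← mul_sub, abs_mul, abs_of_pos hpos, mul_comm δ] at hz'
  have := lt_of_mul_lt_mul_left hz' hpos.le
  rw [← sq_abs (_ - c)]
  gcongr

omit [DecidableEq ι] in
lemma integrable_combination_sq (v : κ' → ℝ≥0) (a : κ' → ℝ) (j : ι) :
    Integrable (fun z : κ' × ι → ℝ => (∑ k, a k * z (k, j)) ^ 2)
      (gaussianVec (fun p : κ' × ι => v p.1)) := by
  classical
  have := integrable_dotProduct_sq_gaussianVec (fun p : κ' × ι => v p.1)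
    (fun p : κ' × ι => if p.2 = j then a p.1 else 0)
  simpa [dotProduct, Fintype.sum_prod_type] using this

omit [DecidableEq ι] in
lemma integral_combination_sq (v : κ' → ℝ≥0) (a : κ' → ℝ) (j : ι) :
    ∫ z : κ' × ι → ℝ, (∑ k, a k * z (k, j)) ^ 2 ∂gaussianVec (fun p : κ' × ι => v p.1)
      = ∑ k, (v k : ℝ) * a k ^ 2 := by
  classical
  have := integral_dotProduct_sq_gaussianVec (fun p : κ' × ι => v p.1)
    (fun p : κ' × ι => if p.2 = j then a p.1 else 0)
  simpa [dotProduct, Fintype.sum_prod_type] using this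

/-- A residual of a combination `e` of the data columns has second moment at most the variance of
an entry of `e`, because all residuals have the same second moment and the residual vector is
no longer than `e`. -/
lemma integral_residual_sq_le [Nonempty ι]
    (hG : ∀ᵐ z ∂gaussianVec (fun p : κ' × ι => v p.1),
      IsUnit ((designMatrix B z)ᵀ * designMatrix B z).det) (a : κ' → ℝ) (i : ι) :
    Integrable (fun z => (residualMaker (designMatrix B z) *ᵥ (fun j => ∑ k, a k * z (k, j))) i ^ 2)
        (gaussianVec (fun p : κ' × ι => v p.1)) ∧
      ∫ z, (residualMaker (designMatrix B z) *ᵥ (fun j => ∑ k, a k * z (k, j))) i ^ 2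
        ∂gaussianVec (fun p : κ' × ι => v p.1) ≤ ∑ k, (v k : ℝ) * a k ^ 2 := by
  classical
  set μ := gaussianVec (fun p : κ' × ι => v p.1) with hμ
  set M : (κ' × ι → ℝ) → Matrix ι ι ℝ := fun z => residualMaker (designMatrix B z) with hM
  set e : (κ' × ι → ℝ) → ι → ℝ := fun z j => ∑ k, a k * z (k, j) with he
  have hIe : ∀ j, Integrable (fun z => e z j ^ 2) μ := fun j =>
    integrable_combination_sq v a j
  have hEe : ∀ j, ∫ z, e z j ^ 2 ∂μ = ∑ k, (v k : ℝ) * a k ^ 2 := fun j =>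
    integral_combination_sq v a j
  have hem : ∀ j, Measurable fun z => e z j := fun j => by simp only [he]; fun_prop
  have hMm : ∀ i j, Measurable fun z => M z i j :=
    measurable_residualMaker_apply (measurable_designMatrix_apply (ι := ι) B)
  have hMe : ∀ j, Measurable fun z => (M z *ᵥ e z) j := measurable_mulVec_apply hMm hem
  have hle : ∀ᵐ z ∂μ, ∑ j, (M z *ᵥ e z) j ^ 2 ≤ ∑ j, e z j ^ 2 := by
    filter_upwards [hG] with z hz
    have := residualMaker_mulVec_sq_le hz (e z)
    simpa only [dotProduct, ← sq] using this
  have hIM : ∀ j, Integrable (fun z => (M z *ᵥ e z) j ^ 2) μ := fun j => by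
    refine (integrable_finsetSum Finset.univ fun j _ => hIe j).mono'
      ((hMe j).pow_const 2).aestronglyMeasurable ?_
    filter_upwards [hle] with z hz
    rw [Real.norm_of_nonneg (sq_nonneg _)]
    exact (Finset.single_le_sum (f := fun j => (M z *ᵥ e z) j ^ 2) (fun _ _ => sq_nonneg _)
      (Finset.mem_univ j)).trans hz
  refine ⟨hIM i, ?_⟩
  have hconst : ∀ j, ∫ z, (M z *ᵥ e z) j ^ 2 ∂μ = ∫ z, (M z *ᵥ e z) i ^ 2 ∂μ := by
    intro j
    obtain ⟨O, hO, hOx⟩ := exists_orthogonal_mulVec_eq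
      (x := Pi.single i (1 : ℝ)) (y := Pi.single j 1) (by simp)
    rw [← integral_comp_rotateData hO ((hMe j).pow_const 2)]
    refine integral_congr_ae (ae_of_all _ fun z => ?_)
    have hOx' : Oᵀ *ᵥ Pi.single j 1 = Pi.single i 1 := by rw [← hOx, mulVec_mulVec, hO, one_mulVec]
    have hrot : e (rotateData O z) = O *ᵥ e z := by
      funext s
      simp only [he, rotateData, mulVec, dotProduct, Finset.mul_sum]
      rw [Finset.sum_comm]
      exact Finset.sum_congr rfl fun _ _ => Finset.sum_congr rfl fun _ _ => by ring
    have h1 : M (rotateData O z) *ᵥ e (rotateData O z) = O *ᵥ (M z *ᵥ e z) := by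
      simp only [hM]
      rw [designMatrix_rotateData, residualMaker_orthogonal_mul hO, hrot, mulVec_mulVec,
        Matrix.mul_assoc, hO, Matrix.mul_one, mulVec_mulVec]
    simp only []
    rw [h1, ← single_one_dotProduct j (O *ᵥ _), dotProduct_mulVec, ← mulVec_transpose, hOx',
      single_one_dotProduct]
  have hsum : ∫ z, ∑ j, (M z *ᵥ e z) j ^ 2 ∂μ ≤ ∫ z, ∑ j, e z j ^ 2 ∂μ :=
    integral_mono_ae (integrable_finsetSum _ fun j _ => hIM j)
      (integrable_finsetSum _ fun j _ => hIe j) hle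
  rw [integral_finsetSum _ fun j _ => hIM j, integral_finsetSum _ fun j _ => hIe j] at hsum
  simp only [hconst, hEe, Finset.sum_const, Finset.card_univ, nsmul_eq_mul] at hsum
  exact le_of_mul_le_mul_left hsum (by exact_mod_cast Fintype.card_pos)

end Invariance

/-! ### Convergence in probability and in distribution -/

section InProbability

variable {Ω : Type*} [MeasurableSpace Ω] {P : Measure Ω}

lemma TendstoInMeasure.comp_continuousAt_prod {X Y : ℕ → Ω → ℝ} {a b : ℝ} {g : ℝ → ℝ → ℝ}
    (hX : TendstoInMeasure P X atTop fun _ => a) (hY : TendstoInMeasure P Y atTop fun _ => b)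
    (hg : ContinuousAt (fun p : ℝ × ℝ => g p.1 p.2) (a, b)) :
    TendstoInMeasure P (fun n ω => g (X n ω) (Y n ω)) atTop fun _ => g a b := by
  rw [tendstoInMeasure_iff_dist] at *
  intro ε hε
  obtain ⟨δ, hδ, h⟩ := Metric.continuousAt_iff.1 hg ε hε
  have hsum := (hX δ hδ).add (hY δ hδ)
  rw [add_zero] at hsum
  refine tendsto_of_tendsto_of_tendsto_of_le_of_le tendsto_const_nhds hsum (fun _ => zero_le)
    fun n => (measure_mono fun ω hω => ?_).trans (measure_union_le _ _)
  by_contra hcon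
  rw [Set.mem_union, not_or] at hcon
  have h1 : dist (X n ω) a < δ := not_le.1 hcon.1
  have h2 : dist (Y n ω) b < δ := not_le.1 hcon.2
  have h3 : dist (X n ω, Y n ω) (a, b) < δ := by rw [Prod.dist_eq]; exact max_lt h1 h2
  exact absurd (h h3) (not_lt.2 hω)

lemma TendstoInMeasure.comp_continuousAt {X : ℕ → Ω → ℝ} {a : ℝ} {g : ℝ → ℝ}
    (hX : TendstoInMeasure P X atTop fun _ => a) (hg : ContinuousAt g a) :
    TendstoInMeasure P (fun n ω => g (X n ω)) atTop fun _ => g a :=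
  TendstoInMeasure.comp_continuousAt_prod (g := fun x _ => g x) hX hX
    (ContinuousAt.comp (f := Prod.fst) (x := (a, a)) hg continuousAt_fst)

lemma tendstoInMeasure_zero_of_integral_sq_le [IsFiniteMeasure P] {X : ℕ → Ω → ℝ} {C : ℕ → ℝ}
    (hI : ∀ᶠ n in atTop, Integrable (fun ω => X n ω ^ 2) P)
    (hX : ∀ᶠ n in atTop, ∫ ω, X n ω ^ 2 ∂P ≤ C n) (hC : Tendsto C atTop (𝓝 0)) :
    TendstoInMeasure P X atTop fun _ => 0 := by
  rw [tendstoInMeasure_iff_measureReal_dist]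
  intro ε hε
  have h0 : Tendsto (fun n => C n / ε ^ 2) atTop (𝓝 0) := by simpa using hC.div_const (ε ^ 2)
  refine tendsto_of_tendsto_of_tendsto_of_le_of_le' tendsto_const_nhds h0
    (Eventually.of_forall fun _ => measureReal_nonneg) ?_
  filter_upwards [hI, hX] with n hI hX
  rw [le_div_iff₀ (by positivity), mul_comm]
  have hset : {ω | ε ≤ dist (X n ω) 0} = {ω | ε ^ 2 ≤ X n ω ^ 2} := by
    ext ω
    change ε ≤ dist (X n ω) 0 ↔ ε ^ 2 ≤ X n ω ^ 2
    rw [Real.dist_eq, sub_zero, ← sq_abs (X n ω), sq_le_sq₀ hε.le (abs_nonneg _)]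
  rw [hset]
  exact (mul_meas_ge_le_integral_of_nonneg (ae_of_all _ fun ω => sq_nonneg _) hI _).trans hX

variable [IsProbabilityMeasure P]

lemma tendsto_integral_of_tendstoInMeasure_const {X : ℕ → Ω → ℝ} {a : ℝ}
    (hXm : ∀ n, AEMeasurable (X n) P) (hX : TendstoInMeasure P X atTop fun _ => a)
    (φ : BoundedContinuousFunction ℝ ℝ) :
    Tendsto (fun n => ∫ ω, φ (X n ω) ∂P) atTop (𝓝 (φ a)) := by
  have h := (hX.tendstoInDistribution hXm).tendsto
  have h1 := ProbabilityMeasure.tendsto_iff_forall_integral_tendsto.1 h φ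
  simp only [ProbabilityMeasure.coe_mk] at h1
  have h2 : ∀ n, ∫ x, φ x ∂P.map (X n) = ∫ ω, φ (X n ω) ∂P := fun n =>
    integral_map (hXm n) φ.continuous.aestronglyMeasurable
  have h3 : ∫ x, φ x ∂P.map (fun _ : Ω => a) = φ a := by
    rw [integral_map aemeasurable_const φ.continuous.aestronglyMeasurable]
    simp
  rw [h3] at h1
  simpa only [h2] using h1

/-- Convergence in probability to a constant can be read off two values of the Laplace transform,
because these control the variance of `exp (-V n)`. -/
lemma tendstoInMeasure_of_laplace {V : ℕ → Ω → ℝ} {a : ℝ}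
    (hVm : ∀ n, AEMeasurable (V n) P) (hV0 : ∀ n ω, 0 ≤ V n ω)
    (h1 : Tendsto (fun n => ∫ ω, Real.exp (-V n ω) ∂P) atTop (𝓝 (Real.exp (-a))))
    (h2 : Tendsto (fun n => ∫ ω, Real.exp (-(2 * V n ω)) ∂P) atTop (𝓝 (Real.exp (-(2 * a))))) :
    TendstoInMeasure P V atTop fun _ => a := by
  have hb : ∀ n (s : ℝ), 0 ≤ s → Integrable (fun ω => Real.exp (-(s * V n ω))) P := by
    intro n s hs
    refine Integrable.of_bound (((hVm n).const_mul s).neg.exp).aestronglyMeasurable 1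
      (ae_of_all _ fun ω => ?_)
    rw [Real.norm_of_nonneg (Real.exp_pos _).le, Real.exp_le_one_iff]
    have := mul_nonneg hs (hV0 n ω)
    linarith
  have hI1 : ∀ n, Integrable (fun ω => Real.exp (-V n ω)) P := fun n => by
    simpa using hb n 1 zero_le_one
  have hI2 : ∀ n, Integrable (fun ω => Real.exp (-(2 * V n ω))) P := fun n => hb n 2 zero_le_two
  have hpt : ∀ n ω, (Real.exp (-V n ω) - Real.exp (-a)) ^ 2
      = Real.exp (-(2 * V n ω)) - 2 * Real.exp (-a) * Real.exp (-V n ω) + Real.exp (-a) ^ 2 := by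
    intro n ω
    have : Real.exp (-(2 * V n ω)) = Real.exp (-V n ω) ^ 2 := by
      rw [← Real.exp_nat_mul]; congr 1; push_cast; ring
    rw [this]; ring
  have hI3 : ∀ n, Integrable (fun ω => Real.exp (-(2 * V n ω))
      - 2 * Real.exp (-a) * Real.exp (-V n ω)) P := fun n => (hI2 n).sub ((hI1 n).const_mul _)
  have hI : ∀ n, Integrable (fun ω => (Real.exp (-V n ω) - Real.exp (-a)) ^ 2) P := by
    intro n
    simp_rw [hpt]
    exact (hI3 n).add (integrable_const _)
  have hE : ∀ n, ∫ ω, (Real.exp (-V n ω) - Real.exp (-a)) ^ 2 ∂P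
      = ∫ ω, Real.exp (-(2 * V n ω)) ∂P - 2 * Real.exp (-a) * ∫ ω, Real.exp (-V n ω) ∂P
        + Real.exp (-a) ^ 2 := by
    intro n
    simp_rw [hpt]
    rw [integral_add (hI3 n) (integrable_const _), integral_sub (hI2 n) ((hI1 n).const_mul _),
      integral_const_mul]
    simp
  have hlim : Tendsto (fun n => ∫ ω, (Real.exp (-V n ω) - Real.exp (-a)) ^ 2 ∂P) atTop (𝓝 0) := by
    simp_rw [hE]
    have := (h2.sub (h1.const_mul (2 * Real.exp (-a)))).add_const (Real.exp (-a) ^ 2)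
    convert this using 2
    have : Real.exp (-(2 * a)) = Real.exp (-a) ^ 2 := by
      rw [← Real.exp_nat_mul]; congr 1; push_cast; ring
    rw [this]; ring
  -- `exp (-V n)` tends to `exp (-a)` in mean square; a continuous inverse of `exp` recovers `V n`
  have hU := tendstoInMeasure_zero_of_integral_sq_le (Eventually.of_forall hI)
    (Eventually.of_forall fun n => le_rfl) hlim
  have hg : ContinuousAt (fun u : ℝ => -Real.log (u + Real.exp (-a))) 0 := by
    refine (ContinuousAt.log (by fun_prop) ?_).neg
    rw [zero_add]; exact (Real.exp_pos _).ne'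
  have := TendstoInMeasure.comp_continuousAt hU hg
  simpa using this

/-- Convergence in distribution to a Gaussian law, from characteristic functions. -/
lemma tendstoInDistribution_gaussianReal_of_charFun {X : ℕ → Ω → ℝ} {m : ℝ} {v : ℝ≥0}
    (hXm : ∀ n, AEMeasurable (X n) P)
    (h : ∀ θ : ℝ, Tendsto (fun n => ∫ ω, Complex.exp (((θ * X n ω : ℝ) : ℂ) * Complex.I) ∂P) atTop
      (𝓝 (Complex.exp (θ * m * Complex.I - v * θ ^ 2 / 2)))) :
    TendstoInDistribution X atTop id (fun _ => P) (gaussianReal m v) := by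
  refine ⟨hXm, aemeasurable_id, ?_⟩
  refine ProbabilityMeasure.tendsto_of_tendsto_charFun fun θ => ?_
  simp only [ProbabilityMeasure.coe_mk, Measure.map_id, charFun_gaussianReal]
  refine (h θ).congr fun n => ?_
  rw [charFun_apply_real, integral_map (hXm n) (by fun_prop)]
  simp

/-- A perturbation that vanishes in probability does not change the limit of the characteristic
functions. -/
lemma tendsto_integral_cexp_add {X R : ℕ → Ω → ℝ} (hXm : ∀ n, AEMeasurable (X n) P)
    (hRm : ∀ n, AEMeasurable (R n) P) (hR : TendstoInMeasure P R atTop fun _ => 0) {θ : ℝ} {L : ℂ}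
    (h : Tendsto (fun n => ∫ ω, Complex.exp (((θ * X n ω : ℝ) : ℂ) * Complex.I) ∂P) atTop (𝓝 L)) :
    Tendsto (fun n => ∫ ω, Complex.exp (((θ * (X n ω + R n ω) : ℝ) : ℂ) * Complex.I) ∂P) atTop
      (𝓝 L) := by
  let φ : BoundedContinuousFunction ℝ ℝ := BoundedContinuousFunction.ofNormedAddCommGroup
    (fun r => ‖Complex.exp (((θ * r : ℝ) : ℂ) * Complex.I) - 1‖) (by fun_prop) 2 fun r => by
      rw [norm_norm]
      refine (norm_sub_le _ _).trans ?_
      rw [Complex.norm_exp_ofReal_mul_I, norm_one]; norm_num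
  have hφ := tendsto_integral_of_tendstoInMeasure_const hRm hR φ
  have hφ0 : φ 0 = 0 := by
    change ‖Complex.exp (((θ * 0 : ℝ) : ℂ) * Complex.I) - 1‖ = 0
    simp
  rw [hφ0] at hφ
  have hI : ∀ Y : Ω → ℝ, AEMeasurable Y P →
      Integrable (fun ω => Complex.exp (((θ * Y ω : ℝ) : ℂ) * Complex.I)) P := by
    intro Y hY
    refine Integrable.of_bound ?_ 1 (ae_of_all _ fun ω => ?_)
    · exact AEMeasurable.aestronglyMeasurable (by fun_prop)
    · rw [Complex.norm_exp_ofReal_mul_I]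
  rw [← sub_zero L]
  have hdiff : Tendsto (fun n => ∫ ω, Complex.exp (((θ * X n ω : ℝ) : ℂ) * Complex.I) ∂P
      - ∫ ω, Complex.exp (((θ * (X n ω + R n ω) : ℝ) : ℂ) * Complex.I) ∂P) atTop (𝓝 0) := by
    refine squeeze_zero_norm (fun n => ?_) hφ
    rw [← integral_sub (hI _ (hXm n)) (hI (fun ω => X n ω + R n ω) ((hXm n).add (hRm n)))]
    refine (norm_integral_le_integral_norm _).trans_eq (integral_congr_ae (ae_of_all _ fun ω => ?_))
    change _ = ‖Complex.exp (((θ * R n ω : ℝ) : ℂ) * Complex.I) - 1‖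
    have : Complex.exp (((θ * (X n ω + R n ω) : ℝ) : ℂ) * Complex.I)
        = Complex.exp (((θ * X n ω : ℝ) : ℂ) * Complex.I)
          * Complex.exp (((θ * R n ω : ℝ) : ℂ) * Complex.I) := by
      rw [← Complex.exp_add]; congr 1; push_cast; ring
    beta_reduce
    rw [this, norm_sub_rev _ (1 : ℂ), ← mul_one_sub, norm_mul, Complex.norm_exp_ofReal_mul_I,
      one_mul]
  refine (h.sub hdiff).congr fun n => ?_
  ring

end InProbability

/-! ### Exponential concentration of Gaussian second moments -/

section Chernoff

/-- If `g` is centred with exponential moments, its moment generating function grows slower than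
any linear exponential near zero. -/
lemma exists_exp_mul_mgf_lt_one {Q : Measure ℝ} [IsProbabilityMeasure Q] {g : ℝ → ℝ}
    (hg : 0 ∈ interior (integrableExpSet g Q)) (hmean : ∫ x, g x ∂Q = 0) {η : ℝ} (hη : 0 < η) :
    ∃ t > 0, Integrable (fun x => Real.exp (t * g x)) Q ∧ Real.exp (-(t * η)) * mgf g Q t < 1 := by
  have hd : HasDerivAt (fun t => Real.exp (-(t * η)) * mgf g Q t) (-η) 0 := by
    have h1 : HasDerivAt (mgf g Q) 0 0 := by
      have := (differentiableAt_mgf hg).hasDerivAt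
      rwa [deriv_mgf_zero hg, hmean] at this
    have h2 : HasDerivAt (fun t : ℝ => Real.exp (-(t * η))) (-η) 0 := by
      have := (((hasDerivAt_id (0 : ℝ)).mul_const η).neg).exp
      simpa using this
    exact (h2.mul h1).congr_deriv (by simp)
  have hslope := hd.tendsto_slope
  have hneg : ∀ᶠ t in 𝓝[≠] (0 : ℝ), slope (fun t => Real.exp (-(t * η)) * mgf g Q t) 0 t < 0 :=
    hslope.eventually_lt_const (by linarith)
  have hmem : ∀ᶠ t in 𝓝[>] (0 : ℝ), t ∈ integrableExpSet g Q :=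
    nhdsWithin_le_nhds (mem_interior_iff_mem_nhds.1 hg)
  have hneg' : ∀ᶠ t in 𝓝[>] (0 : ℝ),
      slope (fun t => Real.exp (-(t * η)) * mgf g Q t) 0 t < 0 :=
    hneg.filter_mono (nhdsWithin_mono (0 : ℝ) fun t (ht : 0 < t) => ht.ne')
  have hpos : ∀ᶠ t in 𝓝[>] (0 : ℝ), 0 < t := self_mem_nhdsWithin
  obtain ⟨t, ⟨h1, h2⟩, h3⟩ := ((hneg'.and hmem).and hpos).exists
  refine ⟨t, h3, h2, ?_⟩
  rw [slope_def_field, div_neg_iff] at h1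
  simp at h1
  rcases h1 with h | h
  · linarith [h.2]
  · exact h.1

variable {Ω : Type*} [MeasurableSpace Ω] {P : Measure Ω} [IsProbabilityMeasure P]

/-- The Chernoff bound for sums of independent identically distributed variables. -/
lemma measureReal_sum_ge_le_pow {ι : Type*} {X : ι → Ω → ℝ} {Q : Measure ℝ}
    [IsProbabilityMeasure Q] (hind : iIndepFun X P) (hX : ∀ i, HasLaw (X i) Q P) {g : ℝ → ℝ}
    (hg : Measurable g) {t η : ℝ} (ht : 0 ≤ t)
    (hI : Integrable (fun x => Real.exp (t * g x)) Q) (S : Finset ι) :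
    P.real {ω | S.card * η ≤ ∑ i ∈ S, g (X i ω)}
      ≤ (Real.exp (-(t * η)) * mgf g Q t) ^ S.card := by
  have hgm : ∀ i, AEMeasurable (fun ω => g (X i ω)) P := fun i =>
    hg.comp_aemeasurable (hX i).aemeasurable
  have hind' : iIndepFun (fun i ω => g (X i ω)) P := hind.comp (fun _ => g) fun _ => hg
  have hmgf : ∀ i, mgf (fun ω => g (X i ω)) P t = mgf g Q t := fun i => by
    rw [← (hX i).map_eq, mgf_map (hX i).aemeasurable]
    · rfl
    · exact (by fun_prop : Measurable fun x => Real.exp (t * g x)).aestronglyMeasurable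
  have hIi : ∀ i, Integrable (fun ω => Real.exp (t * g (X i ω))) P := fun i => by
    have := hI
    rw [← (hX i).map_eq] at this
    exact this.comp_aemeasurable (hX i).aemeasurable
  have hmgfS : mgf (fun ω => ∑ i ∈ S, g (X i ω)) P t = mgf g Q t ^ S.card := by
    have h := hind'.mgf_sum₀ hgm S (t := t)
    rw [Finset.prod_congr rfl fun i _ => hmgf i, Finset.prod_const] at h
    rw [← h]
    congr 1
    funext ω
    simp
  have hIS : Integrable (fun ω => Real.exp (t * ∑ i ∈ S, g (X i ω))) P := by
    by_contra hcon
    have h0 := mgf_undef hcon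
    rw [hmgfS] at h0
    exact (pow_pos (mgf_pos hI) _).ne' h0
  refine (measure_ge_le_exp_mul_mgf (S.card * η) ht hIS).trans_eq ?_
  rw [hmgfS, mul_pow, ← Real.exp_nat_mul]
  congr 2
  ring

/-- Exponential concentration of empirical second moments of Gaussian samples, with a rate that
depends only on the variance and the tolerance. -/
lemma exists_rate_sum_sq_gaussian (v : ℝ≥0) {η : ℝ} (hη : 0 < η) :
    ∃ ρ : ℝ, 0 ≤ ρ ∧ ρ < 1 ∧ ∀ {ι : Type} (X : ι → Ω → ℝ) (_ : iIndepFun X P)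
      (_ : ∀ i, HasLaw (X i) (gaussianReal 0 v) P) (S : Finset ι),
      P.real {ω | S.card * η ≤ |∑ i ∈ S, X i ω ^ 2 - S.card * v|} ≤ 2 * ρ ^ S.card := by
  set Q := gaussianReal 0 v
  have hmean : ∫ x, (x ^ 2 - v) ∂Q = 0 := by
    have hI : Integrable (fun x : ℝ => x ^ 2) Q := (memLp_id_gaussianReal 2).integrable_sq
    have h := variance_id_gaussianReal (μ := 0) (v := v)
    rw [variance_of_integral_eq_zero aemeasurable_id (by simp)] at h
    rw [integral_sub hI (integrable_const _)]
    simp only [id] at h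
    simp [Q, h]
  obtain ⟨C, hC, hCI⟩ := IsGaussian.exists_integrable_exp_sq Q
  have hint : ∀ s : ℝ, |s| ≤ 1 →
      0 ∈ interior (integrableExpSet (fun x : ℝ => s * (x ^ 2 - v)) Q) := by
    intro s hs
    rw [mem_interior_iff_mem_nhds]
    filter_upwards [Metric.ball_mem_nhds (0 : ℝ) hC] with t ht
    rw [Metric.mem_ball, dist_zero_right, Real.norm_eq_abs] at ht
    change Integrable (fun x : ℝ => Real.exp (t * (s * (x ^ 2 - v)))) Q
    refine (hCI.const_mul (Real.exp (C * v))).mono' (by fun_prop) (ae_of_all _ fun x => ?_)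
    rw [Real.norm_of_nonneg (Real.exp_pos _).le, ← Real.exp_add, Real.norm_eq_abs, sq_abs]
    apply Real.exp_le_exp.2
    have h1 : |t * s| ≤ C := by
      rw [abs_mul]
      nlinarith [abs_nonneg t, abs_nonneg s]
    have h2 := abs_le.1 h1
    have hx := sq_nonneg x
    have hv : (0 : ℝ) ≤ v := v.2
    nlinarith [mul_le_mul_of_nonneg_right h2.2 hx, mul_le_mul_of_nonneg_right h2.1 hv]
  obtain ⟨t₁, ht₁, hI₁, hlt₁⟩ := exists_exp_mul_mgf_lt_one (g := fun x => 1 * (x ^ 2 - v))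
    (hint 1 (by simp)) (by simpa using hmean) hη
  obtain ⟨t₂, ht₂, hI₂, hlt₂⟩ := exists_exp_mul_mgf_lt_one (g := fun x => (-1) * (x ^ 2 - v))
    (hint (-1) (by simp)) (by rw [integral_const_mul, hmean, mul_zero]) hη
  -- the rates of the upper and of the lower tail
  set ρ₁ := Real.exp (-(t₁ * η)) * mgf (fun x => 1 * (x ^ 2 - v)) Q t₁ with hρ₁
  set ρ₂ := Real.exp (-(t₂ * η)) * mgf (fun x => (-1) * (x ^ 2 - v)) Q t₂ with hρ₂
  have h1 : 0 ≤ ρ₁ := mul_nonneg (Real.exp_pos _).le mgf_nonneg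
  have h2 : 0 ≤ ρ₂ := mul_nonneg (Real.exp_pos _).le mgf_nonneg
  refine ⟨max ρ₁ ρ₂, le_max_of_le_left h1, max_lt hlt₁ hlt₂, fun X hind hX S => ?_⟩
  have hb1 := measureReal_sum_ge_le_pow hind hX (g := fun x => 1 * (x ^ 2 - v)) (by fun_prop)
    (η := η) ht₁.le hI₁ S
  have hb2 := measureReal_sum_ge_le_pow hind hX (g := fun x => (-1) * (x ^ 2 - v)) (by fun_prop)
    (η := η) ht₂.le hI₂ S
  have hsum : ∀ (s : ℝ) ω, ∑ i ∈ S, s * (X i ω ^ 2 - v) = s * (∑ i ∈ S, X i ω ^ 2 - S.card * v) := by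
    intro s ω
    rw [← Finset.mul_sum, Finset.sum_sub_distrib, Finset.sum_const, nsmul_eq_mul]
  calc P.real {ω | S.card * η ≤ |∑ i ∈ S, X i ω ^ 2 - S.card * v|}
      ≤ P.real ({ω | S.card * η ≤ ∑ i ∈ S, 1 * (X i ω ^ 2 - v)}
        ∪ {ω | S.card * η ≤ ∑ i ∈ S, (-1) * (X i ω ^ 2 - v)}) := by
        refine measureReal_mono fun ω hω => ?_
        have hω' : S.card * η ≤ |∑ i ∈ S, X i ω ^ 2 - S.card * v| := hω
        rcases le_abs.1 hω' with h | h
        · left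
          change _ ≤ ∑ i ∈ S, 1 * (X i ω ^ 2 - (v : ℝ))
          rw [hsum]; linarith
        · right
          change _ ≤ ∑ i ∈ S, (-1) * (X i ω ^ 2 - (v : ℝ))
          rw [hsum]; linarith
    _ ≤ ρ₁ ^ S.card + ρ₂ ^ S.card := (measureReal_union_le _ _).trans (add_le_add hb1 hb2)
    _ ≤ 2 * max ρ₁ ρ₂ ^ S.card := by
        rw [two_mul]
        gcongr
        · exact le_max_left _ _
        · exact le_max_right _ _

end Chernoff

/-! ### Subfamilies of independent Gaussian variables -/

section Families

variable {Ω S α β : Type*} [MeasurableSpace Ω] {P : Measure Ω}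
  {F : S → Ω → ℝ} {v : S → ℝ≥0} [Fintype α] [Fintype β]

lemma hasLaw_gaussianVec_of_iIndepFun (hF : ∀ a, HasLaw (F a) (gaussianReal 0 (v a)) P)
    (hind : iIndepFun F P) {f : α → S} (hf : Function.Injective f) :
    HasLaw (fun ω a => F (f a) ω) (gaussianVec fun a => v (f a)) P where
  aemeasurable := aemeasurable_pi_lambda _ fun a => (hF _).aemeasurable
  map_eq := by
    have h := (hind.precomp hf).map_fun_eq_pi_map fun a => (hF _).aemeasurable
    rw [h]
    congr 1
    funext a
    exact (hF _).map_eq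

lemma indepFun_subfamilies (hF : ∀ a, HasLaw (F a) (gaussianReal 0 (v a)) P)
    (hind : iIndepFun F P) {f : α → S} {g : β → S} (hfg : ∀ a b, f a ≠ g b) :
    IndepFun (fun ω a => F (f a) ω) (fun ω b => F (g b) ω) P := by
  classical
  have h := hind.indepFun_finset₀ (Finset.univ.image f) (Finset.univ.image g)
    (by
      rw [Finset.disjoint_left]
      intro s hs hs'
      obtain ⟨a, -, rfl⟩ := Finset.mem_image.1 hs
      obtain ⟨b, -, hb⟩ := Finset.mem_image.1 hs'
      exact hfg a b hb.symm) fun a => (hF a).aemeasurable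
  exact h.comp
    (φ := fun (x : (Finset.univ.image f) → ℝ) (a : α) =>
      x ⟨f a, Finset.mem_image_of_mem _ (Finset.mem_univ _)⟩)
    (ψ := fun (x : (Finset.univ.image g) → ℝ) (b : β) =>
      x ⟨g b, Finset.mem_image_of_mem _ (Finset.mem_univ _)⟩)
    (by fun_prop) (by fun_prop)

end Families

/-! ### The factor model and conditionally Gaussian prediction errors -/

section Model

variable {Ω : Type*} [MeasurableSpace Ω] {P : Measure Ω}
  {σ σlam : ℝ} {lam : ℤ → Ω → ℝ} {eps : ℕ → ℤ → Ω → ℝ}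

/-- All shocks of the model as one family: factor shocks `inl s`, idiosyncratic shocks
`inr (i, s)`. -/
def shock (lam : ℤ → Ω → ℝ) (eps : ℕ → ℤ → Ω → ℝ) : ℤ ⊕ (ℕ × ℤ) → Ω → ℝ :=
  Sum.elim lam fun p => eps p.1 p.2

/-- The variances of the shocks. -/
noncomputable def shockVar (σ σlam : ℝ) : ℤ ⊕ (ℕ × ℤ) → ℝ≥0 :=
  Sum.elim (fun _ => (σlam ^ 2).toNNReal) fun _ => (σ ^ 2).toNNReal

/-- The model: the factor shocks and the idiosyncratic shocks are jointly independent centred Gaussian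
variables with positive variances `σlam²` and `σ²`. -/
structure IsGaussianModel (P : Measure Ω) (σ σlam : ℝ) (lam : ℤ → Ω → ℝ)
    (eps : ℕ → ℤ → Ω → ℝ) : Prop where
  pos : 0 < σ
  pos_factor : 0 < σlam
  law : ∀ a, HasLaw (shock lam eps a) (gaussianReal 0 (shockVar σ σlam a)) P
  indep : iIndepFun (shock lam eps) P

/-- The shock of column `k` at time `s`: column `none` is the common factor, column `some j` is
the control unit `j + 1`. -/
def columnShock {J : ℕ} (k : Option (Fin J)) (s : ℤ) : ℤ ⊕ (ℕ × ℤ) :=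
  k.elim (Sum.inl s) fun j => Sum.inr ((j : ℕ) + 1, s)

/-- The variances of the columns of the control data. -/
noncomputable def columnVar (σ σlam : ℝ) {J : ℕ} (k : Option (Fin J)) : ℝ≥0 :=
  k.elim (σlam ^ 2).toNNReal fun _ => (σ ^ 2).toNNReal

/-- The data of the control units (common factor and idiosyncratic shocks) over the rows `time`. -/
def controlData (lam : ℤ → Ω → ℝ) (eps : ℕ → ℤ → Ω → ℝ) (J : ℕ) {ι : Type*} (time : ι → ℤ)
    (ω : Ω) : Option (Fin J) × ι → ℝ :=
  fun p => shock lam eps (columnShock p.1 (time p.2)) ω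

/-- The idiosyncratic shocks of unit `0` over the rows `time`. -/
def treatedNoise (eps : ℕ → ℤ → Ω → ℝ) {ι : Type*} (time : ι → ℤ) (ω : Ω) : ι → ℝ :=
  fun i => eps 0 (time i) ω

/-- The shocks that drive the outcomes of a single period: the noise of unit `0`, the common factor
and the noise of the controls. -/
def periodShocks (lam : ℤ → Ω → ℝ) (eps : ℕ → ℤ → Ω → ℝ) (J : ℕ) (t : ℤ) (ω : Ω) :
    Option (Option (Fin J)) → ℝ :=
  fun k => shock lam eps (k.elim (Sum.inr (0, t)) fun k => columnShock k t) ω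

lemma columnShock_injective {J : ℕ} {ι : Type*} {time : ι → ℤ} (ht : Function.Injective time) :
    Function.Injective fun p : Option (Fin J) × ι => columnShock p.1 (time p.2) := by
  rintro ⟨_ | j, i⟩ ⟨_ | j', i'⟩ h
  · simpa [columnShock] using ht (by simpa [columnShock] using h)
  · simp [columnShock] at h
  · simp [columnShock] at h
  · simp only [columnShock, Option.elim_some, Sum.inr.injEq, Prod.mk.injEq, Nat.add_right_cancel_iff]
      at h
    rw [Fin.ext h.1, ht h.2]

lemma columnShock_ne_zero {J : ℕ} (k : Option (Fin J)) (s s' : ℤ) :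
    columnShock k s ≠ Sum.inr (0, s') := by
  cases k <;> simp [columnShock]

lemma columnShock_ne_of_time_ne {J : ℕ} (k k' : Option (Fin J)) {s s' : ℤ} (h : s ≠ s') :
    columnShock k s ≠ columnShock k' s' := by
  cases k <;> cases k' <;> simp [columnShock, h]

lemma shockVar_columnShock {J : ℕ} (k : Option (Fin J)) (s : ℤ) :
    shockVar σ σlam (columnShock k s) = columnVar σ σlam k := by
  cases k <;> rfl

namespace IsGaussianModel

variable (h : IsGaussianModel P σ σlam lam eps) {ι : Type*} [Fintype ι] {time : ι → ℤ}
include h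

lemma hasLaw_controlData (J : ℕ) (ht : Function.Injective time) :
    HasLaw (controlData lam eps J time)
      (gaussianVec fun p : Option (Fin J) × ι => columnVar σ σlam p.1) P := by
  have := hasLaw_gaussianVec_of_iIndepFun h.law h.indep (columnShock_injective (J := J) ht)
  simp only [shockVar_columnShock] at this
  exact this

lemma hasLaw_treatedNoise (ht : Function.Injective time) :
    HasLaw (treatedNoise eps time) (gaussianVec fun _ : ι => (σ ^ 2).toNNReal) P :=
  hasLaw_gaussianVec_of_iIndepFun h.law h.indep (f := fun i => Sum.inr (0, time i))
    fun i j hij => ht (by simpa using hij)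

lemma indepFun_controlData_treatedNoise (J : ℕ) :
    IndepFun (controlData lam eps J time) (treatedNoise eps time) P :=
  indepFun_subfamilies h.law h.indep (g := fun i => Sum.inr (0, time i))
    fun _ _ => columnShock_ne_zero _ _ _

lemma hasLaw_periodShocks (J : ℕ) (t : ℤ) :
    HasLaw (periodShocks lam eps J t) (gaussianVec fun k : Option (Option (Fin J)) =>
      k.elim (σ ^ 2).toNNReal (columnVar σ σlam)) P := by
  have hinj : Function.Injective fun k : Option (Option (Fin J)) =>
      k.elim (Sum.inr (0, t)) fun k => columnShock k t := by
    rintro (_ | k) (_ | k') hk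
    · rfl
    · exact absurd hk.symm (columnShock_ne_zero _ _ _)
    · exact absurd hk (columnShock_ne_zero _ _ _)
    · have := columnShock_injective (J := J) (time := fun _ : Unit => t)
        (fun _ _ _ => rfl) (a₁ := (k, ())) (a₂ := (k', ())) hk
      simp only [Prod.mk.injEq, and_true] at this
      rw [this]
  have := hasLaw_gaussianVec_of_iIndepFun h.law h.indep hinj
  have hv : (fun k : Option (Option (Fin J)) => k.elim (σ ^ 2).toNNReal (columnVar σ σlam))
      = fun k => shockVar σ σlam (k.elim (Sum.inr (0, t)) fun k => columnShock k t) := by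
    funext k
    rcases k with _ | k
    · rfl
    · exact (shockVar_columnShock k t).symm
  rw [hv]
  exact this

lemma indepFun_past_periodShocks (J : ℕ) {t : ℤ} (ht : ∀ i, time i ≠ t) :
    IndepFun (fun ω => (controlData lam eps J time ω, treatedNoise eps time ω))
      (periodShocks lam eps J t) P := by
  have := indepFun_subfamilies h.law h.indep
    (f := fun a : (Option (Fin J) × ι) ⊕ ι => a.elim (fun p => columnShock p.1 (time p.2))
      fun i => Sum.inr (0, time i))
    (g := fun k : Option (Option (Fin J)) => k.elim (Sum.inr (0, t)) fun k => columnShock k t)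
    (by
      rintro (p | i) (_ | k)
      · exact columnShock_ne_zero _ _ _
      · exact columnShock_ne_of_time_ne _ _ (ht _)
      · simp [ht]
      · exact (columnShock_ne_zero _ _ _).symm)
  exact this.comp (φ := fun x => (fun p => x (Sum.inl p), fun i => x (Sum.inr i))) (ψ := id)
    (by fun_prop) measurable_id

lemma hasLaw_factor (ht : Function.Injective time) :
    HasLaw (fun ω i => lam (time i) ω) (gaussianVec fun _ : ι => (σlam ^ 2).toNNReal) P :=
  hasLaw_gaussianVec_of_iIndepFun h.law h.indep (f := fun i => Sum.inl (time i))
    fun i j hij => ht (by simpa using hij)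

lemma hasLaw_controlNoise (J : ℕ) (ht : Function.Injective time) :
    HasLaw (fun ω (p : Fin J × ι) => eps (p.1 + 1) (time p.2) ω)
      (gaussianVec fun _ : Fin J × ι => (σ ^ 2).toNNReal) P :=
  hasLaw_gaussianVec_of_iIndepFun h.law h.indep
    (f := fun p : Fin J × ι => Sum.inr ((p.1 : ℕ) + 1, time p.2)) fun p q hpq => by
      simp only [Sum.inr.injEq, Prod.mk.injEq, Nat.add_right_cancel_iff] at hpq
      exact Prod.ext (Fin.ext hpq.1) (ht hpq.2)

lemma indepFun_factor_controlNoise (J : ℕ) :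
    IndepFun (fun ω i => lam (time i) ω)
      (fun ω (p : Fin J × ι) => eps (p.1 + 1) (time p.2) ω) P :=
  indepFun_subfamilies h.law h.indep (f := fun i => Sum.inl (time i))
    (g := fun p : Fin J × ι => Sum.inr ((p.1 : ℕ) + 1, time p.2)) fun _ _ => by simp

end IsGaussianModel

/-- The loadings of the columns of the control data on the control outcomes
`y_j = λ + ε_j`. -/
def loadings (J : ℕ) : Matrix (Option (Fin J)) (Fin J) ℝ :=
  Matrix.of fun k j => k.elim 1 fun i => if i = j then 1 else 0

lemma exists_leftInverse_loadings (J : ℕ) :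
    ∃ C : Matrix (Fin J) (Option (Fin J)) ℝ, C * loadings J = 1 := by
  refine ⟨Matrix.of fun j k => k.elim 0 fun i => if i = j then 1 else 0, ?_⟩
  ext j j'
  rw [Matrix.mul_apply, Fintype.sum_option]
  simp [loadings, Matrix.one_apply, eq_comm]

lemma designMatrix_loadings {J : ℕ} {ι : Type*} (z : Option (Fin J) × ι → ℝ) (i : ι)
    (j : Fin J) : designMatrix (loadings J) z i j = z (none, i) + z (some j, i) := by
  rw [designMatrix, Matrix.mul_apply, Fintype.sum_option]
  simp [loadings]

/-- The matrix of control outcomes as a function of the control data. -/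
abbrev controlMatrix {J : ℕ} {ι : Type*} (z : Option (Fin J) × ι → ℝ) : Matrix ι (Fin J) ℝ :=
  designMatrix (loadings J) z

lemma controlMatrix_apply {J : ℕ} {ι : Type*} (z : Option (Fin J) × ι → ℝ) (i : ι) (j : Fin J) :
    controlMatrix z i j = z (none, i) + z (some j, i) :=
  designMatrix_loadings z i j

lemma columnVar_ne_zero (hσ : 0 < σ) (hσlam : 0 < σlam) {J : ℕ} (k : Option (Fin J)) :
    columnVar σ σlam k ≠ 0 := by
  cases k <;> simp [columnVar] <;> positivity

/-- The outcome `λ + ε₀` of unit `0` as a function of the control data and the noise of unit `0`. -/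
def treatedVec {J : ℕ} {ι : Type*} (w : (Option (Fin J) × ι → ℝ) × (ι → ℝ)) : ι → ℝ :=
  fun i => w.1 (none, i) + w.2 i

/-- The OLS coefficients `(XᵀX)⁻¹ Xᵀ y` as a function of the data. They solve the least squares problem
only if the Gram matrix is invertible, which holds almost surely for at most as many controls as
periods. -/
noncomputable def olsCoef {J : ℕ} {ι : Type*} [Fintype ι]
    (w : (Option (Fin J) × ι → ℝ) × (ι → ℝ)) : Fin J → ℝ :=
  ((controlMatrix w.1)ᵀ * controlMatrix w.1)⁻¹ *ᵥ ((controlMatrix w.1)ᵀ *ᵥ treatedVec w)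

lemma measurable_olsCoef {J : ℕ} {ι : Type*} [Fintype ι] :
    Measurable (olsCoef : (Option (Fin J) × ι → ℝ) × (ι → ℝ) → Fin J → ℝ) := by
  have hX : ∀ i j, Measurable fun w : (Option (Fin J) × ι → ℝ) × (ι → ℝ) => controlMatrix w.1 i j :=
    fun i j => (measurable_designMatrix_apply (loadings J) i j).comp measurable_fst
  refine measurable_pi_lambda _ fun j => ?_
  refine measurable_mulVec_apply (measurable_matrix_inv_apply
    (measurable_matrix_mul_apply (fun k l => hX l k) hX)) (measurable_mulVec_apply
    (fun k l => hX l k) fun i => ?_) j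
  unfold treatedVec
  fun_prop

/-- The pre-treatment periods as an index type of rows. -/
def preTime (T₀ : ℕ) : prePeriods T₀ → ℤ := Subtype.val

/-- The pre-treatment periods together with the period `t`, which is the row `none`. -/
def extTime (T₀ : ℕ) (t : ℤ) : Option (prePeriods T₀) → ℤ := fun r => r.elim t Subtype.val

lemma preTime_injective (T₀ : ℕ) : Function.Injective (preTime T₀) := Subtype.val_injective

lemma preTime_nonpos {T₀ : ℕ} (s : prePeriods T₀) : preTime T₀ s ≤ 0 :=
  (Finset.mem_Ioc.1 s.2).2

lemma preTime_ne {T₀ : ℕ} {t : ℤ} (ht : 0 < t) (s : prePeriods T₀) : preTime T₀ s ≠ t := by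
  have := preTime_nonpos s
  omega

lemma extTime_injective (T₀ : ℕ) {t : ℤ} (ht : 0 < t) : Function.Injective (extTime T₀ t) := by
  rintro (_ | s) (_ | s') h
  · rfl
  · exact absurd h.symm (preTime_ne ht s')
  · exact absurd h (preTime_ne ht s)
  · exact congrArg some (preTime_injective T₀ h)

lemma card_prePeriods (T₀ : ℕ) : Fintype.card (prePeriods T₀) = T₀ := by
  rw [Fintype.card_coe]
  simp [prePeriods]

/-- The pre-treatment data on which weights may depend: the factor and the noise of the controls, and
the noise of unit `0`. -/
def preData (lam : ℤ → Ω → ℝ) (eps : ℕ → ℤ → Ω → ℝ) (T₀ J : ℕ) (ω : Ω) :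
    (Option (Fin J) × prePeriods T₀ → ℝ) × (prePeriods T₀ → ℝ) :=
  (controlData lam eps J (preTime T₀) ω, treatedNoise eps (preTime T₀) ω)

variable {α : ℕ → ℤ → ℝ}

omit [MeasurableSpace Ω] in
lemma outcome_of_nonpos (i : ℕ) {s : ℤ} (hs : s ≤ 0) (ω : Ω) :
    outcome α lam eps i s ω = lam s ω + eps i s ω := by
  simp [outcome, treatment, untreatedOutcome, not_lt.2 hs]

omit [MeasurableSpace Ω] in
lemma outcome_control (j : ℕ) (s : ℤ) (ω : Ω) :
    outcome α lam eps (j + 1) s ω = lam s ω + eps (j + 1) s ω := by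
  simp [outcome, treatment, untreatedOutcome]

omit [MeasurableSpace Ω] in
lemma outcome_treated {t : ℤ} (ht : 0 < t) (ω : Ω) :
    outcome α lam eps 0 t ω = α 0 t + (lam t ω + eps 0 t ω) := by
  simp [outcome, treatment, treatedOutcome, untreatedOutcome, ht]

omit [MeasurableSpace Ω] in
/-- The pre-treatment loss is the mean squared residual of the data matrices. -/
lemma preTreatmentLoss_eq (T₀ J : ℕ) (b : Fin J → ℝ) (ω : Ω) :
    preTreatmentLoss (fun i s => outcome α lam eps i s ω) T₀ J b
      = (1 / (T₀ : ℝ)) *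
        ((treatedVec (preData lam eps T₀ J ω) - controlMatrix (preData lam eps T₀ J ω).1 *ᵥ b) ⬝ᵥ
          (treatedVec (preData lam eps T₀ J ω)
            - controlMatrix (preData lam eps T₀ J ω).1 *ᵥ b)) := by
  rw [preTreatmentLoss, dotProduct]
  congr 1
  rw [← Finset.sum_coe_sort (prePeriods T₀)]
  refine Finset.sum_congr rfl fun s _ => ?_
  have hs : (s : ℤ) ≤ 0 := preTime_nonpos s
  rw [← sq]
  congr 1
  simp only [controlOutcome, outcome_of_nonpos _ hs, Pi.sub_apply, mulVec, dotProduct,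
    designMatrix_loadings]
  congr 1
  exact Finset.sum_congr rfl fun j _ => mul_comm _ _

omit [MeasurableSpace Ω] in
/-- The prediction error of unit `0` in a post-treatment period is a linear form in the shocks of
that period. -/
lemma effectEstimator_eq {J : ℕ} (b : Fin J → ℝ) {t : ℤ} (ht : 0 < t) (ω : Ω) :
    effectEstimator (fun i s => outcome α lam eps i s ω) b t
      = α 0 t + ((fun k : Option (Option (Fin J)) =>
          k.elim 1 fun k => k.elim (1 - ∑ j, b j) fun j => -b j) ⬝ᵥ periodShocks lam eps J t ω) := by
  rw [effectEstimator, controlOutcome, outcome_treated ht, dotProduct, Fintype.sum_option,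
    Fintype.sum_option]
  simp only [outcome_control, periodShocks, columnShock, shock, Option.elim_none, Option.elim_some,
    Sum.elim_inl, Sum.elim_inr, mul_add, Finset.sum_add_distrib, ← Finset.sum_mul, neg_mul,
    Finset.sum_neg_distrib]
  ring

/-- The prediction variance of weights `b` in a new period: the variance of
`(1 - ∑ b_j) λ + ε_0 - ∑ b_j ε_j` for fixed `b`. -/
def predictionVar (σ σlam : ℝ) {J : ℕ} (b : Fin J → ℝ) : ℝ :=
  σ ^ 2 * (1 + b ⬝ᵥ b) + σlam ^ 2 * (1 - ∑ j, b j) ^ 2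

lemma predictionVar_nonneg {J : ℕ} (b : Fin J → ℝ) : 0 ≤ predictionVar σ σlam b := by
  have := dotProduct_self_nonneg b
  unfold predictionVar
  positivity

lemma measurable_predictionVar {J : ℕ} :
    Measurable (predictionVar σ σlam : (Fin J → ℝ) → ℝ) := by
  unfold predictionVar dotProduct
  fun_prop

lemma IsGaussianModel.aemeasurable_preData (h : IsGaussianModel P σ σlam lam eps) (T₀ J : ℕ) :
    AEMeasurable (preData lam eps T₀ J) P :=
  (h.hasLaw_controlData J (preTime_injective T₀)).aemeasurable.prodMk
    (h.hasLaw_treatedNoise (preTime_injective T₀)).aemeasurable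

/-- Weights that depend on pre-treatment data only make the estimator conditionally Gaussian, with
variance `predictionVar`. -/
lemma IsGaussianModel.integral_cexp_effectEstimator [IsProbabilityMeasure P]
    (h : IsGaussianModel P σ σlam lam eps)
    {T₀ J : ℕ} {t : ℤ} (ht : 0 < t) {b : Ω → Fin J → ℝ}
    {β : (Option (Fin J) × prePeriods T₀ → ℝ) × (prePeriods T₀ → ℝ) → Fin J → ℝ}
    (hβ : Measurable β) (hb : ∀ᵐ ω ∂P, b ω = β (preData lam eps T₀ J ω)) (θ : ℝ) :
    ∫ ω, Complex.exp (((θ * effectEstimator (fun i s => outcome α lam eps i s ω) (b ω) t : ℝ) : ℂ)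
        * Complex.I) ∂P
      = Complex.exp (θ * α 0 t * Complex.I)
        * ((∫ ω, Real.exp (-(θ ^ 2 / 2 * predictionVar σ σlam (b ω))) ∂P : ℝ) : ℂ) := by
  set f : (Option (Fin J) × prePeriods T₀ → ℝ) × (prePeriods T₀ → ℝ) → Option (Option (Fin J)) → ℝ :=
    fun w k => θ * k.elim 1 fun k => k.elim (1 - ∑ j, β w j) fun j => -β w j with hf
  have hfm : Measurable f := by
    refine measurable_pi_lambda _ fun k => ?_
    have hβj : ∀ j, Measurable fun w => β w j := fun j => (measurable_pi_apply j).comp hβ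
    rcases k with _ | _ | j
    · simp only [hf, Option.elim_none]; fun_prop
    · simp only [hf, Option.elim_none, Option.elim_some]; fun_prop
    · simp only [hf, Option.elim_some]; fun_prop
  have key := integral_cexp_gaussian_mixture (h.aemeasurable_preData T₀ J)
    (h.hasLaw_periodShocks J t)
    (h.indepFun_past_periodShocks J (preTime_ne ht)) hfm
  have h1 : ∫ ω, Complex.exp (((θ * effectEstimator (fun i s => outcome α lam eps i s ω) (b ω) t
      : ℝ) : ℂ) * Complex.I) ∂P = Complex.exp (θ * α 0 t * Complex.I)
        * ∫ ω, Complex.exp (((f (preData lam eps T₀ J ω) ⬝ᵥ periodShocks lam eps J t ω : ℝ) : ℂ)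
          * Complex.I) ∂P := by
    rw [← integral_const_mul]
    refine integral_congr_ae ?_
    filter_upwards [hb] with ω hω
    rw [← Complex.exp_add, effectEstimator_eq _ ht, hω]
    have : f (preData lam eps T₀ J ω) = θ • (fun k : Option (Option (Fin J)) =>
          k.elim 1 fun k => k.elim (1 - ∑ j, β (preData lam eps T₀ J ω) j)
            fun j => -β (preData lam eps T₀ J ω) j) := rfl
    rw [this, smul_dotProduct, smul_eq_mul]
    congr 1
    push_cast
    ring
  rw [h1, key]
  congr 2
  refine integral_congr_ae ?_
  filter_upwards [hb] with ω hω
  congr 1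
  rw [hω, Fintype.sum_option, Fintype.sum_option]
  simp only [hf, Option.elim_none, Option.elim_some, columnVar, Real.coe_toNNReal _ (sq_nonneg _),
    predictionVar, dotProduct]
  have : ∑ j, σ ^ 2 * (θ * -β (preData lam eps T₀ J ω) j) ^ 2
      = σ ^ 2 * θ ^ 2 * ∑ j, β (preData lam eps T₀ J ω) j * β (preData lam eps T₀ J ω) j := by
    rw [Finset.mul_sum]
    exact Finset.sum_congr rfl fun j _ => by ring
  rw [this]
  ring

/-- If the prediction variance converges in probability to a constant, the estimator is asymptotically
Gaussian with that variance. -/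
lemma IsGaussianModel.tendstoInDistribution_effectEstimator [IsProbabilityMeasure P]
    (h : IsGaussianModel P σ σlam lam eps)
    {J : ℕ → ℕ} {t : ℤ} (ht : 0 < t) {b : (n : ℕ) → Ω → Fin (J n) → ℝ}
    {β : (n : ℕ) → (Option (Fin (J n)) × prePeriods n → ℝ) × (prePeriods n → ℝ) → Fin (J n) → ℝ}
    (hbm : ∀ n, AEMeasurable (b n) P) (hβ : ∀ᶠ n in atTop, Measurable (β n))
    (hb : ∀ᶠ n in atTop, ∀ᵐ ω ∂P, b n ω = β n (preData lam eps n (J n) ω)) {a : ℝ} (ha : 0 ≤ a)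
    (hV : TendstoInMeasure P (fun n ω => predictionVar σ σlam (b n ω)) atTop fun _ => a) :
    TendstoInDistribution
      (fun n ω => effectEstimator (fun i s => outcome α lam eps i s ω) (b n ω) t)
      atTop id (fun _ => P) (gaussianReal (α 0 t) a.toNNReal) := by
  have hest : ∀ n, AEMeasurable (fun ω =>
      effectEstimator (fun i s => outcome α lam eps i s ω) (b n ω) t) P := by
    intro n
    have hps := (h.hasLaw_periodShocks (J n) t).aemeasurable
    have hbj : ∀ j, AEMeasurable (fun ω => b n ω j) P := fun j =>
      (measurable_pi_apply j).comp_aemeasurable (hbm n)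
    have hpk : ∀ k, AEMeasurable (fun ω => periodShocks lam eps (J n) t ω k) P := fun k =>
      (measurable_pi_apply k).comp_aemeasurable hps
    simp_rw [effectEstimator_eq _ ht]
    simp only [dotProduct]
    refine AEMeasurable.const_add (Finset.aemeasurable_fun_sum _ fun k _ =>
      AEMeasurable.mul ?_ (hpk k)) _
    rcases k with _ | _ | j
    · exact aemeasurable_const
    · exact (Finset.aemeasurable_fun_sum _ fun j _ => hbj j).const_sub 1
    · exact (hbj j).neg
  refine tendstoInDistribution_gaussianReal_of_charFun hest fun θ => ?_
  have hVm : ∀ n, AEMeasurable (fun ω => predictionVar σ σlam (b n ω)) P := fun n =>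
    measurable_predictionVar.comp_aemeasurable (hbm n)
  -- the absolute value, immaterial for variances, makes the test function bounded
  let φ : BoundedContinuousFunction ℝ ℝ := BoundedContinuousFunction.ofNormedAddCommGroup
    (fun r => Real.exp (-(θ ^ 2 / 2 * |r|))) (by fun_prop) 1 fun r => by
      rw [Real.norm_of_nonneg (Real.exp_pos _).le, Real.exp_le_one_iff]
      have : 0 ≤ θ ^ 2 / 2 * |r| := by positivity
      linarith
  have hlim := tendsto_integral_of_tendstoInMeasure_const hVm hV φ
  have hφa : φ a = Real.exp (-(θ ^ 2 / 2 * a)) := by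
    change Real.exp (-(θ ^ 2 / 2 * |a|)) = _
    rw [abs_of_nonneg ha]
  rw [hφa] at hlim
  have hlim2 := ((Complex.continuous_ofReal.tendsto _).comp hlim).const_mul
    (Complex.exp (θ * α 0 t * Complex.I))
  have htarget : Complex.exp (θ * α 0 t * Complex.I - (a.toNNReal : ℝ) * θ ^ 2 / 2)
      = Complex.exp (θ * α 0 t * Complex.I) * ((Real.exp (-(θ ^ 2 / 2 * a)) : ℝ) : ℂ) := by
    rw [Complex.ofReal_exp, ← Complex.exp_add, Real.coe_toNNReal _ ha]
    congr 1
    push_cast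
    ring
  have hcast : Complex.exp (θ * α 0 t * Complex.I - (a.toNNReal : ℂ) * θ ^ 2 / 2)
      = Complex.exp (θ * α 0 t * Complex.I - (a.toNNReal : ℝ) * θ ^ 2 / 2) := rfl
  rw [hcast, htarget]
  refine hlim2.congr' ?_
  filter_upwards [hβ, hb] with n hβ hb
  rw [h.integral_cexp_effectEstimator ht hβ hb]
  simp only [Function.comp]
  congr 2
  refine integral_congr_ae (ae_of_all _ fun ω => ?_)
  change Real.exp (-(θ ^ 2 / 2 * |predictionVar σ σlam (b n ω)|)) = _
  rw [abs_of_nonneg (predictionVar_nonneg _)]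

end Model

/-! ### Algebra of the regression on the controls -/

section ControlAlgebra

variable {J : ℕ} {ι : Type*} [Fintype ι]

/-- The loadings of the cross-sectional mean of the idiosyncratic shocks. -/
noncomputable def meanLoading (J : ℕ) (k : Option (Fin J)) : ℝ := k.elim 0 fun _ => 1 / J

/-- The cross-sectional mean of the idiosyncratic shocks of the controls. -/
noncomputable def noiseMean (z : Option (Fin J) × ι → ℝ) : ι → ℝ :=
  fun i => ∑ k, meanLoading J k * z (k, i)

/-- The vector `X (XᵀX)⁻¹ 1`, which represents the sum of the OLS coefficients as a linear form in
the outcome vector. -/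
noncomputable def sumVec (z : Option (Fin J) × ι → ℝ) : ι → ℝ :=
  controlMatrix z *ᵥ (((controlMatrix z)ᵀ * controlMatrix z)⁻¹ *ᵥ 1)

omit [Fintype ι] in
/-- The cross-sectional mean of the controls recovers the factor up to averaged noise. -/
lemma controlMatrix_mulVec_mean (hJ : J ≠ 0) (z : Option (Fin J) × ι → ℝ) :
    controlMatrix z *ᵥ (fun _ => 1 / (J : ℝ)) = (fun i => z (none, i)) + noiseMean z := by
  funext i
  have hJ' : (J : ℝ) ≠ 0 := by exact_mod_cast hJ
  simp only [mulVec, dotProduct, designMatrix_loadings, add_mul, Finset.sum_add_distrib,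
    Finset.sum_const, Finset.card_univ, Fintype.card_fin, nsmul_eq_mul, Pi.add_apply, noiseMean,
    Fintype.sum_option, meanLoading, Option.elim_none, Option.elim_some, zero_mul, zero_add]
  congr 1
  · field_simp
  · exact Finset.sum_congr rfl fun j _ => mul_comm _ _

/-- The cross-sectional mean of the controls lies in the span of the regressors, so that the factor and
the averaged noise have opposite residuals. -/
lemma residualMaker_mulVec_factor [DecidableEq ι] (hJ : J ≠ 0) {z : Option (Fin J) × ι → ℝ}
    (hz : IsUnit ((controlMatrix z)ᵀ * controlMatrix z).det) :
    residualMaker (controlMatrix z) *ᵥ (fun i => z (none, i))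
      = -(residualMaker (controlMatrix z) *ᵥ noiseMean z) := by
  have h := congrArg (fun v => residualMaker (controlMatrix z) *ᵥ v) (controlMatrix_mulVec_mean hJ z)
  simp only [mulVec_mulVec, residualMaker_mul hz, zero_mulVec, mulVec_add] at h
  exact eq_neg_of_add_eq_zero_left h.symm

lemma gram_inv_transpose (z : Option (Fin J) × ι → ℝ) :
    (((controlMatrix z)ᵀ * controlMatrix z)⁻¹)ᵀ = ((controlMatrix z)ᵀ * controlMatrix z)⁻¹ := by
  rw [transpose_nonsing_inv, transpose_mul, transpose_transpose]

lemma sumVec_dotProduct (z : Option (Fin J) × ι → ℝ) (y : ι → ℝ) :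
    sumVec z ⬝ᵥ y
      = 1 ⬝ᵥ (((controlMatrix z)ᵀ * controlMatrix z)⁻¹ *ᵥ ((controlMatrix z)ᵀ *ᵥ y)) := by
  rw [sumVec, dotProduct_mulVec 1, ← mulVec_transpose, gram_inv_transpose, dotProduct_mulVec,
    ← mulVec_transpose, transpose_transpose]

/-- The factor drops out of the error of the sum of the coefficients: `sumVec` has inner product one
with the cross-sectional mean of the controls. -/
lemma one_sub_sum_olsCoef (hJ : J ≠ 0) {w : (Option (Fin J) × ι → ℝ) × (ι → ℝ)}
    (hz : IsUnit ((controlMatrix w.1)ᵀ * controlMatrix w.1).det) :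
    1 - ∑ j, olsCoef w j = sumVec w.1 ⬝ᵥ noiseMean w.1 - sumVec w.1 ⬝ᵥ w.2 := by
  have h1 : ∑ j, olsCoef w j = sumVec w.1 ⬝ᵥ treatedVec w := by
    rw [sumVec_dotProduct, one_dotProduct]
    rfl
  have h2 : sumVec w.1 ⬝ᵥ (controlMatrix w.1 *ᵥ fun _ => 1 / (J : ℝ)) = 1 := by
    rw [sumVec_dotProduct, mulVec_mulVec, mulVec_mulVec, Matrix.mul_assoc,
      nonsing_inv_mul _ hz, one_mulVec, one_dotProduct]
    have hJ' : (J : ℝ) ≠ 0 := by exact_mod_cast hJ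
    simp [hJ']
  have h3 : treatedVec w = (controlMatrix w.1 *ᵥ fun _ => 1 / (J : ℝ)) - noiseMean w.1 + w.2 := by
    rw [controlMatrix_mulVec_mean hJ]
    funext i
    simp [treatedVec]
  rw [h1, h3, dotProduct_add, dotProduct_sub, h2]
  ring

/-- The idiosyncratic shocks of the controls within the control data. -/
def noiseData (z : Option (Fin J) × ι → ℝ) : Fin J × ι → ℝ := fun p => z (some p.1, p.2)

/-- The sum of the coefficients is estimated at least as precisely as the part of the factor that is
orthogonal to the idiosyncratic shocks allows. -/
lemma sumVec_sq_mul_le [DecidableEq ι] {z : Option (Fin J) × ι → ℝ}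
    (hz : IsUnit ((controlMatrix z)ᵀ * controlMatrix z).det)
    (hE : IsUnit ((designMatrix (1 : Matrix (Fin J) (Fin J) ℝ) (noiseData z))ᵀ
      * designMatrix (1 : Matrix (Fin J) (Fin J) ℝ) (noiseData z)).det) :
    (sumVec z ⬝ᵥ sumVec z) * ((fun i => z (none, i)) ⬝ᵥ
      (residualMaker (designMatrix (1 : Matrix (Fin J) (Fin J) ℝ) (noiseData z)) *ᵥ fun i => z (none, i))) ≤ 1 := by
  set E : Matrix ι (Fin J) ℝ := designMatrix 1 (noiseData z) with hEdef
  set u := ((controlMatrix z)ᵀ * controlMatrix z)⁻¹ *ᵥ (1 : Fin J → ℝ) with hu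
  set l : ι → ℝ := fun i => z (none, i) with hl
  set K := sumVec z ⬝ᵥ sumVec z with hK
  have hKu : K = 1 ⬝ᵥ u := by
    rw [hK, sumVec_dotProduct, sumVec, mulVec_mulVec, mulVec_mulVec, Matrix.mul_assoc,
      nonsing_inv_mul _ hz, one_mulVec]
  have hk : sumVec z = K • l + E *ᵥ u := by
    funext i
    rw [hKu, sumVec, ← hu, one_dotProduct]
    simp only [mulVec, dotProduct, controlMatrix_apply, add_mul, Finset.sum_add_distrib,
      Pi.add_apply, Pi.smul_apply, smul_eq_mul, hEdef, designMatrix, Matrix.mul_one, of_apply,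
      noiseData, Finset.sum_mul, hl]
    congr 1
    exact Finset.sum_congr rfl fun j _ => mul_comm _ _
  -- only the multiple `K` of the factor survives the projection off the noise
  have hMk : residualMaker E *ᵥ sumVec z = K • (residualMaker E *ᵥ l) := by
    rw [hk, mulVec_add, mulVec_smul, mulVec_mulVec, residualMaker_mul hE, zero_mulVec, add_zero]
  have h1 := residualMaker_mulVec_sq_le hE (sumVec z)
  rw [hMk, smul_dotProduct, dotProduct_smul, ← dotProduct_residualMaker hE, smul_eq_mul,
    smul_eq_mul, ← hK] at h1
  have hK0 : 0 ≤ K := dotProduct_self_nonneg _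
  rcases hK0.eq_or_lt with h0 | hpos
  · rw [← h0]; simp
  · exact le_of_mul_le_mul_left (by rw [mul_one]; exact h1) hpos

lemma measurable_sumVec_apply (i : ι) :
    Measurable fun z : Option (Fin J) × ι → ℝ => sumVec z i := by
  have hX : ∀ i j, Measurable fun z : Option (Fin J) × ι → ℝ => controlMatrix z i j :=
    fun i j => measurable_designMatrix_apply (loadings J) i j
  exact measurable_mulVec_apply hX (measurable_mulVec_apply (measurable_matrix_inv_apply
    (measurable_matrix_mul_apply (fun k l => hX l k) hX)) fun _ => measurable_const) i

end ControlAlgebra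

/-! ### OLS weights as a function of the data -/

section Ols

variable {Ω : Type*} [MeasurableSpace Ω] {P : Measure Ω} {σ σlam : ℝ} {lam : ℤ → Ω → ℝ}
  {eps : ℕ → ℤ → Ω → ℝ} {α : ℕ → ℤ → ℝ}

lemma IsGaussianModel.ae_isUnit_controlMatrix (h : IsGaussianModel P σ σlam lam eps) {n J : ℕ}
    (hJn : J ≤ n) : ∀ᵐ ω ∂P, IsUnit ((controlMatrix (preData lam eps n J ω).1)ᵀ
      * controlMatrix (preData lam eps n J ω).1).det := by
  obtain ⟨C, hC⟩ := exists_leftInverse_loadings J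
  have h1 := ae_isUnit_det_gram (ι := prePeriods n)
    (columnVar_ne_zero (J := J) h.pos h.pos_factor) hC
    (by rw [Fintype.card_fin, card_prePeriods]; exact hJn)
  have hlaw := h.hasLaw_controlData J (preTime_injective n)
  rw [← hlaw.map_eq] at h1
  exact ae_of_ae_map hlaw.aemeasurable h1

omit [MeasurableSpace Ω] in
lemma IsOLSWeights.eq_olsCoef {n J : ℕ} (hn : n ≠ 0) {ω : Ω}
    (hz : IsUnit ((controlMatrix (preData lam eps n J ω).1)ᵀ
      * controlMatrix (preData lam eps n J ω).1).det) {b : Fin J → ℝ}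
    (hb : IsOLSWeights (fun i s => outcome α lam eps i s ω) n J b) :
    b = olsCoef (preData lam eps n J ω) := by
  refine eq_of_normal_equations hz (normal_equations fun b' => ?_)
  have h := hb (Set.mem_univ b')
  simp only [preTreatmentLoss_eq] at h
  have hn' : (0 : ℝ) < n := by exact_mod_cast Nat.pos_of_ne_zero hn
  exact le_of_mul_le_mul_left h (by positivity)

omit [MeasurableSpace Ω] in
/-- The leave-one-out form of the OLS prediction error in period `t`, in terms of the regression that
includes period `t`: the factor contributes only through the averaged noise of the controls. -/
lemma effectEstimator_olsCoef {n J : ℕ} (hJ : J ≠ 0) {t : ℤ} (ht : 0 < t) {ω : Ω}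
    (hz : IsUnit ((controlMatrix (preData lam eps n J ω).1)ᵀ
      * controlMatrix (preData lam eps n J ω).1).det) :
    effectEstimator (fun i s => outcome α lam eps i s ω) (olsCoef (preData lam eps n J ω)) t
      = α 0 t + (((fun i => residualMaker (controlMatrix (controlData lam eps J (extTime n t) ω)) none i
          / residualMaker (controlMatrix (controlData lam eps J (extTime n t) ω)) none none)
            ⬝ᵥ treatedNoise eps (extTime n t) ω)
        + -((residualMaker (controlMatrix (controlData lam eps J (extTime n t) ω))
            *ᵥ noiseMean (controlData lam eps J (extTime n t) ω)) none
          / residualMaker (controlMatrix (controlData lam eps J (extTime n t) ω)) none none)) := by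
  set z := controlData lam eps J (extTime n t) ω with hzdef
  set e := treatedNoise eps (extTime n t) ω with hedef
  set X := controlMatrix z with hX
  have hsub : X.submatrix some id = controlMatrix (preData lam eps n J ω).1 := by
    ext s j
    rw [submatrix_apply, hX, controlMatrix_apply, controlMatrix_apply]
    rfl
  have hpos : 0 < residualMaker X none none := residualMaker_none_pos (by rw [hsub]; exact hz)
  have hXu : IsUnit (Xᵀ * X).det := isUnit_det_gram_of_submatrix (by rw [hsub]; exact hz)
  have hloo := residualMaker_mulVec_none hXu (treatedVec (z, e)) (olsCoef (preData lam eps n J ω))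
    (by
      rw [hsub]
      have : (fun s => treatedVec (z, e) (some s)) = treatedVec (preData lam eps n J ω) := rfl
      rw [this, mulVec_sub, sub_eq_zero, olsCoef, mulVec_mulVec, mulVec_mulVec,
        mul_nonsing_inv _ hz, one_mulVec])
  have hsplit : treatedVec (z, e) = (fun i => z (none, i)) + e := rfl
  rw [hsplit, mulVec_add, residualMaker_mulVec_factor hJ hXu] at hloo
  have hest : effectEstimator (fun i s => outcome α lam eps i s ω)
      (olsCoef (preData lam eps n J ω)) t = α 0 t + (((fun i => z (none, i)) + e) none
        - X none ⬝ᵥ olsCoef (preData lam eps n J ω)) := by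
    rw [effectEstimator, controlOutcome, outcome_treated ht, add_sub_assoc]
    congr 2
    refine Finset.sum_congr rfl fun j _ => ?_
    rw [outcome_control, hX, controlMatrix_apply, mul_comm]
    rfl
  have hW : (fun i => residualMaker X none i / residualMaker X none none) ⬝ᵥ e
      = (residualMaker X *ᵥ e) none / residualMaker X none none := by
    simp only [dotProduct, mulVec, Finset.sum_div]
    exact Finset.sum_congr rfl fun _ _ => by ring
  rw [hest, hW, ← neg_div, ← add_div]
  congr 1
  rw [eq_div_iff hpos.ne', mul_comm, ← hloo]
  simp only [Pi.add_apply, Pi.neg_apply]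
  ring

end Ols

/-! ### Prediction variance of OLS -/

section OlsLimits

variable {Ω : Type*} [MeasurableSpace Ω] {P : Measure Ω} [IsProbabilityMeasure P] {σ σlam : ℝ}
  {lam : ℤ → Ω → ℝ} {eps : ℕ → ℤ → Ω → ℝ} {α : ℕ → ℤ → ℝ} {J : ℕ → ℕ} {c : ℝ}

lemma eventually_le_of_ratio (hc1 : c < 1)
    (hJc : Tendsto (fun n : ℕ => (J n : ℝ) / (n : ℝ)) atTop (𝓝 c)) : ∀ᶠ n in atTop, J n ≤ n := by
  filter_upwards [hJc.eventually_lt_const hc1, eventually_gt_atTop 0] with n hn h0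
  rw [div_lt_one (by exact_mod_cast h0)] at hn
  exact_mod_cast hn.le

lemma tendstoInMeasure_of_tendsto_const {a : ℕ → ℝ} {l : ℝ} (ha : Tendsto a atTop (𝓝 l)) :
    TendstoInMeasure P (fun n (_ : Ω) => a n) atTop fun _ => l :=
  tendstoInMeasure_of_tendsto_ae (fun _ => aestronglyMeasurable_const) (ae_of_all _ fun _ => ha)

/-- The residual maker of the controls over the pre-treatment periods and the period `t`. -/
noncomputable abbrev extResidualMaker (lam : ℤ → Ω → ℝ) (eps : ℕ → ℤ → Ω → ℝ) (n J : ℕ) (t : ℤ)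
    (ω : Ω) : Matrix (Option (prePeriods n)) (Option (prePeriods n)) ℝ :=
  residualMaker (controlMatrix (controlData lam eps J (extTime n t) ω))

namespace IsGaussianModel

variable (h : IsGaussianModel P σ σlam lam eps)
include h

omit [IsProbabilityMeasure P] in
lemma aemeasurable_extResidualMaker {t : ℤ} (ht : 0 < t) (n J : ℕ)
    (i j : Option (prePeriods n)) :
    AEMeasurable (fun ω => extResidualMaker lam eps n J t ω i j) P :=
  (measurable_residualMaker_apply
    (measurable_designMatrix_apply (loadings J)) i j).comp_aemeasurable
    (h.hasLaw_controlData J (extTime_injective n ht)).aemeasurable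

omit [IsProbabilityMeasure P] in
lemma ae_isUnit_gaussianVec_ext {n J : ℕ} (hJn : J ≤ n) :
    ∀ᵐ z ∂gaussianVec (fun p : Option (Fin J) × Option (prePeriods n) => columnVar σ σlam p.1),
      IsUnit ((controlMatrix z)ᵀ * controlMatrix z).det := by
  obtain ⟨C, hC⟩ := exists_leftInverse_loadings J
  refine ae_isUnit_det_gram (columnVar_ne_zero (J := J) h.pos h.pos_factor) hC ?_
  rw [Fintype.card_fin, Fintype.card_option, card_prePeriods]
  exact hJn.trans n.le_succ

/-- One minus the leverage of period `t` tends to the fraction of residual degrees of freedom. -/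
lemma tendstoInMeasure_extResidualMaker {t : ℤ} (ht : 0 < t) (hc1 : c < 1)
    (hJc : Tendsto (fun n : ℕ => (J n : ℝ) / (n : ℝ)) atTop (𝓝 c)) :
    TendstoInMeasure P (fun n ω => extResidualMaker lam eps n (J n) t ω none none) atTop
      fun _ => 1 - c := by
  set r : ℕ → ℝ := fun n => (((n + 1 : ℕ) : ℝ) - J n) / ((n + 1 : ℕ) : ℝ) with hr
  have hcard : ∀ n, Fintype.card (Option (prePeriods n)) = n + 1 := fun n => by
    rw [Fintype.card_option, card_prePeriods]
  have key : ∀ n, J n ≤ n →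
      Integrable (fun ω => (extResidualMaker lam eps n (J n) t ω none none - r n) ^ 2) P ∧
      ∫ ω, (extResidualMaker lam eps n (J n) t ω none none - r n) ^ 2 ∂P ≤ 2 / ((n + 1 : ℕ) : ℝ) := by
    intro n hn
    have hG := h.ae_isUnit_gaussianVec_ext hn
    have hlaw := h.hasLaw_controlData (J n) (extTime_injective n ht)
    have hmz : Measurable fun z : Option (Fin (J n)) × Option (prePeriods n) → ℝ =>
        (residualMaker (controlMatrix z) none none - r n) ^ 2 :=
      ((measurable_residualMaker_apply (measurable_designMatrix_apply (loadings (J n)))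
        none none).sub_const _).pow_const 2
    have h1 := integral_quadForm_sub_sq_le
      (by rw [Fintype.card_fin, hcard]; exact hn.trans n.le_succ) hG
      (x := Pi.single none 1) (by simp)
    simp only [mulVec_single_one, single_one_dotProduct, col_apply, hcard, Fintype.card_fin] at h1
    constructor
    · have hI : Integrable (fun z => (residualMaker (controlMatrix z) none none - r n) ^ 2)
          (gaussianVec fun p : Option (Fin (J n)) × Option (prePeriods n) =>
            columnVar σ σlam p.1) := by
        refine Integrable.of_bound hmz.aestronglyMeasurable ((1 + |r n|) ^ 2) ?_
        filter_upwards [hG] with z hz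
        rw [norm_pow]
        gcongr
        refine (abs_sub _ _).trans ?_
        gcongr
        exact abs_residualMaker_le_one hz _ _
      rw [← hlaw.map_eq] at hI
      exact hI.comp_aemeasurable hlaw.aemeasurable
    · rw [← hlaw.map_eq, integral_map hlaw.aemeasurable hmz.aestronglyMeasurable] at h1
      exact h1
  have hev := eventually_le_of_ratio hc1 hJc
  have h0 := tendstoInMeasure_zero_of_integral_sq_le (P := P)
    (X := fun n ω => extResidualMaker lam eps n (J n) t ω none none - r n)
    (hev.mono fun n hn => (key n hn).1) (hev.mono fun n hn => (key n hn).2)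
    ((tendsto_const_div_atTop_nhds_zero_nat (2 : ℝ)).comp (tendsto_add_atTop_nat 1))
  have hrlim : Tendsto r atTop (𝓝 (1 - c)) := by
    have h2 : Tendsto (fun n : ℕ => (n : ℝ) / (n + 1 : ℕ)) atTop (𝓝 1) := by
      have := tendsto_natCast_div_add_atTop (1 : ℝ)
      simpa using this
    have h3 := (hJc.mul h2).const_sub 1
    rw [mul_one] at h3
    refine h3.congr' ?_
    filter_upwards [eventually_gt_atTop 0] with n hn
    have hn' : (n : ℝ) ≠ 0 := by exact_mod_cast hn.ne'
    have hn1 : ((n + 1 : ℕ) : ℝ) ≠ 0 := by exact_mod_cast n.succ_ne_zero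
    rw [hr]
    field_simp
  have := TendstoInMeasure.comp_continuousAt_prod (g := fun x y => x + y) h0
    (tendstoInMeasure_of_tendsto_const (P := P) hrlim) (by fun_prop)
  simpa using this

omit [IsProbabilityMeasure P] h in
lemma sum_columnVar_mul_meanLoading_sq {J : ℕ} (hJ : J ≠ 0) :
    ∑ k : Option (Fin J), (columnVar σ σlam k : ℝ) * meanLoading J k ^ 2 = σ ^ 2 / J := by
  have hJ' : (J : ℝ) ≠ 0 := by exact_mod_cast hJ
  rw [Fintype.sum_option]
  simp only [columnVar, meanLoading, Option.elim_none, Option.elim_some, Finset.sum_const,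
    Finset.card_univ, Fintype.card_fin, nsmul_eq_mul, Real.coe_toNNReal _ (sq_nonneg σ)]
  field_simp
  ring

/-- The residual of the averaged noise vanishes, because its mean square is at most `σ² / J`. -/
lemma tendstoInMeasure_residual_noiseMean {t : ℤ} (ht : 0 < t) (hJ : Tendsto J atTop atTop)
    (hc1 : c < 1) (hJc : Tendsto (fun n : ℕ => (J n : ℝ) / (n : ℝ)) atTop (𝓝 c)) :
    TendstoInMeasure P (fun n ω => (extResidualMaker lam eps n (J n) t ω
      *ᵥ noiseMean (controlData lam eps (J n) (extTime n t) ω)) none) atTop fun _ => 0 := by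
  have hev := (eventually_le_of_ratio hc1 hJc).and (hJ.eventually_gt_atTop 0)
  have hCl : Tendsto (fun n => σ ^ 2 / (J n : ℝ)) atTop (𝓝 0) :=
    (tendsto_const_div_atTop_nhds_zero_nat (σ ^ 2)).comp hJ
  have key : ∀ n, J n ≤ n → 0 < J n →
      Integrable (fun ω => (extResidualMaker lam eps n (J n) t ω
        *ᵥ noiseMean (controlData lam eps (J n) (extTime n t) ω)) none ^ 2) P ∧
      ∫ ω, (extResidualMaker lam eps n (J n) t ω
        *ᵥ noiseMean (controlData lam eps (J n) (extTime n t) ω)) none ^ 2 ∂P ≤ σ ^ 2 / J n := by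
    intro n hn h0
    have hG := h.ae_isUnit_gaussianVec_ext hn
    have hlaw := h.hasLaw_controlData (J n) (extTime_injective n ht)
    obtain ⟨h1, h2⟩ := integral_residual_sq_le hG (meanLoading (J n)) none
    rw [sum_columnVar_mul_meanLoading_sq h0.ne', ← hlaw.map_eq,
      integral_map hlaw.aemeasurable (by rw [hlaw.map_eq]; exact h1.aestronglyMeasurable)] at h2
    rw [← hlaw.map_eq] at h1
    exact ⟨h1.comp_aemeasurable hlaw.aemeasurable, h2⟩
  exact tendstoInMeasure_zero_of_integral_sq_le (hev.mono fun n hn => (key n hn.1 hn.2).1)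
    (hev.mono fun n hn => (key n hn.1 hn.2).2) hCl

/-- The characteristic function of the leading part of the leave-one-out prediction error. Given the
controls, this part is centred Gaussian with variance `σ² / M_tt`. -/
lemma tendsto_integral_cexp_leaveOneOut {t : ℤ} (ht : 0 < t)
    (hc1 : c < 1) (hJc : Tendsto (fun n : ℕ => (J n : ℝ) / (n : ℝ)) atTop (𝓝 c)) (θ : ℝ) :
    Tendsto (fun n => ∫ ω, Complex.exp (((θ * ((fun i => extResidualMaker lam eps n (J n) t ω none i
        / extResidualMaker lam eps n (J n) t ω none none)
          ⬝ᵥ treatedNoise eps (extTime n t) ω) : ℝ) : ℂ) * Complex.I) ∂P) atTop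
      (𝓝 ((Real.exp (-(θ ^ 2 / 2 * (σ ^ 2 / (1 - c)))) : ℝ) : ℂ)) := by
  have hc0 : 0 < 1 - c := by linarith
  have hM := h.tendstoInMeasure_extResidualMaker ht hc1 hJc
  have hinv := TendstoInMeasure.comp_continuousAt hM
    (g := fun x => σ ^ 2 / x) (continuousAt_const.div continuousAt_id hc0.ne')
  -- the absolute value, immaterial for variances, makes the test function bounded
  let φ : BoundedContinuousFunction ℝ ℝ := BoundedContinuousFunction.ofNormedAddCommGroup
    (fun r => Real.exp (-(θ ^ 2 / 2 * |r|))) (by fun_prop) 1 fun r => by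
      rw [Real.norm_of_nonneg (Real.exp_pos _).le, Real.exp_le_one_iff]
      have : 0 ≤ θ ^ 2 / 2 * |r| := by positivity
      linarith
  have hlim := tendsto_integral_of_tendstoInMeasure_const
    (fun n => (h.aemeasurable_extResidualMaker ht n (J n) none none).const_div (σ ^ 2)) hinv φ
  have hφa : φ (σ ^ 2 / (1 - c)) = Real.exp (-(θ ^ 2 / 2 * (σ ^ 2 / (1 - c)))) := by
    change Real.exp (-(θ ^ 2 / 2 * |σ ^ 2 / (1 - c)|)) = _
    rw [abs_of_nonneg (by positivity)]
  rw [hφa] at hlim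
  refine ((Complex.continuous_ofReal.tendsto _).comp hlim).congr' ?_
  filter_upwards [eventually_le_of_ratio hc1 hJc] with n hn
  have hlaw := h.hasLaw_controlData (J n) (extTime_injective n ht)
  set f : (Option (Fin (J n)) × Option (prePeriods n) → ℝ) → Option (prePeriods n) → ℝ :=
    fun z i => θ * (residualMaker (controlMatrix z) none i
      / residualMaker (controlMatrix z) none none) with hf
  have hmz := measurable_residualMaker_apply
    (measurable_designMatrix_apply (ι := Option (prePeriods n)) (loadings (J n)))
  have hfm : Measurable f := measurable_pi_lambda _ fun i =>
    ((hmz none i).div (hmz none none)).const_mul θ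
  have hkey := integral_cexp_gaussian_mixture hlaw.aemeasurable
    (h.hasLaw_treatedNoise (extTime_injective n ht))
    (h.indepFun_controlData_treatedNoise (J n)) hfm
  have hlhs : ∀ ω, f (controlData lam eps (J n) (extTime n t) ω) ⬝ᵥ treatedNoise eps (extTime n t) ω
      = θ * ((fun i => extResidualMaker lam eps n (J n) t ω none i
        / extResidualMaker lam eps n (J n) t ω none none) ⬝ᵥ treatedNoise eps (extTime n t) ω) := by
    intro ω
    rw [← smul_eq_mul, ← smul_dotProduct]
    rfl
  simp_rw [hlhs] at hkey
  rw [hkey]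
  simp only [Function.comp]
  congr 1
  have hG := h.ae_isUnit_gaussianVec_ext hn
  rw [← hlaw.map_eq] at hG
  refine integral_congr_ae ?_
  filter_upwards [ae_of_ae_map hlaw.aemeasurable hG, h.ae_isUnit_controlMatrix hn] with ω hω hpre
  change Real.exp (-(θ ^ 2 / 2 * |σ ^ 2 / extResidualMaker lam eps n (J n) t ω none none|)) = _
  have hpos : 0 < extResidualMaker lam eps n (J n) t ω none none := by
    refine residualMaker_none_pos ?_
    have hsub : (controlMatrix (controlData lam eps (J n) (extTime n t) ω)).submatrix some id
        = controlMatrix (preData lam eps n (J n) ω).1 := by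
      ext s j
      rw [submatrix_apply, controlMatrix_apply, controlMatrix_apply]
      rfl
    rw [hsub]
    exact hpre
  rw [abs_of_nonneg (by positivity)]
  congr 1
  have hd := residualMaker_diag hω none
  have hsum : ∑ i, ((σ ^ 2).toNNReal : ℝ) * f (controlData lam eps (J n) (extTime n t) ω) i ^ 2
      = σ ^ 2 * θ ^ 2 / extResidualMaker lam eps n (J n) t ω none none ^ 2
        * ∑ i, extResidualMaker lam eps n (J n) t ω none i ^ 2 := by
    rw [Finset.mul_sum, Real.coe_toNNReal _ (sq_nonneg σ)]
    refine Finset.sum_congr rfl fun i _ => ?_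
    simp only [hf]
    field_simp
  rw [hsum, ← hd]
  field_simp

/-- The prediction variance of the OLS weights converges in probability: its Laplace transform is the
characteristic function of the leave-one-out prediction error. -/
lemma tendstoInMeasure_predictionVar_ols (hJ : Tendsto J atTop atTop) (hc1 : c < 1)
    (hJc : Tendsto (fun n : ℕ => (J n : ℝ) / (n : ℝ)) atTop (𝓝 c))
    {b : (n : ℕ) → Ω → Fin (J n) → ℝ} (hbm : ∀ n, AEMeasurable (b n) P)
    (hb : ∀ᶠ n in atTop, ∀ᵐ ω ∂P, b n ω = olsCoef (preData lam eps n (J n) ω)) :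
    TendstoInMeasure P (fun n ω => predictionVar σ σlam (b n ω)) atTop
      fun _ => σ ^ 2 / (1 - c) := by
  have ht : (0 : ℤ) < 1 := one_pos
  have hc0 : 0 < 1 - c := by linarith
  have hM := h.tendstoInMeasure_extResidualMaker ht hc1 hJc
  have hR : TendstoInMeasure P (fun n ω => -((extResidualMaker lam eps n (J n) 1 ω
      *ᵥ noiseMean (controlData lam eps (J n) (extTime n 1) ω)) none
        / extResidualMaker lam eps n (J n) 1 ω none none)) atTop fun _ => 0 := by
    have := TendstoInMeasure.comp_continuousAt_prod (g := fun x y => -(x / y))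
      (h.tendstoInMeasure_residual_noiseMean ht hJ hc1 hJc) hM
      ((continuousAt_fst.div continuousAt_snd hc0.ne').neg)
    simpa using this
  have hmz : ∀ n, ∀ i j, Measurable fun z : Option (Fin (J n)) × Option (prePeriods n) → ℝ =>
      residualMaker (controlMatrix z) i j := fun n =>
    measurable_residualMaker_apply (measurable_designMatrix_apply (loadings (J n)))
  have hz : ∀ n, AEMeasurable (controlData lam eps (J n) (extTime n 1)) P := fun n =>
    (h.hasLaw_controlData (J n) (extTime_injective n ht)).aemeasurable
  have hRm : ∀ n, AEMeasurable (fun ω => -((extResidualMaker lam eps n (J n) 1 ω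
      *ᵥ noiseMean (controlData lam eps (J n) (extTime n 1) ω)) none
        / extResidualMaker lam eps n (J n) 1 ω none none)) P := by
    intro n
    have : Measurable fun z : Option (Fin (J n)) × Option (prePeriods n) → ℝ =>
        -((residualMaker (controlMatrix z) *ᵥ noiseMean z) none
          / residualMaker (controlMatrix z) none none) := by
      refine ((measurable_mulVec_apply (hmz n) (fun i => ?_) none).div (hmz n none none)).neg
      unfold noiseMean
      fun_prop
    exact this.comp_aemeasurable (hz n)
  have hWm : ∀ n, AEMeasurable (fun ω => (fun i => extResidualMaker lam eps n (J n) 1 ω none i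
        / extResidualMaker lam eps n (J n) 1 ω none none)
          ⬝ᵥ treatedNoise eps (extTime n 1) ω) P := by
    intro n
    refine Finset.aemeasurable_fun_sum _ fun i _ => ?_
    refine ((h.aemeasurable_extResidualMaker ht n (J n) none i).div
      (h.aemeasurable_extResidualMaker ht n (J n) none none)).mul ?_
    exact (measurable_pi_apply i).comp_aemeasurable
      (h.hasLaw_treatedNoise (extTime_injective n ht)).aemeasurable
  have hlap : ∀ θ : ℝ, Tendsto (fun n => ∫ ω,
      Real.exp (-(θ ^ 2 / 2 * predictionVar σ σlam (b n ω))) ∂P) atTop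
      (𝓝 (Real.exp (-(θ ^ 2 / 2 * (σ ^ 2 / (1 - c)))))) := by
    intro θ
    have hlim := tendsto_integral_cexp_add hWm hRm hR
      (h.tendsto_integral_cexp_leaveOneOut ht hc1 hJc θ)
    have hre := (Complex.continuous_re.tendsto _).comp hlim
    rw [Complex.ofReal_re] at hre
    refine hre.congr' ?_
    filter_upwards [hb, eventually_le_of_ratio hc1 hJc, hJ.eventually_gt_atTop 0]
      with n hbn hn hJ0
    -- the weights and the prediction error do not involve the treatment effects
    have hcf := h.integral_cexp_effectEstimator (α := fun _ _ => 0) ht measurable_olsCoef hbn θ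
    have hcongr : ∫ ω, Complex.exp (((θ * effectEstimator
        (fun i s => outcome (fun _ _ => 0) lam eps i s ω) (b n ω) 1 : ℝ) : ℂ) * Complex.I) ∂P
        = ∫ ω, Complex.exp (((θ * ((fun i => extResidualMaker lam eps n (J n) 1 ω none i
          / extResidualMaker lam eps n (J n) 1 ω none none) ⬝ᵥ treatedNoise eps (extTime n 1) ω
          + -((extResidualMaker lam eps n (J n) 1 ω
            *ᵥ noiseMean (controlData lam eps (J n) (extTime n 1) ω)) none
          / extResidualMaker lam eps n (J n) 1 ω none none)) : ℝ) : ℂ) * Complex.I) ∂P := by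
      refine integral_congr_ae ?_
      filter_upwards [hbn, h.ae_isUnit_controlMatrix hn] with ω hω hu
      rw [hω, effectEstimator_olsCoef hJ0.ne' ht hu, zero_add]
    rw [hcongr] at hcf
    simp only [Function.comp]
    rw [hcf]
    simp
  refine tendstoInMeasure_of_laplace
    (fun n => measurable_predictionVar.comp_aemeasurable (hbm n))
    (fun n ω => predictionVar_nonneg _) ?_ ?_
  -- the Laplace transform at `1` and `2`, that is `θ² / 2 = 1` and `θ² / 2 = 2`
  · have := hlap (√2)
    simpa [Real.sq_sqrt (zero_le_two : (0 : ℝ) ≤ 2)] using this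
  · have := hlap 2
    norm_num at this
    exact this

end IsGaussianModel

end OlsLimits

/-! ### Sum of the OLS coefficients -/

section SumOfCoefficients

lemma gaussianVec_abs_dotProduct_ge_le {ι : Type*} [Fintype ι] (v : ι → ℝ≥0) (a : ι → ℝ) {ε : ℝ}
    (hε : 0 < ε) : gaussianVec v {z | ε ≤ |a ⬝ᵥ z|}
      ≤ ENNReal.ofReal ((∑ i, (v i : ℝ) * a i ^ 2) / ε ^ 2) := by
  have hset : {z : ι → ℝ | ε ≤ |a ⬝ᵥ z|} = {z | ε ^ 2 ≤ (a ⬝ᵥ z) ^ 2} := by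
    ext z
    change ε ≤ _ ↔ ε ^ 2 ≤ _
    rw [sq_le_sq, abs_of_pos hε]
  have h := mul_meas_ge_le_integral_of_nonneg (ae_of_all _ fun z => sq_nonneg (a ⬝ᵥ z))
    (integrable_dotProduct_sq_gaussianVec v a) (ε ^ 2)
  rw [integral_dotProduct_sq_gaussianVec] at h
  rw [hset, ← ofReal_measureReal]
  refine ENNReal.ofReal_le_ofReal ?_
  rw [le_div_iff₀ (by positivity), mul_comm]
  exact h

variable {Ω : Type*} [MeasurableSpace Ω] {P : Measure Ω} [IsProbabilityMeasure P] {σ σlam : ℝ}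
  {lam : ℤ → Ω → ℝ} {eps : ℕ → ℤ → Ω → ℝ} {α : ℕ → ℤ → ℝ} {J : ℕ → ℕ} {c : ℝ}

namespace IsGaussianModel

variable (h : IsGaussianModel P σ σlam lam eps)
include h

/-- The part of the factor that is orthogonal to the idiosyncratic shocks of the controls keeps about
the fraction `1 - J / n` of its squared length. -/
lemma measure_factor_quadForm_le {n J : ℕ} (hn : n ≠ 0) (hJn : J ≤ n) {δ : ℝ} (hδ : 0 < δ) :
    P {ω | δ * ((fun s : prePeriods n => lam s ω) ⬝ᵥ fun s => lam s ω)
        < |(fun s : prePeriods n => lam s ω) ⬝ᵥ (residualMaker (designMatrix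
            (1 : Matrix (Fin J) (Fin J) ℝ) (noiseData (preData lam eps n J ω).1))
            *ᵥ fun s => lam s ω)
          - ((n : ℝ) - J) / n * ((fun s : prePeriods n => lam s ω) ⬝ᵥ fun s => lam s ω)|}
      ≤ ENNReal.ofReal (2 / (n * δ ^ 2)) := by
  have hW := h.hasLaw_factor (preTime_injective n)
  have hX := h.hasLaw_controlNoise J (preTime_injective n)
  have : Nonempty (prePeriods n) := by
    rw [← Fintype.card_pos_iff, card_prePeriods]; omega
  have hcard : Fintype.card (Fin J) ≤ Fintype.card (prePeriods n) := by
    rwa [Fintype.card_fin, card_prePeriods]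
  have hG := ae_isUnit_det_gram (ι := prePeriods n) (v := fun _ : Fin J => (σ ^ 2).toNNReal)
    (B := 1) (C := 1) (fun _ => by simpa using h.pos.ne') (one_mul 1) hcard
  set S : Set ((prePeriods n → ℝ) × (Fin J × prePeriods n → ℝ)) :=
    {p | δ * (p.1 ⬝ᵥ p.1) < |p.1 ⬝ᵥ (residualMaker (designMatrix
      (1 : Matrix (Fin J) (Fin J) ℝ) p.2) *ᵥ p.1) - ((n : ℝ) - J) / n * (p.1 ⬝ᵥ p.1)|} with hS
  have hSm : MeasurableSet S := by
    have hM := measurable_residualMaker_apply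
      (X := fun p : (prePeriods n → ℝ) × (Fin J × prePeriods n → ℝ) =>
        designMatrix (1 : Matrix (Fin J) (Fin J) ℝ) p.2)
      fun i j => (measurable_designMatrix_apply 1 i j).comp measurable_snd
    have h1 : Measurable fun p : (prePeriods n → ℝ) × (Fin J × prePeriods n → ℝ) =>
        p.1 ⬝ᵥ p.1 := by unfold dotProduct; fun_prop
    have h2 : Measurable fun p : (prePeriods n → ℝ) × (Fin J × prePeriods n → ℝ) =>
        p.1 ⬝ᵥ (residualMaker (designMatrix (1 : Matrix (Fin J) (Fin J) ℝ) p.2) *ᵥ p.1) := by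
      refine Finset.measurable_sum _ fun i _ => Measurable.mul (by fun_prop) ?_
      exact measurable_mulVec_apply hM (fun j => by fun_prop) i
    exact measurableSet_lt (h1.const_mul δ) (h2.sub (h1.const_mul _)).abs
  have key := measure_le_of_forall_section_le hW.aemeasurable hX.aemeasurable
    (h.indepFun_factor_controlNoise (time := preTime n) J) hSm MeasurableSet.univ
    (C := ENNReal.ofReal (2 / (n * δ ^ 2))) fun w _ => by
      have hb := measure_quadForm_sub_gt_le (v := fun _ : Fin J => (σ ^ 2).toNNReal) (B := 1)
        hcard hG w hδ
      rw [Fintype.card_fin, card_prePeriods] at hb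
      refine le_trans (le_of_eq ?_) hb
      have hm : MeasurableSet {x | (w, x) ∈ S} := measurable_prodMk_left hSm
      change P ((fun ω (p : Fin J × prePeriods n) => eps (p.1 + 1) (preTime n p.2) ω) ⁻¹'
        {x | (w, x) ∈ S}) = _
      rw [← Measure.map_apply_of_aemeasurable hX.aemeasurable hm, hX.map_eq]
      rfl
  simp only [Set.mem_univ, not_true_eq_false, Set.ofPred_false, measure_empty, zero_add] at key
  exact key

lemma tendsto_measure_sumSq_factor {η : ℝ} (hη : 0 < η) :
    Tendsto (fun n : ℕ => P {ω | (n : ℝ) * η ≤ |((fun s : prePeriods n => lam s ω)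
      ⬝ᵥ fun s => lam s ω) - n * σlam ^ 2|}) atTop (𝓝 0) := by
  obtain ⟨ρ, hρ0, hρ1, hρ⟩ := exists_rate_sum_sq_gaussian (P := P) (σlam ^ 2).toNNReal hη
  have hlim : Tendsto (fun n : ℕ => ENNReal.ofReal (2 * ρ ^ n)) atTop (𝓝 0) := by
    have := (tendsto_pow_atTop_nhds_zero_of_lt_one hρ0 hρ1).const_mul 2
    simpa using ENNReal.tendsto_ofReal this
  refine tendsto_of_tendsto_of_tendsto_of_le_of_le tendsto_const_nhds hlim
    (fun _ => zero_le) fun n => ?_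
  have hb := hρ lam (iIndepFun.precomp (g := Sum.inl) Sum.inl_injective h.indep) (fun i => h.law (Sum.inl i)) (prePeriods n)
  have hc : (prePeriods n).card = n := by rw [← Fintype.card_coe, card_prePeriods]
  rw [hc, Real.coe_toNNReal _ (sq_nonneg _)] at hb
  rw [← ofReal_measureReal]
  refine ENNReal.ofReal_le_ofReal (le_trans (le_of_eq ?_) hb)
  congr 2
  ext ω
  have : ((fun s : prePeriods n => lam s ω) ⬝ᵥ fun s => lam s ω)
      = ∑ s ∈ prePeriods n, lam s ω ^ 2 := by
    rw [← Finset.sum_coe_sort, dotProduct]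
    exact Finset.sum_congr rfl fun s _ => (sq _).symm
  change _ ≤ _ ↔ _ ≤ _
  rw [this]

/-- The squared length of the linear form giving the sum of the OLS coefficients is of order
`1 / n`. -/
lemma exists_tendsto_measure_sumVec (hc1 : c < 1)
    (hJc : Tendsto (fun n : ℕ => (J n : ℝ) / (n : ℝ)) atTop (𝓝 c)) :
    ∃ d > 0, Tendsto (fun n : ℕ => P {ω | ¬ (n * d * (sumVec (preData lam eps n (J n) ω).1
      ⬝ᵥ sumVec (preData lam eps n (J n) ω).1) ≤ 1)}) atTop (𝓝 0) := by
  have hl := h.pos_factor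
  have hc0 : 0 < 1 - c := by linarith
  -- with high probability the factor has squared length at least `n σlam² / 2`, of which at least
  -- the fraction `(1 - c) / 2 - (1 - c) / 4` is orthogonal to the noise of the controls
  refine ⟨(1 - c) * σlam ^ 2 / 8, by positivity, ?_⟩
  have hη : 0 < σlam ^ 2 / 2 := by positivity
  have hδ : 0 < (1 - c) / 4 := by positivity
  have h2 := h.tendsto_measure_sumSq_factor hη
  have h1 : Tendsto (fun n : ℕ => ENNReal.ofReal (2 / (n * ((1 - c) / 4) ^ 2))) atTop (𝓝 0) := by
    have : Tendsto (fun n : ℕ => 2 / ((1 - c) / 4) ^ 2 / (n : ℝ)) atTop (𝓝 0) :=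
      tendsto_const_div_atTop_nhds_zero_nat _
    have := ENNReal.tendsto_ofReal this
    rw [ENNReal.ofReal_zero] at this
    refine this.congr fun n => ?_
    rw [div_div, mul_comm]
  have hsum := h1.add h2
  rw [add_zero] at hsum
  refine tendsto_of_tendsto_of_tendsto_of_le_of_le' tendsto_const_nhds hsum
    (Eventually.of_forall fun _ => zero_le) ?_
  filter_upwards [eventually_gt_atTop 0, eventually_le_of_ratio hc1 hJc,
    hJc.eventually_lt_const (show c < (1 + c) / 2 by linarith)] with n hn hJn hr
  have hn' : (0 : ℝ) < n := by exact_mod_cast hn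
  refine le_trans ?_ (add_le_add_left (h.measure_factor_quadForm_le hn.ne' hJn hδ) _)
  refine le_trans (measure_mono_ae ?_) (measure_union_le _ _)
  have hE : ∀ᵐ ω ∂P, IsUnit ((designMatrix (1 : Matrix (Fin (J n)) (Fin (J n)) ℝ)
      (noiseData (preData lam eps n (J n) ω).1))ᵀ
      * designMatrix (1 : Matrix (Fin (J n)) (Fin (J n)) ℝ)
        (noiseData (preData lam eps n (J n) ω).1)).det := by
    have hX := h.hasLaw_controlNoise (J n) (preTime_injective n)
    have hG := ae_isUnit_det_gram (ι := prePeriods n)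
      (v := fun _ : Fin (J n) => (σ ^ 2).toNNReal)
      (B := 1) (C := 1) (fun _ => by simpa using h.pos.ne') (one_mul 1)
      (by rwa [Fintype.card_fin, card_prePeriods])
    change ∀ᵐ z ∂gaussianVec (fun _ : Fin (J n) × prePeriods n => (σ ^ 2).toNNReal), _ at hG
    rw [← hX.map_eq] at hG
    exact ae_of_ae_map hX.aemeasurable hG
  filter_upwards [hE, h.ae_isUnit_controlMatrix hJn] with ω hω hz
  intro hbad
  by_contra hcon
  refine hbad ?_
  have hcon' := not_or.1 hcon
  rw [Set.mem_ofPred_eq, Set.mem_ofPred_eq, not_lt, not_le] at hcon'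
  obtain ⟨hq, hs⟩ := hcon'
  have hK := sumVec_sq_mul_le hz hω
  change (sumVec (preData lam eps n (J n) ω).1 ⬝ᵥ sumVec (preData lam eps n (J n) ω).1)
    * ((fun s : prePeriods n => lam s ω) ⬝ᵥ (residualMaker (designMatrix
      (1 : Matrix (Fin (J n)) (Fin (J n)) ℝ) (noiseData (preData lam eps n (J n) ω).1))
        *ᵥ fun s => lam s ω)) ≤ 1 at hK
  have hK0 := dotProduct_self_nonneg (sumVec (preData lam eps n (J n) ω).1)
  set K := sumVec (preData lam eps n (J n) ω).1 ⬝ᵥ sumVec (preData lam eps n (J n) ω).1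
  set L := (fun s : prePeriods n => lam s ω) ⬝ᵥ fun s => lam s ω
  set q := (fun s : prePeriods n => lam s ω) ⬝ᵥ (residualMaker (designMatrix
      (1 : Matrix (Fin (J n)) (Fin (J n)) ℝ) (noiseData (preData lam eps n (J n) ω).1))
        *ᵥ fun s => lam s ω)
  have hratio : (1 - c) / 2 ≤ ((n : ℝ) - J n) / n := by
    rw [sub_div (n : ℝ), div_self hn'.ne']
    linarith
  have hL : n * σlam ^ 2 / 2 ≤ L := by
    have := (abs_lt.1 hs).1
    linarith
  have hL0 : 0 ≤ L := le_trans (by positivity) hL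
  have hq2 : (1 - c) / 4 * L ≤ q := by
    have := (abs_le.1 hq).1
    have := mul_le_mul_of_nonneg_right hratio hL0
    linarith
  have hq3 : n * ((1 - c) * σlam ^ 2 / 8) ≤ q := by
    have := mul_le_mul_of_nonneg_left hL hδ.le
    linarith
  calc n * ((1 - c) * σlam ^ 2 / 8) * K ≤ q * K := mul_le_mul_of_nonneg_right hq3 hK0
    _ = K * q := mul_comm _ _
    _ ≤ 1 := hK

omit [IsProbabilityMeasure P] in
/-- The averaged noise of the controls has mean square `σ² / J`. -/
lemma integral_noiseMean_sq {n J : ℕ} (hn : n ≠ 0) (hJ : J ≠ 0) :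
    Integrable (fun ω => (noiseMean (preData lam eps n J ω).1
        ⬝ᵥ noiseMean (preData lam eps n J ω).1) / n) P ∧
      ∫ ω, (noiseMean (preData lam eps n J ω).1
        ⬝ᵥ noiseMean (preData lam eps n J ω).1) / n ∂P = σ ^ 2 / J := by
  have hlaw := h.hasLaw_controlData J (preTime_injective n)
  have hI : ∀ s : prePeriods n, Integrable (fun ω => noiseMean (preData lam eps n J ω).1 s ^ 2) P ∧
      ∫ ω, noiseMean (preData lam eps n J ω).1 s ^ 2 ∂P = σ ^ 2 / J := by
    intro s
    have h1 := integrable_combination_sq (columnVar σ σlam) (meanLoading J) s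
    have h2 := integral_combination_sq (columnVar σ σlam) (meanLoading J) s
    rw [sum_columnVar_mul_meanLoading_sq hJ, ← hlaw.map_eq,
      integral_map hlaw.aemeasurable (by rw [hlaw.map_eq]; exact h1.aestronglyMeasurable)] at h2
    rw [← hlaw.map_eq] at h1
    exact ⟨h1.comp_aemeasurable hlaw.aemeasurable, h2⟩
  have hdot : ∀ ω, noiseMean (preData lam eps n J ω).1 ⬝ᵥ noiseMean (preData lam eps n J ω).1
      = ∑ s, noiseMean (preData lam eps n J ω).1 s ^ 2 := fun ω =>
    Finset.sum_congr rfl fun s _ => (sq _).symm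
  have hn' : (n : ℝ) ≠ 0 := by exact_mod_cast hn
  simp_rw [hdot]
  refine ⟨(integrable_finsetSum _ fun s _ => (hI s).1).div_const _, ?_⟩
  rw [integral_div, integral_finsetSum _ fun s _ => (hI s).1]
  simp only [fun s => (hI s).2, Finset.sum_const, Finset.card_univ, card_prePeriods, nsmul_eq_mul]
  field_simp

/-- By Cauchy–Schwarz, using that the averaged noise has squared length `O(n / J)`. -/
lemma tendstoInMeasure_sumVec_noiseMean (hJ : Tendsto J atTop atTop) (hc1 : c < 1)
    (hJc : Tendsto (fun n : ℕ => (J n : ℝ) / (n : ℝ)) atTop (𝓝 c)) :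
    TendstoInMeasure P (fun n ω => sumVec (preData lam eps n (J n) ω).1
      ⬝ᵥ noiseMean (preData lam eps n (J n) ω).1) atTop fun _ => 0 := by
  obtain ⟨d, hd, hbad⟩ := h.exists_tendsto_measure_sumVec hc1 hJc
  have hev := (eventually_gt_atTop 0).and (hJ.eventually_gt_atTop 0)
  have hnn : ∀ n ω, 0 ≤ (noiseMean (preData lam eps n (J n) ω).1
      ⬝ᵥ noiseMean (preData lam eps n (J n) ω).1) / n := fun n ω =>
    div_nonneg (dotProduct_self_nonneg _) n.cast_nonneg
  have hY : TendstoInMeasure P (fun n ω => √((noiseMean (preData lam eps n (J n) ω).1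
      ⬝ᵥ noiseMean (preData lam eps n (J n) ω).1) / n)) atTop fun _ => 0 := by
    refine tendstoInMeasure_zero_of_integral_sq_le (C := fun n => σ ^ 2 / J n) ?_ ?_
      ((tendsto_const_div_atTop_nhds_zero_nat (σ ^ 2)).comp hJ)
    · filter_upwards [hev] with n hn
      simp_rw [Real.sq_sqrt (hnn n _)]
      exact (h.integral_noiseMean_sq hn.1.ne' hn.2.ne').1
    · filter_upwards [hev] with n hn
      simp_rw [Real.sq_sqrt (hnn n _)]
      exact (h.integral_noiseMean_sq hn.1.ne' hn.2.ne').2.le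
  rw [tendstoInMeasure_iff_dist] at hY ⊢
  intro ε hε
  have hsum := hbad.add (hY (ε * √d) (by positivity))
  rw [add_zero] at hsum
  refine tendsto_of_tendsto_of_tendsto_of_le_of_le' tendsto_const_nhds hsum
    (Eventually.of_forall fun _ => zero_le) ?_
  filter_upwards [eventually_gt_atTop 0] with n hn
  refine le_trans (measure_mono fun ω hω => ?_) (measure_union_le _ _)
  by_contra hcon
  have hcon' := not_or.1 hcon
  have hK := not_not.1 hcon'.1
  have hm := hcon'.2
  rw [Set.mem_ofPred_eq, not_le] at hm
  change ε ≤ dist _ _ at hω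
  rw [Real.dist_eq, sub_zero] at hω
  rw [Real.dist_eq, sub_zero, abs_of_nonneg (Real.sqrt_nonneg _)] at hm
  have hn' : (0 : ℝ) < n := by exact_mod_cast hn
  have hcs : (sumVec (preData lam eps n (J n) ω).1 ⬝ᵥ noiseMean (preData lam eps n (J n) ω).1) ^ 2
      ≤ (sumVec (preData lam eps n (J n) ω).1 ⬝ᵥ sumVec (preData lam eps n (J n) ω).1)
        * (noiseMean (preData lam eps n (J n) ω).1 ⬝ᵥ noiseMean (preData lam eps n (J n) ω).1) := by
    have := Finset.sum_mul_sq_le_sq_mul_sq Finset.univ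
      (sumVec (preData lam eps n (J n) ω).1) (noiseMean (preData lam eps n (J n) ω).1)
    simpa only [dotProduct, sq] using this
  set K := sumVec (preData lam eps n (J n) ω).1 ⬝ᵥ sumVec (preData lam eps n (J n) ω).1
  set N := noiseMean (preData lam eps n (J n) ω).1 ⬝ᵥ noiseMean (preData lam eps n (J n) ω).1
  have hN0 : 0 ≤ N := dotProduct_self_nonneg _
  have hsq : ε ^ 2 ≤ K * N := by
    refine le_trans ?_ hcs
    rw [← sq_abs (_ ⬝ᵥ _)]
    exact pow_le_pow_left₀ hε.le hω 2
  have hm2 : N / n < ε ^ 2 * d := by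
    have := (Real.sqrt_lt' (by positivity)).1 hm
    rwa [mul_pow, Real.sq_sqrt hd.le] at this
  rw [div_lt_iff₀ hn'] at hm2
  have h3 := mul_le_mul_of_nonneg_right hK hN0
  have h4 := mul_le_mul_of_nonneg_left hsq (by positivity : (0 : ℝ) ≤ n * d)
  nlinarith

/-- Given the controls, the inner product is centred Gaussian with variance `σ²` times the squared
length of `sumVec`. -/
lemma tendstoInMeasure_sumVec_treatedNoise (hc1 : c < 1)
    (hJc : Tendsto (fun n : ℕ => (J n : ℝ) / (n : ℝ)) atTop (𝓝 c)) :
    TendstoInMeasure P (fun n ω => sumVec (preData lam eps n (J n) ω).1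
      ⬝ᵥ (preData lam eps n (J n) ω).2) atTop fun _ => 0 := by
  obtain ⟨d, hd, hbad⟩ := h.exists_tendsto_measure_sumVec hc1 hJc
  rw [tendstoInMeasure_iff_dist]
  intro ε hε
  have hC : Tendsto (fun n : ℕ => ENNReal.ofReal (σ ^ 2 / (d * ε ^ 2) / n)) atTop (𝓝 0) := by
    have := ENNReal.tendsto_ofReal
      (tendsto_const_div_atTop_nhds_zero_nat (σ ^ 2 / (d * ε ^ 2)))
    rwa [ENNReal.ofReal_zero] at this
  have hsum := hbad.add hC
  rw [add_zero] at hsum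
  refine tendsto_of_tendsto_of_tendsto_of_le_of_le' tendsto_const_nhds hsum
    (Eventually.of_forall fun _ => zero_le) ?_
  filter_upwards [eventually_gt_atTop 0] with n hn
  have hn' : (0 : ℝ) < n := by exact_mod_cast hn
  have hX := h.hasLaw_treatedNoise (preTime_injective n)
  have hW := h.hasLaw_controlData (J n) (preTime_injective n)
  have hk : ∀ i, Measurable fun z : Option (Fin (J n)) × prePeriods n → ℝ => sumVec z i :=
    measurable_sumVec_apply
  set S : Set ((Option (Fin (J n)) × prePeriods n → ℝ) × (prePeriods n → ℝ)) :=
    {p | ε ≤ |sumVec p.1 ⬝ᵥ p.2|} with hS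
  have hSm : MeasurableSet S := by
    refine measurableSet_le measurable_const (Measurable.abs ?_)
    exact Finset.measurable_sum _ fun i _ => ((hk i).comp measurable_fst).mul (by fun_prop)
  have hA : MeasurableSet {z : Option (Fin (J n)) × prePeriods n → ℝ |
      n * d * (sumVec z ⬝ᵥ sumVec z) ≤ 1} := by
    refine measurableSet_le (Measurable.const_mul ?_ _) measurable_const
    exact Finset.measurable_sum _ fun i _ => (hk i).mul (hk i)
  have key := measure_le_of_forall_section_le hW.aemeasurable hX.aemeasurable
    (h.indepFun_controlData_treatedNoise (time := preTime n) (J n)) hSm hA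
    (C := ENNReal.ofReal (σ ^ 2 / (d * ε ^ 2) / n)) fun w hw => by
      have hm : MeasurableSet {x | (w, x) ∈ S} := measurable_prodMk_left hSm
      change P (treatedNoise eps (preTime n) ⁻¹' {x | (w, x) ∈ S}) ≤ _
      rw [← Measure.map_apply_of_aemeasurable hX.aemeasurable hm, hX.map_eq]
      refine (gaussianVec_abs_dotProduct_ge_le _ (sumVec w) hε).trans
        (ENNReal.ofReal_le_ofReal ?_)
      have hsumsq : ∑ i, (((σ ^ 2).toNNReal : ℝ≥0) : ℝ) * sumVec w i ^ 2
          = σ ^ 2 * (sumVec w ⬝ᵥ sumVec w) := by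
        rw [Real.coe_toNNReal _ (sq_nonneg σ), dotProduct, Finset.mul_sum]
        exact Finset.sum_congr rfl fun i _ => by ring
      rw [hsumsq, div_div, div_le_div_iff₀ (by positivity) (by positivity)]
      have h1 : n * d * (sumVec w ⬝ᵥ sumVec w) ≤ 1 := hw
      have h2 := mul_le_mul_of_nonneg_left h1 (by positivity : 0 ≤ σ ^ 2 * ε ^ 2)
      linarith
  refine le_trans (le_of_eq ?_) key
  congr 1
  ext ω
  change ε ≤ dist _ _ ↔ ε ≤ |_|
  rw [Real.dist_eq, sub_zero]
  rfl

/-- The OLS coefficients sum to one asymptotically: the regression has to match the loading of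
unit `0` on the factor. -/
lemma tendstoInMeasure_one_sub_sum_ols (hJ : Tendsto J atTop atTop) (hc1 : c < 1)
    (hJc : Tendsto (fun n : ℕ => (J n : ℝ) / (n : ℝ)) atTop (𝓝 c))
    {b : (n : ℕ) → Ω → Fin (J n) → ℝ}
    (hb : ∀ᶠ n in atTop, ∀ᵐ ω ∂P, b n ω = olsCoef (preData lam eps n (J n) ω)) :
    TendstoInMeasure P (fun n ω => 1 - ∑ j, b n ω j) atTop fun _ => 0 := by
  have h1 := TendstoInMeasure.comp_continuousAt_prod (g := fun x y => x - y)
    (h.tendstoInMeasure_sumVec_noiseMean hJ hc1 hJc) (h.tendstoInMeasure_sumVec_treatedNoise hc1 hJc)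
    (by fun_prop)
  rw [sub_zero] at h1
  refine MeasureTheory.TendstoInMeasure.congr' ?_ EventuallyEq.rfl h1
  filter_upwards [hb, eventually_le_of_ratio hc1 hJc, hJ.eventually_gt_atTop 0] with n hbn hn hJ0
  filter_upwards [hbn, h.ae_isUnit_controlMatrix hn] with ω hω hz
  rw [hω, one_sub_sum_olsCoef hJ0.ne' hz]

/-- The squared length of the OLS coefficients, obtained by solving the definition of the prediction
variance for it. -/
lemma tendstoInMeasure_dotProduct_ols (hJ : Tendsto J atTop atTop) (hc1 : c < 1)
    (hJc : Tendsto (fun n : ℕ => (J n : ℝ) / (n : ℝ)) atTop (𝓝 c))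
    {b : (n : ℕ) → Ω → Fin (J n) → ℝ} (hbm : ∀ n, AEMeasurable (b n) P)
    (hb : ∀ᶠ n in atTop, ∀ᵐ ω ∂P, b n ω = olsCoef (preData lam eps n (J n) ω)) :
    TendstoInMeasure P (fun n ω => b n ω ⬝ᵥ b n ω) atTop fun _ => c / (1 - c) := by
  have hσ := h.pos
  have hc0 : 1 - c ≠ 0 := by linarith
  have h1 := TendstoInMeasure.comp_continuousAt_prod
    (g := fun x y => (x - σlam ^ 2 * y ^ 2) / σ ^ 2 - 1)
    (h.tendstoInMeasure_predictionVar_ols hJ hc1 hJc hbm hb)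
    (h.tendstoInMeasure_one_sub_sum_ols hJ hc1 hJc hb) (by fun_prop)
  have hval : (σ ^ 2 / (1 - c) - σlam ^ 2 * 0 ^ 2) / σ ^ 2 - 1 = c / (1 - c) := by
    field_simp
    ring
  rw [hval] at h1
  refine h1.congr_left fun n => ae_of_all _ fun ω => ?_
  simp only [predictionVar]
  field_simp
  ring

end IsGaussianModel

end SumOfCoefficients

/-! ### Sample covariances of the idiosyncratic shocks -/

section GramConcentration

/-- A fixed linear combination of the data columns has independent Gaussian entries. -/
lemma map_combination_gaussianVec {κ ι : Type*} [Fintype κ] [Fintype ι] (v : κ → ℝ≥0)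
    (a : κ → ℝ) :
    (gaussianVec fun p : κ × ι => v p.1).map (fun z i => ∑ k, a k * z (k, i))
      = gaussianVec fun _ : ι => (∑ k, (v k : ℝ) * a k ^ 2).toNNReal := by
  classical
  have hm : Measurable fun (z : κ × ι → ℝ) (i : ι) => ∑ k, a k * z (k, i) := by fun_prop
  have : IsProbabilityMeasure ((gaussianVec fun p : κ × ι => v p.1).map
      (fun z i => ∑ k, a k * z (k, i))) := Measure.isProbabilityMeasure_map hm.aemeasurable
  refine Measure.ext_of_charFunDual ?_
  funext L
  set c : ι → ℝ := fun i => L (Pi.single i 1) with hc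
  have hL : ∀ z, L z = c ⬝ᵥ z := by
    intro z
    conv_lhs => rw [← Finset.univ_sum_single z, map_sum]
    refine Finset.sum_congr rfl fun i _ => ?_
    have : Pi.single i (z i) = z i • (Pi.single i 1 : ι → ℝ) := by
      rw [← Pi.single_smul]; simp
    rw [this, map_smul, smul_eq_mul, mul_comm]
  have hLc : ∀ z : κ × ι → ℝ, L (fun i => ∑ k, a k * z (k, i))
      = (fun p : κ × ι => c p.2 * a p.1) ⬝ᵥ z := by
    intro z
    rw [hL, dotProduct, dotProduct, Fintype.sum_prod_type_right]
    refine Finset.sum_congr rfl fun i _ => ?_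
    rw [Finset.mul_sum]
    exact Finset.sum_congr rfl fun k _ => (mul_assoc _ _ _).symm
  have h0 : 0 ≤ ∑ k, (v k : ℝ) * a k ^ 2 := by positivity
  rw [charFunDual_apply, charFunDual_apply, integral_map hm.aemeasurable (by fun_prop)]
  simp_rw [hLc, hL]
  rw [integral_cexp_dotProduct_gaussianVec, integral_cexp_dotProduct_gaussianVec]
  simp only [Real.coe_toNNReal _ h0]
  congr 3
  rw [Fintype.sum_prod_type_right]
  congr 1
  refine Finset.sum_congr rfl fun i _ => ?_
  rw [Finset.sum_mul]
  exact Finset.sum_congr rfl fun k _ => by ring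

variable {Ω : Type*} [MeasurableSpace Ω] {P : Measure Ω} [IsProbabilityMeasure P]

omit [IsProbabilityMeasure P] in
lemma hasLaw_apply_of_gaussianVec {ι : Type*} [Fintype ι] {v : ι → ℝ≥0} {X : Ω → ι → ℝ}
    (hX : HasLaw X (gaussianVec v) P) (i : ι) :
    HasLaw (fun ω => X ω i) (gaussianReal 0 (v i)) P where
  aemeasurable := (measurable_pi_apply i).comp_aemeasurable hX.aemeasurable
  map_eq := by
    rw [← (measurePreserving_eval (fun i => gaussianReal 0 (v i)) i).map_eq]
    change _ = (gaussianVec v).map _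
    rw [← hX.map_eq, AEMeasurable.map_map_of_aemeasurable (measurable_pi_apply i).aemeasurable
      hX.aemeasurable]
    rfl

lemma iIndepFun_of_hasLaw_gaussianVec {ι : Type*} [Fintype ι] {v : ι → ℝ≥0} {X : Ω → ι → ℝ}
    (hX : HasLaw X (gaussianVec v) P) : iIndepFun (fun i ω => X ω i) P := by
  rw [iIndepFun_iff_map_fun_eq_pi_map fun i => (hasLaw_apply_of_gaussianVec hX i).aemeasurable]
  simp_rw [fun i => (hasLaw_apply_of_gaussianVec hX i).map_eq]
  exact hX.map_eq

variable {σ σlam : ℝ} {lam : ℤ → Ω → ℝ} {eps : ℕ → ℤ → Ω → ℝ} {α : ℕ → ℤ → ℝ} {J : ℕ → ℕ} {c : ℝ}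

/-- The entries of the sample covariance matrix of the idiosyncratic shocks concentrate at a
geometric rate, uniformly in the units. Products are reduced to squares by polarization. -/
lemma IsGaussianModel.exists_rate_gram (h : IsGaussianModel P σ σlam lam eps) {η : ℝ}
    (hη : 0 < η) : ∃ ρ : ℝ, 0 ≤ ρ ∧ ρ < 1 ∧ ∀ (n i k : ℕ),
      P.real {ω | n * η < |((fun s : prePeriods n => eps i s ω) ⬝ᵥ fun s => eps k s ω)
        - if i = k then n * σ ^ 2 else 0|} ≤ 4 * ρ ^ n := by
  obtain ⟨ρ₁, h10, h11, h1⟩ := exists_rate_sum_sq_gaussian (P := P) (σ ^ 2).toNNReal hη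
  obtain ⟨ρ₂, h20, h21, h2⟩ := exists_rate_sum_sq_gaussian (P := P) (2 * σ ^ 2).toNNReal
    (by positivity : 0 < 2 * η)
  have hpow₁ : ∀ n, ρ₁ ^ n ≤ max ρ₁ ρ₂ ^ n := fun n => pow_le_pow_left₀ h10 (le_max_left _ _) n
  have hpow₂ : ∀ n, ρ₂ ^ n ≤ max ρ₁ ρ₂ ^ n := fun n => pow_le_pow_left₀ h20 (le_max_right _ _) n
  have hpow0 : ∀ n, 0 ≤ max ρ₁ ρ₂ ^ n := fun n => (pow_nonneg h10 n).trans (hpow₁ n)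
  refine ⟨max ρ₁ ρ₂, le_max_of_le_left h10, max_lt h11 h21, fun n i k => ?_⟩
  have hcard : (Finset.univ : Finset (prePeriods n)).card = n := card_prePeriods n
  by_cases hik : i = k
  · subst hik
    have hlaw : HasLaw (fun ω (s : prePeriods n) => eps i s ω)
        (gaussianVec fun _ : prePeriods n => (σ ^ 2).toNNReal) P :=
      hasLaw_gaussianVec_of_iIndepFun h.law h.indep
        (f := fun s : prePeriods n => Sum.inr (i, preTime n s)) fun s s' hs =>
          preTime_injective n (by simpa using hs)
    have hb := h1 _ (iIndepFun_of_hasLaw_gaussianVec hlaw) (hasLaw_apply_of_gaussianVec hlaw)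
      Finset.univ
    rw [hcard, Real.coe_toNNReal _ (sq_nonneg σ)] at hb
    refine (measureReal_mono fun ω hω => ?_).trans (hb.trans ?_)
    · change n * η < |_ - ite _ _ _| at hω
      change n * η ≤ |_|
      rw [if_pos rfl] at hω
      simp only [sq (eps i _ _)]
      exact hω.le
    · linarith [hpow₁ n, hpow0 n]
  · have hlaw : ∀ y : ℝ, y ^ 2 = 1 →
        HasLaw (fun ω (s : prePeriods n) => eps i s ω + y * eps k s ω)
          (gaussianVec fun _ : prePeriods n => (2 * σ ^ 2).toNNReal) P := by
      intro y hy
      have hj : HasLaw (fun ω (p : Bool × prePeriods n) => shock lam eps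
          (Sum.inr (cond p.1 i k, preTime n p.2)) ω)
          (gaussianVec fun _ : Bool × prePeriods n => (σ ^ 2).toNNReal) P :=
        hasLaw_gaussianVec_of_iIndepFun h.law h.indep
          (f := fun p : Bool × prePeriods n => Sum.inr (cond p.1 i k, preTime n p.2)) (by
            rintro ⟨b, s⟩ ⟨b', s'⟩ hs
            simp only [Sum.inr.injEq, Prod.mk.injEq] at hs
            have hb : b = b' := by
              rcases b <;> rcases b' <;> simp_all [eq_comm]
            rw [hb, preTime_injective n hs.2])
      have hmap := map_combination_gaussianVec (ι := prePeriods n)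
        (fun _ : Bool => (σ ^ 2).toNNReal) (fun b => cond b 1 y)
      have hm : Measurable fun (z : Bool × prePeriods n → ℝ) (s : prePeriods n) =>
        ∑ b, cond b 1 y * z (b, s) := by fun_prop
      have hv : (∑ b : Bool, (((σ ^ 2).toNNReal : ℝ≥0) : ℝ) * (cond b 1 y) ^ 2) = 2 * σ ^ 2 := by
        rw [Fintype.sum_bool, Real.coe_toNNReal _ (sq_nonneg σ), cond_true, cond_false, hy]
        ring
      rw [hv, ← hj.map_eq, AEMeasurable.map_map_of_aemeasurable hm.aemeasurable hj.aemeasurable]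
        at hmap
      have hfun : (fun (z : Bool × prePeriods n → ℝ) (s : prePeriods n) =>
          ∑ b, cond b 1 y * z (b, s)) ∘ (fun ω (p : Bool × prePeriods n) => shock lam eps
          (Sum.inr (cond p.1 i k, preTime n p.2)) ω)
          = fun ω (s : prePeriods n) => eps i s ω + y * eps k s ω := by
        funext ω s
        simp only [Function.comp, Fintype.sum_bool, cond_true, cond_false, one_mul]
        rfl
      rw [hfun] at hmap
      refine ⟨?_, hmap⟩
      rw [← hfun]
      exact hm.comp_aemeasurable hj.aemeasurable
    have hb : ∀ y : ℝ, y ^ 2 = 1 → P.real {ω | n * (2 * η) ≤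
        |∑ s : prePeriods n, (eps i s ω + y * eps k s ω) ^ 2 - n * (2 * σ ^ 2)|} ≤ 2 * ρ₂ ^ n := by
      intro y hy
      have := h2 _ (iIndepFun_of_hasLaw_gaussianVec (hlaw y hy))
        (hasLaw_apply_of_gaussianVec (hlaw y hy)) Finset.univ
      rwa [hcard, Real.coe_toNNReal _ (by positivity)] at this
    have hp := hb 1 (by norm_num)
    have hm := hb (-1) (by norm_num)
    refine (measureReal_mono (fun ω hω => ?_) (measure_ne_top P _)).trans
      ((measureReal_union_le _ _).trans ((add_le_add hp hm).trans ?_))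
    · change n * η < |_ - ite _ _ _| at hω
      rw [if_neg hik, sub_zero] at hω
      by_contra hcon
      have hcon' := not_or.1 hcon
      rw [Set.mem_ofPred_eq, Set.mem_ofPred_eq, not_le, not_le] at hcon'
      obtain ⟨hA, hB⟩ := hcon'
      have hpol : 4 * ((fun s : prePeriods n => eps i s ω) ⬝ᵥ fun s => eps k s ω)
          = ∑ s : prePeriods n, (eps i s ω + 1 * eps k s ω) ^ 2
            - ∑ s : prePeriods n, (eps i s ω + -1 * eps k s ω) ^ 2 := by
        rw [← Finset.sum_sub_distrib, dotProduct, Finset.mul_sum]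
        exact Finset.sum_congr rfl fun s _ => by ring
      rw [abs_lt] at hA hB
      rcases lt_abs.1 hω with h' | h' <;> linarith
    · linarith [hpow₂ n]

/-- With high probability all entries of the sample covariance matrix of the idiosyncratic shocks
are uniformly close to those of `σ² I`. -/
lemma IsGaussianModel.tendsto_measure_gram (h : IsGaussianModel P σ σlam lam eps)
    (hJn : ∀ᶠ n in atTop, J n ≤ n) {η : ℝ} (hη : 0 < η) :
    Tendsto (fun n => P.real {ω | ¬ ∀ i ≤ J n, ∀ k ≤ J n,
      |((fun s : prePeriods n => eps i s ω) ⬝ᵥ fun s => eps k s ω)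
        - if i = k then n * σ ^ 2 else 0| ≤ n * η}) atTop (𝓝 0) := by
  obtain ⟨ρ, h0, h1, hρ⟩ := h.exists_rate_gram hη
  -- union bound over `(J + 1)² ≤ 4 n²` pairs of units
  have hlim : Tendsto (fun n : ℕ => 16 * ((n : ℝ) ^ 2 * ρ ^ n)) atTop (𝓝 0) := by
    have := (tendsto_pow_const_mul_const_pow_of_abs_lt_one 2
      (show |ρ| < 1 by rwa [abs_of_nonneg h0])).const_mul 16
    simpa using this
  refine tendsto_of_tendsto_of_tendsto_of_le_of_le' tendsto_const_nhds hlim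
    (Eventually.of_forall fun _ => measureReal_nonneg) ?_
  filter_upwards [hJn, eventually_ge_atTop 1] with n hn hn1
  set B : ℕ × ℕ → Set Ω := fun p => {ω | n * η <
    |((fun s : prePeriods n => eps p.1 s ω) ⬝ᵥ fun s => eps p.2 s ω)
        - if p.1 = p.2 then n * σ ^ 2 else 0|} with hB
  have hsub : {ω | ¬ ∀ i ≤ J n, ∀ k ≤ J n,
      |((fun s : prePeriods n => eps i s ω) ⬝ᵥ fun s => eps k s ω)
        - if i = k then n * σ ^ 2 else 0| ≤ n * η}
      ⊆ ⋃ p ∈ Finset.range (J n + 1) ×ˢ Finset.range (J n + 1), B p := by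
    intro ω hω
    rw [Set.mem_ofPred_eq] at hω
    push Not at hω
    obtain ⟨i, hi, k, hk, hik⟩ := hω
    simp only [Set.mem_iUnion]
    exact ⟨(i, k), Finset.mem_product.2 ⟨Finset.mem_range.2 (by simp; omega),
      Finset.mem_range.2 (by simp; omega)⟩, hik⟩
  refine (measureReal_mono hsub (measure_ne_top P _)).trans
    ((measureReal_biUnion_finset_le _ _).trans ?_)
  refine (Finset.sum_le_sum fun p _ => hρ n p.1 p.2).trans ?_
  rw [Finset.sum_const, Finset.card_product, Finset.card_range, nsmul_eq_mul]
  have hle : (((J n + 1) * (J n + 1) : ℕ) : ℝ) ≤ 4 * (n : ℝ) ^ 2 := by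
    have : (J n + 1) * (J n + 1) ≤ (2 * n) * (2 * n) := Nat.mul_le_mul (by omega) (by omega)
    calc (((J n + 1) * (J n + 1) : ℕ) : ℝ) ≤ (((2 * n) * (2 * n) : ℕ) : ℝ) := by exact_mod_cast this
      _ = 4 * (n : ℝ) ^ 2 := by push_cast; ring
  calc (((J n + 1) * (J n + 1) : ℕ) : ℝ) * (4 * ρ ^ n) ≤ 4 * (n : ℝ) ^ 2 * (4 * ρ ^ n) :=
        mul_le_mul_of_nonneg_right hle (by positivity)
    _ = 16 * ((n : ℝ) ^ 2 * ρ ^ n) := by ring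

end GramConcentration

/-! ### Diversification of synthetic control weights -/

section SimplexWeights

/-- A quadratic form whose matrix is entrywise close to `v I` is close to `v` times the squared
length, relative to the `ℓ¹` norm of its argument. -/
lemma abs_sum_combination_sq_sub_le {κ ι : Type*} [Fintype κ] [DecidableEq κ] [Fintype ι]
    (u : κ → ℝ) (e : κ → ι → ℝ) {v δ : ℝ}
    (hG : ∀ a b, |e a ⬝ᵥ e b - if a = b then v else 0| ≤ δ) :
    |∑ i, (∑ a, u a * e a i) ^ 2 - v * ∑ a, u a ^ 2| ≤ δ * (∑ a, |u a|) ^ 2 := by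
  have h1 : ∑ i, (∑ a, u a * e a i) ^ 2 = ∑ a, ∑ b, u a * u b * (e a ⬝ᵥ e b) := by
    simp_rw [sq, Finset.sum_mul_sum, dotProduct, Finset.mul_sum]
    rw [Finset.sum_comm]
    refine Finset.sum_congr rfl fun a _ => ?_
    rw [Finset.sum_comm]
    exact Finset.sum_congr rfl fun b _ => Finset.sum_congr rfl fun i _ => by ring
  have h2 : v * ∑ a, u a ^ 2 = ∑ a, ∑ b, u a * u b * (if a = b then v else 0) := by
    rw [Finset.mul_sum]
    refine Finset.sum_congr rfl fun a _ => ?_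
    simp only [mul_ite, mul_zero, Finset.sum_ite_eq, Finset.mem_univ, if_true]
    ring
  rw [h1, h2, ← Finset.sum_sub_distrib, sq, Finset.sum_mul_sum, Finset.mul_sum]
  refine (Finset.abs_sum_le_sum_abs _ _).trans (Finset.sum_le_sum fun a _ => ?_)
  rw [← Finset.sum_sub_distrib, Finset.mul_sum]
  refine (Finset.abs_sum_le_sum_abs _ _).trans (Finset.sum_le_sum fun b _ => ?_)
  rw [← mul_sub, abs_mul, abs_mul, mul_comm δ]
  exact mul_le_mul_of_nonneg_left (hG a b) (by positivity)

variable {Ω : Type*} {σ : ℝ} {lam : ℤ → Ω → ℝ} {eps : ℕ → ℤ → Ω → ℝ} {α : ℕ → ℤ → ℝ}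

/-- On the simplex the common factor cancels from the residuals, so that the loss is `σ² (1 + w'w)`
up to the sampling error of the covariances of the idiosyncratic shocks. -/
lemma abs_preTreatmentLoss_sub_le {n J : ℕ} (hn : n ≠ 0) {ω : Ω} {η : ℝ}
    (hG : ∀ i ≤ J, ∀ k ≤ J, |((fun s : prePeriods n => eps i s ω) ⬝ᵥ fun s => eps k s ω)
        - if i = k then n * σ ^ 2 else 0| ≤ n * η)
    {w : Fin J → ℝ} (hw : w ∈ stdSimplex ℝ (Fin J)) :
    |preTreatmentLoss (fun i s => outcome α lam eps i s ω) n J w - σ ^ 2 * (1 + w ⬝ᵥ w)|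
      ≤ 4 * η := by
  have hn' : (0 : ℝ) < n := by exact_mod_cast Nat.pos_of_ne_zero hn
  set u : Option (Fin J) → ℝ := fun a => a.elim 1 fun j => -w j with hu
  set unit : Option (Fin J) → ℕ := fun a => a.elim 0 fun j => (j : ℕ) + 1 with hunit
  have hinj : ∀ a b, unit a = unit b ↔ a = b := by
    rintro (_ | j) (_ | k) <;> simp [hunit, Fin.ext_iff]
  have hle : ∀ a, unit a ≤ J := by
    rintro (_ | j)
    · exact Nat.zero_le _
    · exact j.2
  have key := abs_sum_combination_sq_sub_le u
    (fun a (s : prePeriods n) => eps (unit a) s ω) (v := n * σ ^ 2) (δ := n * η) fun a b => by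
      have := hG (unit a) (hle a) (unit b) (hle b)
      simpa only [hinj] using this
  have hu1 : ∑ a, |u a| = 2 := by
    rw [Fintype.sum_option]
    simp only [hu, Option.elim_none, Option.elim_some, abs_one, abs_neg]
    rw [Finset.sum_congr rfl fun j _ => abs_of_nonneg (hw.1 j), hw.2]
    norm_num
  have hu2 : ∑ a, u a ^ 2 = 1 + w ⬝ᵥ w := by
    rw [Fintype.sum_option]
    simp only [hu, Option.elim_none, Option.elim_some, sq, neg_mul_neg, one_mul, dotProduct]
  have hloss : preTreatmentLoss (fun i s => outcome α lam eps i s ω) n J w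
      = (1 / n) * ∑ s : prePeriods n, (∑ a, u a * eps (unit a) s ω) ^ 2 := by
    rw [preTreatmentLoss_eq, dotProduct]
    congr 1
    refine Finset.sum_congr rfl fun s _ => ?_
    rw [← sq]
    congr 1
    simp only [Pi.sub_apply, mulVec, dotProduct, controlMatrix_apply, add_mul,
      Finset.sum_add_distrib, ← Finset.mul_sum, hw.2, Fintype.sum_option]
    simp only [hu, hunit, Option.elim_none, Option.elim_some, neg_mul, Finset.sum_neg_distrib,
      treatedVec, preData, controlData, columnShock, shock, treatedNoise, Sum.elim_inl,
      Sum.elim_inr, preTime]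
    simp only [mul_comm (w _)]
    ring
  rw [hu1, hu2] at key
  have hfac : preTreatmentLoss (fun i s => outcome α lam eps i s ω) n J w - σ ^ 2 * (1 + w ⬝ᵥ w)
      = (1 / n) * (∑ s : prePeriods n, (∑ a, u a * eps (unit a) s ω) ^ 2
        - n * σ ^ 2 * (1 + w ⬝ᵥ w)) := by
    rw [hloss]
    field_simp
  rw [hfac, abs_mul, abs_of_pos (by positivity : (0 : ℝ) < 1 / n)]
  calc 1 / n * |∑ s : prePeriods n, (∑ a, u a * eps (unit a) s ω) ^ 2
        - n * σ ^ 2 * (1 + w ⬝ᵥ w)| ≤ 1 / n * (n * η * 2 ^ 2) :=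
        mul_le_mul_of_nonneg_left key (by positivity)
    _ = 4 * η := by field_simp; norm_num

/-- Comparison with equal weights: no unit can receive a substantial weight. -/
lemma IsSCWeights.dotProduct_self_le (hσ : 0 < σ) {n J : ℕ} (hn : n ≠ 0) (hJ : J ≠ 0) {ω : Ω}
    {η : ℝ} (hG : ∀ i ≤ J, ∀ k ≤ J, |((fun s : prePeriods n => eps i s ω) ⬝ᵥ fun s => eps k s ω)
        - if i = k then n * σ ^ 2 else 0| ≤ n * η)
    {w : Fin J → ℝ} (hw : IsSCWeights (fun i s => outcome α lam eps i s ω) n J w) :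
    w ⬝ᵥ w ≤ 1 / J + 8 * η / σ ^ 2 := by
  have hJ' : (J : ℝ) ≠ 0 := by exact_mod_cast hJ
  have hu : (fun _ => 1 / (J : ℝ)) ∈ stdSimplex ℝ (Fin J) :=
    ⟨fun _ => by positivity, by simp [hJ']⟩
  have h0 : (fun _ : Fin J => 1 / (J : ℝ)) ⬝ᵥ (fun _ => 1 / (J : ℝ)) = 1 / J := by
    simp only [dotProduct, Finset.sum_const, Finset.card_univ, Fintype.card_fin, nsmul_eq_mul]
    field_simp
  have h1 := abs_le.1 (abs_preTreatmentLoss_sub_le (α := α) (lam := lam) hn hG hw.1)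
  have h2 := abs_le.1 (abs_preTreatmentLoss_sub_le (α := α) (lam := lam) hn hG hu)
  have h3 : preTreatmentLoss (fun i s => outcome α lam eps i s ω) n J w
      ≤ preTreatmentLoss (fun i s => outcome α lam eps i s ω) n J _ := hw.2 hu
  rw [h0] at h2
  have h4 : σ ^ 2 * (w ⬝ᵥ w) ≤ σ ^ 2 * (1 / J + 8 * η / σ ^ 2) := by
    rw [mul_add, mul_div_cancel₀ _ (by positivity : σ ^ 2 ≠ 0)]
    linarith [h1.1, h2.2]
  exact le_of_mul_le_mul_left h4 (by positivity)

variable [MeasurableSpace Ω] {P : Measure Ω} [IsProbabilityMeasure P] {σlam : ℝ} {J : ℕ → ℕ}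

/-- Synthetic control weights spread out over the controls, so that the prediction variance tends to
the variance of the noise of unit `0`. -/
lemma IsGaussianModel.tendstoInMeasure_predictionVar_sc (h : IsGaussianModel P σ σlam lam eps)
    (hJ : Tendsto J atTop atTop) (hJn : ∀ᶠ n in atTop, J n ≤ n) {w : (n : ℕ) → Ω → Fin (J n) → ℝ}
    (hw : ∀ᶠ n in atTop, ∀ᵐ ω ∂P,
      IsSCWeights (fun i s => outcome α lam eps i s ω) n (J n) (w n ω)) :
    TendstoInMeasure P (fun n ω => predictionVar σ σlam (w n ω)) atTop fun _ => σ ^ 2 := by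
  have hσ := h.pos
  rw [tendstoInMeasure_iff_measureReal_dist]
  intro ε hε
  -- `8 η = ε / 4`, which leaves room for `σ² / J < ε / 2`
  have hη : 0 < ε / 32 := by positivity
  refine tendsto_of_tendsto_of_tendsto_of_le_of_le' tendsto_const_nhds
    (h.tendsto_measure_gram hJn hη) (Eventually.of_forall fun _ => measureReal_nonneg) ?_
  have hJinv : Tendsto (fun n => σ ^ 2 / (J n : ℝ)) atTop (𝓝 0) :=
    (tendsto_const_div_atTop_nhds_zero_nat (σ ^ 2)).comp hJ
  filter_upwards [hw, eventually_gt_atTop 0, hJ.eventually_gt_atTop 0,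
    hJinv.eventually_lt_const (show 0 < ε / 2 by positivity)] with n hwn hn hJ0 hJε
  rw [measureReal_def, measureReal_def]
  refine ENNReal.toReal_mono (measure_ne_top P _) (measure_mono_ae ?_)
  filter_upwards [hwn] with ω hω hdist
  change ¬ _
  intro hG
  have hb := IsSCWeights.dotProduct_self_le hσ hn.ne' hJ0.ne' hG hω
  have h0 := dotProduct_self_nonneg (w n ω)
  have hval : predictionVar σ σlam (w n ω) = σ ^ 2 + σ ^ 2 * (w n ω ⬝ᵥ w n ω) := by
    rw [predictionVar, hω.1.2]
    ring
  have hdist' : ε ≤ dist (predictionVar σ σlam (w n ω)) (σ ^ 2) := hdist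
  rw [hval, Real.dist_eq, add_sub_cancel_left, abs_of_nonneg (by positivity)] at hdist'
  have hb2 := mul_le_mul_of_nonneg_left hb (sq_nonneg σ)
  rw [mul_add, mul_div_cancel₀ _ (by positivity : σ ^ 2 ≠ 0), mul_one_div] at hb2
  linarith

end SimplexWeights

/-! ### Measurability of unique minimizers -/

section Argmin

/-- A minimizer over a compact set that is unique for data in `G` depends measurably on the data: the data for which it lies
in a closed set form the projection of a closed set along a compact factor. -/
lemma exists_measurable_argmin {𝓓 E : Type*} [TopologicalSpace 𝓓] [MeasurableSpace 𝓓]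
    [OpensMeasurableSpace 𝓓] [TopologicalSpace E] [MeasurableSpace E] [BorelSpace E] {K : Set E}
    (hK : IsCompact K) (hne : K.Nonempty) {F : 𝓓 → E → ℝ}
    (hF : Continuous fun p : 𝓓 × E => F p.1 p.2) {G : Set 𝓓} (hG : MeasurableSet G)
    (huniq : ∀ d ∈ G, ∀ w ∈ K, ∀ w' ∈ K, IsMinOn (F d) K w → IsMinOn (F d) K w' → w = w') :
    ∃ β : 𝓓 → E, Measurable β ∧ ∀ d ∈ G, ∀ w ∈ K, IsMinOn (F d) K w → w = β d := by
  classical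
  have hex : ∀ d, ∃ w ∈ K, IsMinOn (F d) K w := fun d =>
    hK.exists_isMinOn hne (hF.comp (Continuous.prodMk_right d)).continuousOn
  choose f hfK hfmin using hex
  obtain ⟨e, -⟩ := hne
  refine ⟨G.piecewise f fun _ => e, measurable_of_isClosed fun C hC => ?_, fun d hd w hw hmin => ?_⟩
  · set A : Set 𝓓 := {d | ∃ w ∈ K, w ∈ C ∧ IsMinOn (F d) K w} with hA
    have hAc : IsClosed A := by
      have : CompactSpace K := isCompact_iff_compactSpace.1 hK
      have hT : IsClosed {p : 𝓓 × K | (p.2 : E) ∈ C ∧ ∀ w' ∈ K, F p.1 p.2 ≤ F p.1 w'} := by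
        refine IsClosed.inter (hC.preimage (continuous_subtype_val.comp continuous_snd)) ?_
        have : {p : 𝓓 × K | ∀ w' ∈ K, F p.1 p.2 ≤ F p.1 w'}
            = ⋂ w' ∈ K, {p : 𝓓 × K | F p.1 p.2 ≤ F p.1 w'} := by
          ext p
          rw [Set.mem_iInter₂]
          exact Iff.rfl
        change IsClosed {p : 𝓓 × K | ∀ w' ∈ K, F p.1 p.2 ≤ F p.1 w'}
        rw [this]
        refine isClosed_biInter fun w' _ => isClosed_le ?_ ?_
        · exact hF.comp (continuous_fst.prodMk (continuous_subtype_val.comp continuous_snd))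
        · exact hF.comp (continuous_fst.prodMk continuous_const)
      convert isClosedMap_fst_of_compactSpace _ hT using 1
      ext d
      constructor
      · rintro ⟨w, hw, hwC, hmin⟩
        exact ⟨(d, ⟨w, hw⟩), ⟨hwC, fun w' hw' => hmin hw'⟩, rfl⟩
      · rintro ⟨⟨d', w⟩, ⟨hwC, hmin⟩, rfl⟩
        exact ⟨w, w.2, hwC, fun w' hw' => hmin w' hw'⟩
    have hpre : G.piecewise f (fun _ => e) ⁻¹' C = G.ite A ((fun _ => e) ⁻¹' C) := by
      rw [Set.piecewise_preimage]
      ext d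
      by_cases hd : d ∈ G
      · simp only [Set.ite, Set.mem_union, Set.mem_inter_iff, hd, Set.mem_sdiff, not_true_eq_false,
          and_true, and_false, or_false, Set.mem_preimage]
        constructor
        · exact fun h => ⟨f d, hfK d, h, hfmin d⟩
        · rintro ⟨w, hw, hwC, hmin⟩
          rwa [← huniq d hd w hw (f d) (hfK d) hmin (hfmin d)]
      · simp [Set.ite, hd]
    rw [hpre]
    exact hG.ite hAc.measurableSet (measurable_const hC.measurableSet)
  · rw [Set.piecewise_eq_of_mem _ _ _ hd]
    exact huniq d hd w hw (f d) (hfK d) hmin (hfmin d)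

/-- Linearly independent regressors make the least squares criterion strictly convex. -/
lemma eq_of_isMinOn_sumSq {ι κ : Type*} [Fintype ι] [Fintype κ] [DecidableEq κ]
    {X : Matrix ι κ ℝ} (hX : IsUnit (Xᵀ * X).det) {y : ι → ℝ} {K : Set (κ → ℝ)} (hK : Convex ℝ K)
    {w w' : κ → ℝ} (hw : w ∈ K) (hw' : w' ∈ K)
    (hmin : IsMinOn (fun b => (y - X *ᵥ b) ⬝ᵥ (y - X *ᵥ b)) K w)
    (hmin' : IsMinOn (fun b => (y - X *ᵥ b) ⬝ᵥ (y - X *ᵥ b)) K w') : w = w' := by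
  have hmid : (1 / 2 : ℝ) • w + (1 / 2 : ℝ) • w' ∈ K :=
    hK hw hw' (by norm_num) (by norm_num) (by norm_num)
  have h1 : (y - X *ᵥ w) ⬝ᵥ (y - X *ᵥ w) ≤ _ := hmin hmid
  have h2 : (y - X *ᵥ w') ⬝ᵥ (y - X *ᵥ w') ≤ _ := hmin' hmid
  -- parallelogram law for the residuals at the two minimizers
  have hpar : (y - X *ᵥ ((1 / 2 : ℝ) • w + (1 / 2 : ℝ) • w'))
        ⬝ᵥ (y - X *ᵥ ((1 / 2 : ℝ) • w + (1 / 2 : ℝ) • w'))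
      = ((y - X *ᵥ w) ⬝ᵥ (y - X *ᵥ w) + (y - X *ᵥ w') ⬝ᵥ (y - X *ᵥ w')) / 2
        - (X *ᵥ (w - w')) ⬝ᵥ (X *ᵥ (w - w')) / 4 := by
    simp only [mulVec_add, mulVec_smul, mulVec_sub, sub_dotProduct, dotProduct_sub, add_dotProduct,
      dotProduct_add, smul_dotProduct, dotProduct_smul, smul_eq_mul,
      dotProduct_comm (X *ᵥ w) y, dotProduct_comm (X *ᵥ w') y,
      dotProduct_comm (X *ᵥ w') (X *ᵥ w)]
    ring
  have h0 := dotProduct_self_nonneg (X *ᵥ (w - w'))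
  have hz : (X *ᵥ (w - w')) ⬝ᵥ (X *ᵥ (w - w')) = 0 := by
    simp only [hpar] at h1 h2
    linarith
  exact sub_eq_zero.1 (mulVec_eq_zero_of_gram hX (dotProduct_self_eq_zero.1 hz))

end Argmin

/-! ### Synthetic control weights as a function of the data -/

section SyntheticControlWeights

variable {Ω : Type*} {lam : ℤ → Ω → ℝ} {eps : ℕ → ℤ → Ω → ℝ} {α : ℕ → ℤ → ℝ}

/-- For linearly independent control outcomes, the synthetic control weights are a measurable
function of the pre-treatment data. -/
lemma exists_measurable_scWeights {n J : ℕ} (hn : n ≠ 0) (hJ : J ≠ 0) :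
    ∃ β : (Option (Fin J) × prePeriods n → ℝ) × (prePeriods n → ℝ) → Fin J → ℝ, Measurable β ∧
      ∀ ω, IsUnit ((controlMatrix (preData lam eps n J ω).1)ᵀ
          * controlMatrix (preData lam eps n J ω).1).det →
        ∀ w, IsSCWeights (fun i s => outcome α lam eps i s ω) n J w →
          w = β (preData lam eps n J ω) := by
  have : NeZero J := ⟨hJ⟩
  obtain ⟨β, hβ, hmin⟩ := exists_measurable_argmin (isCompact_stdSimplex ℝ (Fin J))
    (⟨_, single_mem_stdSimplex ℝ (0 : Fin J)⟩ : (stdSimplex ℝ (Fin J)).Nonempty)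
    (F := fun (d : (Option (Fin J) × prePeriods n → ℝ) × (prePeriods n → ℝ)) b =>
      (treatedVec d - controlMatrix d.1 *ᵥ b) ⬝ᵥ (treatedVec d - controlMatrix d.1 *ᵥ b))
    (by
      simp only [dotProduct, Pi.sub_apply, mulVec, controlMatrix_apply, treatedVec]
      fun_prop)
    (G := {d | IsUnit ((controlMatrix d.1)ᵀ * controlMatrix d.1).det})
    (measurable_fst (measurableSet_isUnit_det_gram (loadings J)))
    fun d hd w hw w' hw' h h' => eq_of_isMinOn_sumSq hd (convex_stdSimplex ℝ (Fin J)) hw hw' h h'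
  refine ⟨β, hβ, fun ω hω w hw => hmin _ hω w hw.1 fun w' hw' => ?_⟩
  have h : preTreatmentLoss _ n J w ≤ preTreatmentLoss _ n J w' := hw.2 hw'
  rw [preTreatmentLoss_eq, preTreatmentLoss_eq] at h
  have hn' : (0 : ℝ) < n := by exact_mod_cast Nat.pos_of_ne_zero hn
  exact le_of_mul_le_mul_left h (by positivity)

end SyntheticControlWeights

/-! ### Limit laws and limit variances -/

section Limits

variable {Ω : Type*} [MeasurableSpace Ω] {P : Measure Ω} [IsProbabilityMeasure P] {σ σlam : ℝ}
  {lam : ℤ → Ω → ℝ} {eps : ℕ → ℤ → Ω → ℝ} {α : ℕ → ℤ → ℝ} {J : ℕ → ℕ}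

omit [IsProbabilityMeasure P] in
lemma IsGaussianModel.eventually_ae_eq_olsCoef (h : IsGaussianModel P σ σlam lam eps)
    (hJn : ∀ᶠ n in atTop, J n ≤ n) {b : (n : ℕ) → Ω → Fin (J n) → ℝ}
    (hols : ∀ᶠ n in atTop, ∀ᵐ ω ∂P,
      IsOLSWeights (fun i s => outcome α lam eps i s ω) n (J n) (b n ω)) :
    ∀ᶠ n in atTop, ∀ᵐ ω ∂P, b n ω = olsCoef (preData lam eps n (J n) ω) := by
  filter_upwards [hols, hJn, eventually_ne_atTop 0] with n hn hJn hn0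
  filter_upwards [hn, h.ae_isUnit_controlMatrix hJn] with ω hω hz
  exact hω.eq_olsCoef hn0 hz

/-- The synthetic control estimator is asymptotically Gaussian with the variance of the noise of
unit `0`. -/
lemma IsGaussianModel.tendstoInDistribution_sc (h : IsGaussianModel P σ σlam lam eps)
    (hJ : Tendsto J atTop atTop) (hJn : ∀ᶠ n in atTop, J n ≤ n) {w : (n : ℕ) → Ω → Fin (J n) → ℝ}
    (hwm : ∀ n, AEMeasurable (w n) P)
    (hsc : ∀ᶠ n in atTop, ∀ᵐ ω ∂P,
      IsSCWeights (fun i s => outcome α lam eps i s ω) n (J n) (w n ω)) {t : ℤ} (ht : 0 < t) :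
    TendstoInDistribution
      (fun n ω => effectEstimator (fun i s => outcome α lam eps i s ω) (w n ω) t)
      atTop id (fun _ => P) (gaussianReal (α 0 t) (σ ^ 2).toNNReal) := by
  have hβ : ∀ n, ∃ β : (Option (Fin (J n)) × prePeriods n → ℝ) × (prePeriods n → ℝ) →
      Fin (J n) → ℝ, n ≠ 0 → J n ≠ 0 → Measurable β ∧
      ∀ ω, IsUnit ((controlMatrix (preData lam eps n (J n) ω).1)ᵀ
          * controlMatrix (preData lam eps n (J n) ω).1).det →
        ∀ w, IsSCWeights (fun i s => outcome α lam eps i s ω) n (J n) w →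
          w = β (preData lam eps n (J n) ω) := by
    intro n
    by_cases hn : n ≠ 0 ∧ J n ≠ 0
    · obtain ⟨β, hβ⟩ := exists_measurable_scWeights (α := α) (lam := lam) (eps := eps) hn.1 hn.2
      exact ⟨β, fun _ _ => hβ⟩
    -- without periods or controls there is nothing to select
    · exact ⟨0, fun h1 h2 => absurd ⟨h1, h2⟩ hn⟩
  choose β hβ using hβ
  have hpos := (eventually_ne_atTop 0).and (hJ.eventually_ne_atTop 0)
  refine h.tendstoInDistribution_effectEstimator ht hwm (β := β)
    (hpos.mono fun n hn => (hβ n hn.1 hn.2).1) ?_ (sq_nonneg σ)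
    (h.tendstoInMeasure_predictionVar_sc hJ hJn hsc)
  filter_upwards [hsc, hJn, hpos] with n hn hJn hp
  filter_upwards [hn, h.ae_isUnit_controlMatrix hJn] with ω hω hz
  exact (hβ n hp.1 hp.2).2 ω hz _ hω

lemma tendsto_div_one_sub_nhdsLT_one {v : ℝ} (hv : 0 < v) :
    Tendsto (fun r : ℝ => v / (1 - r)) (𝓝[<] 1) atTop := by
  have h0 : Tendsto (fun r : ℝ => 1 - r) (𝓝[<] 1) (𝓝[>] 0) := by
    refine tendsto_nhdsWithin_iff.2 ⟨?_, ?_⟩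
    · have : Tendsto (fun r : ℝ => 1 - r) (𝓝 1) (𝓝 (1 - 1)) :=
        (continuous_const.sub continuous_id).tendsto 1
      rw [sub_self] at this
      exact this.mono_left nhdsWithin_le_nhds
    · filter_upwards [self_mem_nhdsWithin] with r hr
      exact Set.mem_Ioi.2 (sub_pos.2 (Set.mem_Iio.1 hr))
  simp only [div_eq_mul_inv]
  exact (tendsto_inv_nhdsGT_zero.comp h0).const_mul_atTop hv

end Limits

end SyntheticControl

theorem mainTheorem6
    {Ω : Type*} [MeasurableSpace Ω] (P : Measure Ω) [IsProbabilityMeasure P]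
    (σ σlam : ℝ) (hσ : 0 < σ) (hσlam : 0 < σlam)
    (lam : ℤ → Ω → ℝ) (eps : ℕ → ℤ → Ω → ℝ)
    (hlam : ∀ t, HasLaw (lam t) (gaussianReal 0 (σlam ^ 2).toNNReal) P)
    (heps : ∀ i t, HasLaw (eps i t) (gaussianReal 0 (σ ^ 2).toNNReal) P)
    (hindep : iIndepFun
      (Sum.elim lam (fun p : ℕ × ℤ => eps p.1 p.2) : ℤ ⊕ (ℕ × ℤ) → Ω → ℝ) P)
    (α : ℕ → ℤ → ℝ)
    (J : ℕ → ℕ) (hJ : Tendsto J atTop atTop)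
    (c : ℝ) (hc0 : 0 ≤ c) (hc1 : c < 1)
    (hJc : Tendsto (fun T₀ : ℕ => (J T₀ : ℝ) / (T₀ : ℝ)) atTop (𝓝 c)) :
    -- the OLS weights and the OLS treatment-effect estimator
    (∀ b : (T₀ : ℕ) → Ω → (Fin (J T₀) → ℝ),
      (∀ T₀, AEMeasurable (b T₀) P) →
      (∀ᶠ T₀ in atTop, ∀ᵐ ω ∂P, SyntheticControl.IsOLSWeights
        (fun i s => SyntheticControl.outcome α lam eps i s ω) T₀ (J T₀) (b T₀ ω)) →
      TendstoInMeasure P (fun T₀ ω => b T₀ ω ⬝ᵥ b T₀ ω) atTop (fun _ => c / (1 - c)) ∧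
      ∀ t : ℤ, 0 < t →
        TendstoInDistribution
          (fun T₀ ω => SyntheticControl.effectEstimator
            (fun i s => SyntheticControl.outcome α lam eps i s ω) (b T₀ ω) t)
          atTop id (fun _ => P) (gaussianReal (α 0 t) (σ ^ 2 / (1 - c)).toNNReal)) ∧
    -- the SC treatment-effect estimator
    (∀ w : (T₀ : ℕ) → Ω → (Fin (J T₀) → ℝ),
      (∀ T₀, AEMeasurable (w T₀) P) →
      (∀ᶠ T₀ in atTop, ∀ᵐ ω ∂P, SyntheticControl.IsSCWeights
        (fun i s => SyntheticControl.outcome α lam eps i s ω) T₀ (J T₀) (w T₀ ω)) →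
      ∀ t : ℤ, 0 < t →
        TendstoInDistribution
          (fun T₀ ω => SyntheticControl.effectEstimator
            (fun i s => SyntheticControl.outcome α lam eps i s ω) (w T₀ ω) t)
          atTop id (fun _ => P) (gaussianReal (α 0 t) (σ ^ 2).toNNReal)) ∧
    -- comparison of the variances of the limit laws, and divergence as the ratio tends to one
    (∀ t : ℤ, 0 < t →
      (c = 0 → Var[id; gaussianReal (α 0 t) (σ ^ 2 / (1 - c)).toNNReal] =
        Var[id; gaussianReal (α 0 t) (σ ^ 2).toNNReal]) ∧
      (0 < c → Var[id; gaussianReal (α 0 t) (σ ^ 2).toNNReal] <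
        Var[id; gaussianReal (α 0 t) (σ ^ 2 / (1 - c)).toNNReal]) ∧
      Tendsto (fun r : ℝ => Var[id; gaussianReal (α 0 t) (σ ^ 2 / (1 - r)).toNNReal])
        (𝓝[<] 1) atTop) := by
  have h : SyntheticControl.IsGaussianModel P σ σlam lam eps :=
    ⟨hσ, hσlam, by rintro (t | ⟨i, t⟩); exacts [hlam t, heps i t], hindep⟩
  have hJn := SyntheticControl.eventually_le_of_ratio hc1 hJc
  have h1c : 0 < 1 - c := by linarith
  refine ⟨fun b hbm hols => ?_, fun w hwm hsc t ht => h.tendstoInDistribution_sc hJ hJn hwm hsc ht,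
    fun t _ => ⟨?_, fun hc => ?_, ?_⟩⟩
  · have hb := h.eventually_ae_eq_olsCoef hJn hols
    exact ⟨h.tendstoInMeasure_dotProduct_ols hJ hc1 hJc hbm hb, fun t ht =>
      h.tendstoInDistribution_effectEstimator ht hbm
        (Eventually.of_forall fun _ => SyntheticControl.measurable_olsCoef) hb (by positivity)
        (h.tendstoInMeasure_predictionVar_ols hJ hc1 hJc hbm hb)⟩
  · rintro rfl
    rw [sub_zero, div_one]
  · rw [variance_id_gaussianReal, variance_id_gaussianReal, Real.coe_toNNReal _ (sq_nonneg σ),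
      Real.coe_toNNReal _ (by positivity), lt_div_iff₀ h1c]
    nlinarith [pow_pos hσ 2]
  · refine (SyntheticControl.tendsto_div_one_sub_nhdsLT_one (pow_pos hσ 2)).congr' ?_
    filter_upwards [self_mem_nhdsWithin] with r hr
    have : 0 < 1 - r := sub_pos.2 hr
    rw [variance_id_gaussianReal, Real.coe_toNNReal _ (by positivity)]
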